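/- Let $G$ be a (finite-dimensional, real, Hausdorff, second countable) Lie group and let $B, C \subset G$ be a matched pair of subgroups, i.e. closed subgroups (hence embedded Lie subgroups) with $B \cap C = \{e\}$ and $BC$ open in $G$. Let $\mathfrak g, \mathfrak b$ be the Lie algebras of $G, B$, and $\mathfrak b^0 = \{\phi \in \mathfrak g^* : \phi|_{\mathfrak b} = 0\}$. Let $\mathcal G_B$ be the Lie groupoid with base $B$, arrow space $BC \cap CB$, range and source $r(g) = b$, $s(g) = b'$ for $g = bc = c'b'$ ($b, b' \in B$, $c, c' \in C$), and composition $g \circ h = g\, s(g)^{-1} h$ when $s(g) = r(h)$. Its Lie algebroid $\mathcal L$ over $B$ has fibre $\mathcal L_b = \ker (\mathrm d r)_b \subset T_b G$ at $b$ (as units, the points of $B$ are arrows); the bracket $[X,Y]$ of smooth sections is the restriction to $B$ of the Lie bracket of the corresponding left invariant vector fields on $\mathcal G_B$, and the anchor is $\mathsf a(X) = \mathrm d s(X)$. Let $E = (TB)^0 \subset T^*G|_B$ be the bundle over $B$, with projection $\pi$, whose fibre at $b$ is $(T_bB)^0 \subset T_b^*G$. Then: 1. Right translations identify $E$ with $\mathfrak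 b^0 \times B$, the pair $(v,b)$ corresponding to the covector $v \circ (\mathrm d R_{b^{-1}})_b$ at $b$; and restriction of covectors to $\mathcal L$ identifies $E$ fibrewise with the dual bundle of $\mathcal L$. 2. There is a unique Poisson bracket on $C^\infty(E)$ such that, for all smooth sections $X, Y$ of $\mathcal L$ and all $f, h \in C^\infty(B)$, $$\{\widetilde X, \widetilde Y\} = \widetilde{[X,Y]}, \qquad \{\widetilde X, \pi^* f\} = \pi^*(\mathsf a(X) f), \qquad \{\pi^* f, \pi^* h\} = 0,$$ where $\widetilde X$ is the fibrewise linear function on $E$ given by pairing with $X$. 3. With this Poisson bracket and the semidirect product group structure on $E \cong \mathfrak b^0 \times B$, $$(v,a)(w,b) = (v + \mathrm{Ad}^*_a w,\; ab), \qquad \langle \mathrm{Ad}^*_a w, y\rangle = \langle w, \mathrm{Ad}_{a^{-1}} y\rangle,$$ $E$ is a Poisson–Lie group: it is a Lie group and the multiplication $E \times E \to E$ is a Poisson map for the product Poisson structure on $E \times E$. -/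

import Mathlib

open scoped Manifold ContDiff Pointwise

/-- A matched pair of subgroups of a topological group: closed subgroups with trivial intersection
whose product set `B C` is open. -/
structure IsMatchedPair {G : Type*} [TopologicalSpace G] [Group G] (B C : Subgroup G) : Prop where
  isClosed_left : IsClosed (B : Set G)
  isClosed_right : IsClosed (C : Set G)
  inf_eq_bot : B ⊓ C = ⊥
  isOpen_mul : IsOpen ((B : Set G) * (C : Set G))

noncomputable section

namespace MatchedPair

/-! ### Lie subgroups and the coadjoint action

In Mathlib the tangent space `TangentSpace 𝓘(ℝ, EG) g` of a manifold modelled on `EG` is, by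
definition, a copy of `EG`. In particular the Lie algebra `𝔤 = T₁G` is written `EG` below, and its
dual `𝔤*` is written `EG →L[ℝ] ℝ`. -/

section LieSubgroups

variable (EG EB : Type*) [NormedAddCommGroup EG] [NormedSpace ℝ EG]
  [NormedAddCommGroup EB] [NormedSpace ℝ EB]
  {G : Type*} [TopologicalSpace G] [ChartedSpace EG G] [Group G]

/-- The given smooth structure on the subgroup `B` (with the subspace topology) is that of an
embedded Lie subgroup of `G`. -/
class IsLieSubgroup (B : Subgroup G) [ChartedSpace EB B] : Prop extends
    LieGroup 𝓘(ℝ, EB) ∞ B where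
  isSmoothEmbedding :
    Manifold.IsSmoothEmbedding 𝓘(ℝ, EB) 𝓘(ℝ, EG) ∞ (Subtype.val : B → G)

/-- The adjoint action `Ad_g : 𝔤 → 𝔤`, the differential at `1` of `h ↦ g h g⁻¹`. -/
def Ad (g : G) : EG →L[ℝ] EG :=
  mfderiv 𝓘(ℝ, EG) 𝓘(ℝ, EG) (fun h : G ↦ g * h * g⁻¹) 1

/-- The coadjoint action on `𝔤*`: `⟨Ad*_g φ, y⟩ = ⟨φ, Ad_{g⁻¹} y⟩`. -/
def coAd (g : G) (φ : EG →L[ℝ] ℝ) : EG →L[ℝ] ℝ := φ ∘L Ad EG g⁻¹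

/-- The differential `T_b B → T_b G` of the inclusion `B → G`. Its range is `T_b B ⊆ T_b G`; for
`b = 1` this is the Lie algebra `𝔟 ⊆ 𝔤`. -/
def inclDeriv (B : Subgroup G) [ChartedSpace EB B] (b : B) : EB →L[ℝ] EG :=
  mfderiv 𝓘(ℝ, EB) 𝓘(ℝ, EG) (Subtype.val : B → G) b

/-- The annihilator `(T_b B)⁰ ⊆ T_b* G`. -/
def conormal (B : Subgroup G) [ChartedSpace EB B] (b : B) : Submodule ℝ (EG →L[ℝ] ℝ) where
  carrier := {φ | ∀ x : EB, φ (inclDeriv EG EB B b x) = 0}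
  add_mem' hφ hψ x := by simp [hφ x, hψ x]
  zero_mem' _ := rfl
  smul_mem' c φ hφ x := by simp [hφ x]

/-- The annihilator `𝔟⁰ ⊆ 𝔤*` of the Lie algebra of `B`. -/
abbrev annihilator (B : Subgroup G) [ChartedSpace EB B] : Submodule ℝ (EG →L[ℝ] ℝ) :=
  conormal EG EB B 1

variable {EG}

theorem Ad_one : Ad EG (1 : G) = ContinuousLinearMap.id ℝ EG := by
  unfold Ad
  have : (fun h : G ↦ 1 * h * 1⁻¹) = id := by ext; simp
  rw [this]; exact mfderiv_id

theorem Ad_mul [LieGroup 𝓘(ℝ, EG) ∞ G] (g h : G) : Ad EG (g * h) = Ad EG g ∘L Ad EG h := by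
  have sm (g : G) : ContMDiff 𝓘(ℝ, EG) 𝓘(ℝ, EG) ∞ (fun h : G ↦ g * h * g⁻¹) :=
    (contMDiff_const.mul contMDiff_id).mul contMDiff_const
  have e : (fun x : G ↦ g * h * x * (g * h)⁻¹) =
      (fun x : G ↦ g * x * g⁻¹) ∘ (fun x : G ↦ h * x * h⁻¹) := by
    ext x; simp [mul_assoc]
  have h1 : h * 1 * h⁻¹ = 1 := by simp
  have key := mfderiv_comp (I := 𝓘(ℝ, EG)) (I' := 𝓘(ℝ, EG)) (I'' := 𝓘(ℝ, EG)) (1 : G)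
    ((sm g).mdifferentiable (by simp) (h * 1 * h⁻¹)) ((sm h).mdifferentiable (by simp) 1)
  unfold Ad
  rw [e, key]
  have : HEq (mfderiv 𝓘(ℝ, EG) 𝓘(ℝ, EG) (fun x : G ↦ g * x * g⁻¹) (h * 1 * h⁻¹))
    (mfderiv 𝓘(ℝ, EG) 𝓘(ℝ, EG) (fun x : G ↦ g * x * g⁻¹) 1) := by rw [h1]
  exact congrArg (fun T : EG →L[ℝ] EG ↦ T ∘L (Ad EG h)) (eq_of_heq this)

theorem coAd_one (φ : EG →L[ℝ] ℝ) : coAd EG (1 : G) φ = φ := by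
  simp [coAd, Ad_one]

theorem coAd_mul [LieGroup 𝓘(ℝ, EG) ∞ G] (g h : G) (φ : EG →L[ℝ] ℝ) :
    coAd EG (g * h) φ = coAd EG g (coAd EG h φ) := by
  simp [coAd, Ad_mul, ContinuousLinearMap.comp_assoc]

theorem coAd_add (g : G) (φ ψ : EG →L[ℝ] ℝ) : coAd EG g (φ + ψ) = coAd EG g φ + coAd EG g ψ := by
  simp [coAd, ContinuousLinearMap.add_comp]

/-- `𝔟⁰` is invariant under `Ad*_b` for `b ∈ B`. -/
theorem coAd_mem [LieGroup 𝓘(ℝ, EG) ∞ G] (B : Subgroup G) [ChartedSpace EB B]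
    [hB : IsLieSubgroup EG EB B] (b : B) {φ : EG →L[ℝ] ℝ} (hφ : φ ∈ annihilator EG EB B) :
    coAd EG (b : G) φ ∈ annihilator EG EB B := by
  intro x
  have smB : ContMDiff 𝓘(ℝ, EB) 𝓘(ℝ, EB) ∞ (fun h : B ↦ b⁻¹ * h * b⁻¹⁻¹) :=
    (contMDiff_const.mul contMDiff_id).mul contMDiff_const
  have smG : ContMDiff 𝓘(ℝ, EG) 𝓘(ℝ, EG) ∞ (fun h : G ↦ (b : G)⁻¹ * h * (b : G)⁻¹⁻¹) :=
    (contMDiff_const.mul contMDiff_id).mul contMDiff_const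
  have smι := hB.isSmoothEmbedding.contMDiff
  have e : (fun h : G ↦ (b : G)⁻¹ * h * (b : G)⁻¹⁻¹) ∘ (Subtype.val : B → G) =
      (Subtype.val : B → G) ∘ (fun h : B ↦ b⁻¹ * h * b⁻¹⁻¹) := by
    ext; simp
  have k1 := mfderiv_comp (1 : B) (smG.mdifferentiable (by simp) ((1 : B) : G))
    (smι.mdifferentiable (by simp) 1)
  have k2 := mfderiv_comp (1 : B) (smι.mdifferentiable (by simp) (b⁻¹ * 1 * b⁻¹⁻¹))
    (smB.mdifferentiable (by simp) 1)
  rw [e, k2] at k1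
  have h1 : b⁻¹ * 1 * b⁻¹⁻¹ = (1 : B) := by simp
  have h2 : inclDeriv EG EB B (b⁻¹ * 1 * b⁻¹⁻¹) = inclDeriv EG EB B 1 := by rw [h1]
  have k3 : ∃ y : EB, Ad EG ((b : G)⁻¹) (inclDeriv EG EB B 1 x) =
      inclDeriv EG EB B (b⁻¹ * 1 * b⁻¹⁻¹) y :=
    ⟨mfderiv 𝓘(ℝ, EB) 𝓘(ℝ, EB) (fun h : B ↦ b⁻¹ * h * b⁻¹⁻¹) 1 x,
      (congrArg (fun T : EB →L[ℝ] EG ↦ T x) k1).symm⟩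
  obtain ⟨y, hy⟩ := k3
  rw [coAd, ContinuousLinearMap.comp_apply, hy, h2]
  exact hφ y

end LieSubgroups

/-! ### The bundle `E = (TB)⁰`, presented as `𝔟⁰ × B`, with its semidirect product structure -/

section DualBundle

variable (EG EB : Type*) [NormedAddCommGroup EG] [NormedSpace ℝ EG]
  [NormedAddCommGroup EB] [NormedSpace ℝ EB]
  {G : Type*} [TopologicalSpace G] [ChartedSpace EG G] [Group G]
  (B : Subgroup G) [ChartedSpace EB B]

/-- The total space `E = 𝔟⁰ × B`, with its product manifold structure. -/
def DualBundle : Type _ := annihilator EG EB B × B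

namespace DualBundle

instance : TopologicalSpace (DualBundle EG EB B) :=
  inferInstanceAs (TopologicalSpace (annihilator EG EB B × B))

instance : ChartedSpace (ModelProd (annihilator EG EB B) EB) (DualBundle EG EB B) :=
  inferInstanceAs (ChartedSpace (ModelProd (annihilator EG EB B) EB) (annihilator EG EB B × B))

/-- The model of the product manifold `𝔟⁰ × B`. -/
abbrev model : ModelWithCorners ℝ (annihilator EG EB B × EB)
    (ModelProd (annihilator EG EB B) EB) :=
  𝓘(ℝ, annihilator EG EB B).prod 𝓘(ℝ, EB)

variable {EG EB B}

/-- The point `(v, b)` of `E`. -/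
def mk (v : annihilator EG EB B) (b : B) : DualBundle EG EB B := (v, b)

/-- The component in `𝔟⁰`. -/
def fibre (g : DualBundle EG EB B) : annihilator EG EB B := g.1

/-- The component in `B`; this is the bundle projection `π : E → B`. -/
def base (g : DualBundle EG EB B) : B := g.2

theorem ext {g h : DualBundle EG EB B} (h₁ : (g.fibre : EG →L[ℝ] ℝ) = h.fibre)
    (h₂ : g.base = h.base) : g = h :=
  Prod.ext (Subtype.ext h₁) h₂

/-- The covector at `g.base` corresponding to `g = (v, b)` under the identification of `𝔟⁰ × B`
with `(TB)⁰ ⊆ T*G` by right translations: `v ∘ d(R_{b⁻¹}) : T_b G → T₁ G → ℝ`. -/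
def covector (g : DualBundle EG EB B) : EG →L[ℝ] ℝ :=
  (g.fibre : EG →L[ℝ] ℝ) ∘L
    (mfderiv 𝓘(ℝ, EG) 𝓘(ℝ, EG) (fun h : G ↦ h * (g.base : G)⁻¹) (g.base : G) : EG →L[ℝ] EG)

section Group

variable [LieGroup 𝓘(ℝ, EG) ∞ G] [IsLieSubgroup EG EB B]

/-- `(v, a) (w, b) = (v + Ad*_a w, a b)`. -/
instance : Mul (DualBundle EG EB B) where
  mul g h := mk (g.fibre + ⟨coAd EG (g.base : G) h.fibre, coAd_mem EB B g.base h.fibre.2⟩)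
    (g.base * h.base)

instance : One (DualBundle EG EB B) where
  one := mk 0 1

/-- `(v, a)⁻¹ = (-Ad*_{a⁻¹} v, a⁻¹)`. -/
instance : Inv (DualBundle EG EB B) where
  inv g := mk (-⟨coAd EG ((g.base⁻¹ : B) : G) g.fibre, coAd_mem EB B g.base⁻¹ g.fibre.2⟩) g.base⁻¹

theorem fibre_mul (g h : DualBundle EG EB B) :
    ((g * h).fibre : EG →L[ℝ] ℝ) = g.fibre + coAd EG (g.base : G) h.fibre := rfl

theorem base_mul (g h : DualBundle EG EB B) : (g * h).base = g.base * h.base := rfl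

/-- The semidirect product `𝔟⁰ ⋊ B`. -/
instance : Group (DualBundle EG EB B) :=
  Group.ofLeftAxioms
    (fun g h k ↦ ext (by simp [fibre_mul, base_mul, coAd_mul, coAd_add, add_assoc])
      (by simp [base_mul, mul_assoc]))
    (fun g ↦ ext
      (by
        change (0 : EG →L[ℝ] ℝ) + coAd EG (1 : G) g.fibre = g.fibre
        rw [coAd_one, zero_add])
      (one_mul g.base))
    (fun g ↦ ext
      (by
        change -(coAd EG ((g.base⁻¹ : B) : G) g.fibre) + coAd EG ((g.base⁻¹ : B) : G) g.fibre = 0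
        simp)
      (inv_mul_cancel g.base))

end Group

end DualBundle

end DualBundle

/-! ### The groupoid of a matched pair and its Lie algebroid

The groupoid has base `B`, arrows the open set `B C ∩ C B ⊆ G`, range and source maps
`r g = b`, `s g = b'` for `g = b c = c' b'`, and composition
`g ∘ h = g (s g)⁻¹ h`, defined if `s g = r h`. The unit at `b ∈ B` is `b` itself. -/

section Groupoid

variable {G : Type*} [Group G] (B C : Subgroup G)

open Classical in
/-- The range map: `r (b c) = b`. (The value off `B C` is irrelevant.) -/
def rangeMap (g : G) : B :=
  if h : ∃ b : B, ∃ c : C, (b : G) * c = g then h.choose else 1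

open Classical in
/-- The source map: `s (c' b') = b'`. (The value off `C B` is irrelevant.) -/
def sourceMap (g : G) : B :=
  if h : ∃ b : B, ∃ c : C, (c : G) * b = g then h.choose else 1

/-- The composition `g ∘ h` of the groupoid, meant for arrows with `s g = r h`. For
`g = b c = c' b'` and `h = b' c''` this is `b c c''`. -/
def comp (g h : G) : G := g * (sourceMap B C g : G)⁻¹ * h

end Groupoid

section Algebroid

variable (EG EB : Type*) [NormedAddCommGroup EG] [NormedSpace ℝ EG]
  [NormedAddCommGroup EB] [NormedSpace ℝ EB]
  {G : Type*} [TopologicalSpace G] [ChartedSpace EG G] [Group G]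
  (B C : Subgroup G) [ChartedSpace EB B]

/-- The fibre over `b` of the Lie algebroid: the kernel of `dr` at the unit arrow `b`. -/
def algebroidFibre (b : B) : Submodule ℝ EG :=
  LinearMap.ker
    (mfderiv 𝓘(ℝ, EG) 𝓘(ℝ, EB) (rangeMap B C) (b : G) : EG →L[ℝ] EB).toLinearMap

variable {EG EB B} in
/-- The element of the dual `L_b*` of the fibre `L_b` of the Lie algebroid over `b = g.base` given
by restricting the covector of `g`. -/
def DualBundle.toDual (g : DualBundle EG EB B) :
    Module.Dual ℝ (algebroidFibre EG EB B C g.base) :=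
  g.covector.toLinearMap.domRestrict (algebroidFibre EG EB B C g.base)

/-- Smooth sections of the Lie algebroid. -/
structure AlgebroidSection [LieGroup 𝓘(ℝ, EG) ∞ G] where
  toFun : ∀ b : B, TangentSpace 𝓘(ℝ, EG) (b : G)
  mem_fibre : ∀ b, toFun b ∈ algebroidFibre EG EB B C b
  contMDiff : ContMDiff 𝓘(ℝ, EB) 𝓘(ℝ, EG).tangent ∞
    (fun b : B ↦ (⟨(b : G), toFun b⟩ : TangentBundle 𝓘(ℝ, EG) G))

namespace AlgebroidSection

variable {EG EB B C} [LieGroup 𝓘(ℝ, EG) ∞ G]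

/-- The left invariant vector field on the groupoid extending the section `X`: at the arrow `g` it
is the image of `X (s g)` under the differential of the left translation `h ↦ g ∘ h` at the unit
`s g`. -/
def leftInvariantField (X : AlgebroidSection EG EB B C) (g : G) : TangentSpace 𝓘(ℝ, EG) g :=
  (mfderiv 𝓘(ℝ, EG) 𝓘(ℝ, EG) (comp B C g) (sourceMap B C g : G) : EG →L[ℝ] EG)
    (X.toFun (sourceMap B C g))

/-- The Lie algebroid bracket: the restriction to the units of the Lie bracket of the left
invariant vector fields. -/
def bracket (X Y : AlgebroidSection EG EB B C) (b : B) : TangentSpace 𝓘(ℝ, EG) (b : G) :=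
  VectorField.mlieBracket 𝓘(ℝ, EG) X.leftInvariantField Y.leftInvariantField (b : G)

/-- The anchor: the restriction of `ds`. -/
def anchor (X : AlgebroidSection EG EB B C) (b : B) : TangentSpace 𝓘(ℝ, EB) b :=
  (mfderiv 𝓘(ℝ, EG) 𝓘(ℝ, EB) (sourceMap B C) (b : G) : EG →L[ℝ] EB) (X.toFun b)

end AlgebroidSection

end Algebroid

/-! ### Fibrewise linear functions and pullbacks on `E` -/

section Functions

variable {EG EB : Type*} [NormedAddCommGroup EG] [NormedSpace ℝ EG]
  [NormedAddCommGroup EB] [NormedSpace ℝ EB]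
  {G : Type*} [TopologicalSpace G] [ChartedSpace EG G] [Group G]
  {B C : Subgroup G} [ChartedSpace EB B]

theorem contMDiff_of_contMDiff_tangent {M EM : Type*} [NormedAddCommGroup EM] [NormedSpace ℝ EM]
    [TopologicalSpace M] [ChartedSpace EM M] {N : Type*} [TopologicalSpace N] [ChartedSpace EG N]
    [IsManifold 𝓘(ℝ, EG) ∞ N]
    {w : M → EG} {x : N} (h : ContMDiff 𝓘(ℝ, EM) 𝓘(ℝ, EG).tangent ∞
      (fun m ↦ (⟨x, w m⟩ : TangentBundle 𝓘(ℝ, EG) N))) : ContMDiff 𝓘(ℝ, EM) 𝓘(ℝ, EG) ∞ w := by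
  intro m
  have h2 := (Bundle.contMDiffAt_totalSpace.1 (h m)).2
  convert h2 using 2 with y
  rw [TangentBundle.trivializationAt_apply]
  exact (tangentCoordChange_self (I := 𝓘(ℝ, EG)) (x := x) (z := x) (v := w y)
    (mem_extChartAt_source x)).symm

theorem contMDiff_rightTranslate [LieGroup 𝓘(ℝ, EG) ∞ G] [hB : IsLieSubgroup EG EB B]
    {X : ∀ b : B, TangentSpace 𝓘(ℝ, EG) (b : G)}
    (hX : ContMDiff 𝓘(ℝ, EB) 𝓘(ℝ, EG).tangent ∞
      (fun b : B ↦ (⟨(b : G), X b⟩ : TangentBundle 𝓘(ℝ, EG) G))) :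
    ContMDiff 𝓘(ℝ, EB) 𝓘(ℝ, EG) ∞ (fun b : B ↦
      (mfderiv 𝓘(ℝ, EG) 𝓘(ℝ, EG) (fun h : G ↦ h * (b : G)⁻¹) (b : G) : EG →L[ℝ] EG) (X b)) := by
  apply contMDiff_of_contMDiff_tangent (N := G) (x := 1)
  have smι := hB.isSmoothEmbedding.contMDiff
  have h0 : ContMDiff 𝓘(ℝ, EB) 𝓘(ℝ, EG).tangent ∞ (fun b : B ↦
      (⟨(b : G)⁻¹, 0⟩ : TangentBundle 𝓘(ℝ, EG) G)) :=
    (Bundle.contMDiff_zeroSection ℝ (TangentSpace 𝓘(ℝ, EG) (M := G))).comp smι.inv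
  have h2 := (contMDiff_equivTangentBundleProd_symm (I := 𝓘(ℝ, EG)) (M := G)
    (I' := 𝓘(ℝ, EG)) (M' := G) (n := ∞)).comp (hX.prodMk h0)
  have h3 : ContMDiff (𝓘(ℝ, EG).prod 𝓘(ℝ, EG)).tangent 𝓘(ℝ, EG).tangent ∞
      (tangentMap (𝓘(ℝ, EG).prod 𝓘(ℝ, EG)) 𝓘(ℝ, EG) (fun p : G × G ↦ p.1 * p.2)) :=
    (contMDiff_mul 𝓘(ℝ, EG) ∞).contMDiff_tangentMap (by simp)
  convert h3.comp h2 using 1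
  ext b
  · simp [tangentMap]
  · simp only [Function.comp_apply, tangentMap]
    rw [mfderiv_prod_eq_add_apply ((contMDiff_mul 𝓘(ℝ, EG) ∞).mdifferentiable (by simp) _)]
    refine heq_of_eq ?_
    erw [map_zero, add_zero]
    rfl

/-- The fibrewise linear function `X̃` on `E` given by a section `X` of the Lie algebroid: its value
at a covector over `b` is the pairing with `X b`. -/
def linearFun [LieGroup 𝓘(ℝ, EG) ∞ G] [IsLieSubgroup EG EB B] (X : AlgebroidSection EG EB B C) :
    C^∞⟮DualBundle.model EG EB B, DualBundle EG EB B; 𝓘(ℝ), ℝ⟯ where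
  val g := g.covector (X.toFun g.base)
  property := by
    have h1 : ContMDiff (DualBundle.model EG EB B) 𝓘(ℝ, EG →L[ℝ] ℝ) ∞
        (fun g : annihilator EG EB B × B ↦ (g.1 : EG →L[ℝ] ℝ)) :=
      ContMDiff.comp (I' := 𝓘(ℝ, annihilator EG EB B)) (M' := annihilator EG EB B)
        (g := (annihilator EG EB B).subtypeL) (f := Prod.fst)
        (ContinuousLinearMap.contMDiff (𝕜 := ℝ) (E := annihilator EG EB B) (F := EG →L[ℝ] ℝ)
          (n := ∞) (annihilator EG EB B).subtypeL) contMDiff_fst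
    have h2 := (contMDiff_rightTranslate X.contMDiff).comp
      (contMDiff_snd (I := 𝓘(ℝ, annihilator EG EB B)) (M := annihilator EG EB B))
    exact h1.clm_apply h2

/-- The pullback `π^* f` of a smooth function on `B` under the projection `π : E → B`. -/
def pullback (f : C^∞⟮𝓘(ℝ, EB), B; 𝓘(ℝ), ℝ⟯) :
    C^∞⟮DualBundle.model EG EB B, DualBundle EG EB B; 𝓘(ℝ), ℝ⟯ where
  val g := f g.base
  property := f.contMDiff.comp
    (contMDiff_snd (I := 𝓘(ℝ, annihilator EG EB B)) (M := annihilator EG EB B))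

end Functions

end MatchedPair

/-! ### Poisson structures and Poisson–Lie groups -/

section Poisson

variable {E H : Type*} [NormedAddCommGroup E] [NormedSpace ℝ E] [TopologicalSpace H]
  (I : ModelWithCorners ℝ E H) (M : Type*) [TopologicalSpace M] [ChartedSpace H M]

/-- A Poisson structure on a manifold: a Lie bracket on the space of smooth functions which is a
derivation in each argument. -/
structure PoissonStructure where
  bracket : C^∞⟮I, M; 𝓘(ℝ), ℝ⟯ →ₗ[ℝ] C^∞⟮I, M; 𝓘(ℝ), ℝ⟯ →ₗ[ℝ] C^∞⟮I, M; 𝓘(ℝ), ℝ⟯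
  bracket_self : ∀ f, bracket f f = 0
  jacobi : ∀ f g h,
    bracket f (bracket g h) + bracket g (bracket h f) + bracket h (bracket f g) = 0
  leibniz : ∀ f g h, bracket f (g * h) = bracket f g * h + g * bracket f h

variable {I M}

/-- The bracket of the product Poisson structure on `M × M`:
`{F, K}(x, y) = {F(·, y), K(·, y)}(x) + {F(x, ·), K(x, ·)}(y)`. -/
def PoissonStructure.prodBracket (P : PoissonStructure I M)
    (F K : C^∞⟮I.prod I, M × M; 𝓘(ℝ), ℝ⟯) (p : M × M) : ℝ :=
  P.bracket (F.comp (.prodMk .id (.const p.2))) (K.comp (.prodMk .id (.const p.2))) p.1 +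
    P.bracket (F.comp (.prodMk (.const p.1) .id)) (K.comp (.prodMk (.const p.1) .id)) p.2

/-- The multiplication of a Lie group as a smooth map. -/
def smoothMul [Group M] [LieGroup I ∞ M] : C^∞⟮I.prod I, M × M; I, M⟯ :=
  ⟨fun p ↦ p.1 * p.2, contMDiff_mul I ∞⟩

/-- A Poisson–Lie group: a Lie group with a Poisson structure for which the multiplication
`M × M → M` is a Poisson map. -/
structure IsPoissonLieGroup [Group M] (P : PoissonStructure I M) : Prop extends LieGroup I ∞ M where
  mul_poisson : ∀ (f k : C^∞⟮I, M; 𝓘(ℝ), ℝ⟯) (p : M × M),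
    P.prodBracket (f.comp smoothMul) (k.comp smoothMul) p = P.bracket f k (p.1 * p.2)

end Poisson

namespace MatchedPair

variable {EG EB : Type*} [NormedAddCommGroup EG] [NormedSpace ℝ EG]
  [NormedAddCommGroup EB] [NormedSpace ℝ EB]
  {G : Type*} [TopologicalSpace G] [ChartedSpace EG G] [Group G]
  {B : Subgroup G} [ChartedSpace EB B]

/-- The linear Poisson structure on the dual bundle `E` of the Lie algebroid, characterized by
`{X̃, Ỹ} = [X, Y]~`, `{X̃, π^* f} = π^*(a(X) f)` and `{π^* f, π^* h} = 0`. -/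
structure IsLinearPoisson [LieGroup 𝓘(ℝ, EG) ∞ G] [IsLieSubgroup EG EB B] (C : Subgroup G)
    (P : PoissonStructure (DualBundle.model EG EB B) (DualBundle EG EB B)) : Prop where
  linear_linear : ∀ (X Y : AlgebroidSection EG EB B C) (g : DualBundle EG EB B),
    P.bracket (linearFun X) (linearFun Y) g = g.covector (X.bracket Y g.base)
  linear_pullback : ∀ (X : AlgebroidSection EG EB B C) (f : C^∞⟮𝓘(ℝ, EB), B; 𝓘(ℝ), ℝ⟯)
    (g : DualBundle EG EB B),
    P.bracket (linearFun X) (pullback f) g =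
      (mfderiv 𝓘(ℝ, EB) 𝓘(ℝ) f g.base : EB →L[ℝ] ℝ) (X.anchor g.base)
  pullback_pullback : ∀ f h : C^∞⟮𝓘(ℝ, EB), B; 𝓘(ℝ), ℝ⟯,
    P.bracket (pullback f) (pullback h) = 0

end MatchedPair

end

/-! Everything becomes explicit in the left trivialization. Openness of `B C` and `B ∩ C = {e}`
force `𝔤 = 𝔟 ⊕ 𝔠`. The sum is direct because integral curves in `B` and in `C` with the same initial
velocity coincide, so they stay in `B ∩ C` (`inclDeriv_eq_inclDeriv`). It fills `𝔤` because a smooth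
image of `B × C` cannot contain an open set of larger dimension
(`finrank_le_of_isOpen_subset_range`). The inverse function theorem makes the source map `s` smooth
at `e`, and equivariance spreads this over `C B`. From then on `𝔠` appears only as the kernel of
`projB = ds_e`, and `HasSmoothSource` records all that is needed.

Since `s` is invariant under left multiplication by `C`, left invariant fields on `G` descend along
`s`: the field of `y ∈ 𝔤` is `s`-related to `b ↦ dR_b (pr_𝔟 (Ad_b y))` on `B` (`tder_sourceMap`).
Hence `L` is the action algebroid of `𝔠` on `B`. Its sections are functions `B → 𝔠`, and its bracket
is the pointwise bracket corrected by derivatives along anchors (`bracket_eq`). Relatedness also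
shows that the anchor respects brackets (`anchorVec_lbr`).

On `E` consider `ℓ_y (v, b) = ⟨v, Ad_b y⟩` for `y ∈ 𝔠`, together with the functions `π^* f`. Their
differentials separate tangent vectors at every point (`generators_separating`), and by Hadamard's
lemma a point derivation sees only differentials. So a biderivation is determined by its values on
these generators (`pointBiderivation_eq_zero`), which gives uniqueness. The Jacobiator is a
derivation in each slot, so the Jacobi identity reduces to that of `𝔠` and to the compatibility of
the anchor with brackets. Existence comes from an explicit bivector (`exists_isLinearBracket`), and
the Leibniz rule passes from constant sections to all sections (`pointDerivation_linearFun`).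

The failure of multiplicativity at `(p, q)` is a biderivation at `p q`, so it too is tested on
generators. Translates of generators are generators up to constants and pullbacks
(`rightPullback_ell`, `leftPullback_ell`). For `ℓ_y` and `π^* f` the claim is the cocycle property
of the anchor (`anchorVec_mul`). For two functions `ℓ` it is an identity for `⟨v, [y, z]⟩` with `v ∈
𝔟⁰`, which holds because `v` kills `[𝔟, 𝔟] ⊆ 𝔟` (`annihilator_lbr`). -/

noncomputable section

open Filter Set
open scoped Topology

namespace MatchedPair

/-! ### Derivatives as maps between model spaces -/

section TangentCalculus

variable {E E' E'' H H' H'' M M' M'' : Type*}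
  [NormedAddCommGroup E] [NormedSpace ℝ E] [TopologicalSpace H]
  [NormedAddCommGroup E'] [NormedSpace ℝ E'] [TopologicalSpace H']
  [NormedAddCommGroup E''] [NormedSpace ℝ E''] [TopologicalSpace H'']
  [TopologicalSpace M] [ChartedSpace H M] [TopologicalSpace M'] [ChartedSpace H' M']
  [TopologicalSpace M''] [ChartedSpace H'' M'']

/-- The manifold derivative, as a map between the model spaces. -/
def tder (I : ModelWithCorners ℝ E H) (J : ModelWithCorners ℝ E' H') (f : M → M') (x : M) :
    E →L[ℝ] E' :=
  mfderiv I J f x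

variable {I : ModelWithCorners ℝ E H} {J : ModelWithCorners ℝ E' H'}
  {K : ModelWithCorners ℝ E'' H''}

/-- Taking `f x = y` as a hypothesis avoids rewriting a base point inside a dependent tangent space.
-/
theorem tder_comp_of_eq {g : M' → M''} {f : M → M'} {x : M} {y : M'}
    (hg : MDifferentiableAt J K g y) (hf : MDifferentiableAt I J f x) (hy : f x = y) :
    tder I K (g ∘ f) x = (tder J K g y).comp (tder I J f x) := by
  subst hy; exact mfderiv_comp x hg hf

theorem tder_comp {g : M' → M''} {f : M → M'} {x : M}
    (hg : MDifferentiableAt J K g (f x)) (hf : MDifferentiableAt I J f x) :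
    tder I K (g ∘ f) x = (tder J K g (f x)).comp (tder I J f x) :=
  tder_comp_of_eq hg hf rfl

theorem tder_congr {f g : M → M'} {x : M} (h : f =ᶠ[𝓝 x] g) : tder I J f x = tder I J g x :=
  h.mfderiv_eq

theorem tder_id (x : M) : tder I I (id : M → M) x = ContinuousLinearMap.id ℝ E := mfderiv_id

theorem tder_const (x : M) (c : M') : tder I J (fun _ : M ↦ c) x = 0 := mfderiv_const

end TangentCalculus

/-! ### The Lie bracket of vector fields as a commutator -/

section Bracket

variable {E F M : Type*} [NormedAddCommGroup E] [NormedSpace ℝ E]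
  [NormedAddCommGroup F] [NormedSpace ℝ F] [TopologicalSpace M] [ChartedSpace E M]

theorem tder_eq_fderiv {f : M → F} {x : M} (hf : MDifferentiableAt 𝓘(ℝ, E) 𝓘(ℝ, F) f x) :
    tder 𝓘(ℝ, E) 𝓘(ℝ, F) f x =
      fderiv ℝ (f ∘ (extChartAt 𝓘(ℝ, E) x).symm) (extChartAt 𝓘(ℝ, E) x x) := by
  have h := hf.mfderiv
  simp only [writtenInExtChartAt, extChartAt_model_space_eq_id, PartialEquiv.refl_coe,
    modelWithCornersSelf_coe, range_id, fderivWithin_univ, Function.id_comp] at h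
  exact h

variable [CompleteSpace E] [IsManifold 𝓘(ℝ, E) ∞ M]

/-- The flat identity `VectorField.fderiv_apply_lieBracket` is transported through the preferred
chart at `x`, whose derivative at `x` is the identity. Vector valued `f` are allowed so that a chart
can later serve as test function. -/
theorem tder_mlieBracket {f : M → F} {x : M} {V W : ∀ y : M, TangentSpace 𝓘(ℝ, E) y}
    (hf : ContMDiffAt 𝓘(ℝ, E) 𝓘(ℝ, F) ∞ f x)
    (hV : MDifferentiableAt 𝓘(ℝ, E) 𝓘(ℝ, E).tangent
      (fun y ↦ (⟨y, V y⟩ : TangentBundle 𝓘(ℝ, E) M)) x)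
    (hW : MDifferentiableAt 𝓘(ℝ, E) 𝓘(ℝ, E).tangent
      (fun y ↦ (⟨y, W y⟩ : TangentBundle 𝓘(ℝ, E) M)) x)
    (hVf : MDifferentiableAt 𝓘(ℝ, E) 𝓘(ℝ, F) (fun y ↦ tder 𝓘(ℝ, E) 𝓘(ℝ, F) f y (V y)) x)
    (hWf : MDifferentiableAt 𝓘(ℝ, E) 𝓘(ℝ, F) (fun y ↦ tder 𝓘(ℝ, E) 𝓘(ℝ, F) f y (W y)) x) :
    tder 𝓘(ℝ, E) 𝓘(ℝ, F) f x (VectorField.mlieBracket 𝓘(ℝ, E) V W x) =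
      tder 𝓘(ℝ, E) 𝓘(ℝ, F) (fun y ↦ tder 𝓘(ℝ, E) 𝓘(ℝ, F) f y (W y)) x (V x) -
      tder 𝓘(ℝ, E) 𝓘(ℝ, F) (fun y ↦ tder 𝓘(ℝ, E) 𝓘(ℝ, F) f y (V y)) x (W x) := by
  have h2 : (2 : ℕ∞ω) ≤ ∞ := ENat.LEInfty.out
  set φ := extChartAt 𝓘(ℝ, E) x with hφ
  have hx : φ.symm (φ x) = x := extChartAt_to_inv x
  let pull (V : ∀ y : M, TangentSpace 𝓘(ℝ, E) y) : E → E :=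
    VectorField.mpullbackWithin 𝓘(ℝ, E) 𝓘(ℝ, E) φ.symm V (range 𝓘(ℝ, E))
  have hpd {V : ∀ y : M, TangentSpace 𝓘(ℝ, E) y}
      (hV : MDifferentiableAt 𝓘(ℝ, E) 𝓘(ℝ, E).tangent
      (fun y ↦ (⟨y, V y⟩ : TangentBundle 𝓘(ℝ, E) M)) x) : DifferentiableAt ℝ (pull V) (φ x) := by
    have := (mdifferentiableWithinAt_univ.2 hV).differentiableWithinAt_mpullbackWithin_vectorField
    have hs : (φ.symm ⁻¹' univ ∩ range 𝓘(ℝ, E)) = univ := by simp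
    exact differentiableWithinAt_univ.1 (hs ▸ this)
  have hpx (V : ∀ y : M, TangentSpace 𝓘(ℝ, E) y) : pull V (φ x) = V x := by
    have h := mfderivWithin_extChartAt_symm_inverse_apply (I := 𝓘(ℝ, E)) (x := x) (V x)
    have hv : (V (φ.symm (φ x)) : E) = V x := by rw [hx]
    change ((mfderivWithin 𝓘(ℝ, E) 𝓘(ℝ, E) φ.symm (range 𝓘(ℝ, E)) (φ x) : E →L[ℝ] E).inverse : E → E)
      (V (φ.symm (φ x))) = V x
    rw [hv]
    exact h
  have hbr : VectorField.mlieBracket 𝓘(ℝ, E) V W x =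
      VectorField.lieBracket ℝ (pull V) (pull W) (φ x) := by
    have hs : (φ.symm ⁻¹' univ ∩ range 𝓘(ℝ, E)) = univ := by simp
    have h1 : VectorField.mlieBracketWithin 𝓘(ℝ, E) V W univ x =
        (tder 𝓘(ℝ, E) 𝓘(ℝ, E) φ x).inverse (VectorField.lieBracketWithin ℝ (pull V) (pull W)
          (φ.symm ⁻¹' univ ∩ range 𝓘(ℝ, E)) (φ x)) := rfl
    have h2 : tder 𝓘(ℝ, E) 𝓘(ℝ, E) φ x = ContinuousLinearMap.id ℝ E := mfderiv_extChartAt_self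
    rw [VectorField.mlieBracketWithin_univ, h2, hs,
      VectorField.lieBracketWithin_univ, ContinuousLinearMap.inverse_id] at h1
    exact h1
  have hfc : ContDiffAt ℝ ∞ (f ∘ φ.symm) (φ x) := by
    have := (contMDiffAt_iff.1 hf).2
    have hr : range 𝓘(ℝ, E) = univ := by simp
    rw [hr, contDiffWithinAt_univ, extChartAt_model_space_eq_id] at this
    exact this
  -- The agreement is needed on a neighbourhood and not only at the centre, because these functions
  -- are differentiated once more.
  have key {V : ∀ y : M, TangentSpace 𝓘(ℝ, E) y} :
      ((fun y ↦ tder 𝓘(ℝ, E) 𝓘(ℝ, F) f y (V y)) ∘ φ.symm) =ᶠ[𝓝 (φ x)]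
        fun y ↦ fderiv ℝ (f ∘ φ.symm) y (pull V y) := by
    have h1 : ∀ᶠ y in 𝓝 (φ x), y ∈ φ.target := extChartAt_target_mem_nhds x
    have hf' : ∀ᶠ z in 𝓝 x, MDifferentiableAt 𝓘(ℝ, E) 𝓘(ℝ, F) f z :=
      ((contMDiffAt_iff_contMDiffAt_nhds (by simp)).1 (hf.of_le h2)).mono
        fun z hz ↦ hz.mdifferentiableAt (by simp)
    have h3 : ∀ᶠ y in 𝓝 (φ x), MDifferentiableAt 𝓘(ℝ, E) 𝓘(ℝ, F) f (φ.symm y) :=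
      (continuousAt_extChartAt_symm x).tendsto.eventually (by rwa [hx])
    filter_upwards [h1, h3] with y hy hfy
    have hi := isInvertible_mfderivWithin_extChartAt_symm (I := 𝓘(ℝ, E)) hy
    have hd := mdifferentiableWithinAt_extChartAt_symm (I := 𝓘(ℝ, E)) hy
    have hr : range 𝓘(ℝ, E) = univ := by simp
    have hp : pull V y = (mfderivWithin 𝓘(ℝ, E) 𝓘(ℝ, E) φ.symm (range 𝓘(ℝ, E)) y :
      E →L[ℝ] E).inverse (V (φ.symm y)) := rfl
    rw [hr] at hi hd hp
    rw [mfderivWithin_univ] at hi hp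
    rw [mdifferentiableWithinAt_univ] at hd
    have hc := tder_comp hfy hd
    have he : tder 𝓘(ℝ, E) 𝓘(ℝ, F) (f ∘ φ.symm) y = fderiv ℝ (f ∘ φ.symm) y := mfderiv_eq_fderiv
    obtain ⟨e', he'⟩ := hi
    let e : E ≃L[ℝ] E := e'
    have he2 : tder 𝓘(ℝ, E) 𝓘(ℝ, E) φ.symm y = (e : E →L[ℝ] E) := he'.symm
    have he3 : pull V y = e.symm (V (φ.symm y)) := by
      rw [hp]
      exact congrArg (fun T : E →L[ℝ] E ↦ T.inverse (V (φ.symm y))) he2 |>.trans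
        (by rw [ContinuousLinearMap.inverse_equiv]; rfl)
    rw [← he, hc, he2, he3]
    exact congrArg (tder 𝓘(ℝ, E) 𝓘(ℝ, F) f (φ.symm y)) (e.apply_symm_apply _).symm
  have := VectorField.fderiv_apply_lieBracket (𝕜 := ℝ) hfc (by simpa using h2) (hpd hW) (hpd hV)
  rw [tder_eq_fderiv (hf.mdifferentiableAt (by simp)), tder_eq_fderiv hVf, tder_eq_fderiv hWf, hbr,
    key.fderiv_eq, key.fderiv_eq, ← hpx V, ← hpx W]
  exact this

end Bracket

/-! ### Smoothness of tangent maps and of vector fields along maps -/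

section TangentSmooth

variable {E E' E'' H H' H'' M M' M'' : Type*}
  [NormedAddCommGroup E] [NormedSpace ℝ E] [TopologicalSpace H]
  [NormedAddCommGroup E'] [NormedSpace ℝ E'] [TopologicalSpace H']
  [NormedAddCommGroup E''] [NormedSpace ℝ E''] [TopologicalSpace H'']
  [TopologicalSpace M] [ChartedSpace H M] [TopologicalSpace M'] [ChartedSpace H' M']
  [TopologicalSpace M''] [ChartedSpace H'' M'']
  {I : ModelWithCorners ℝ E H} {J : ModelWithCorners ℝ E' H'} {K : ModelWithCorners ℝ E'' H''}
  [IsManifold I ∞ M] [IsManifold J ∞ M']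

/-- Smoothness of order `∞` at a point provides, for each finite order, a neighbourhood depending on
that order. So each `n` is treated separately, starting from order `n + 1` because one derivative is
lost. -/
theorem contMDiffAt_tangentMap {f : M → M'} {p : TangentBundle I M}
    (hf : ContMDiffAt I J ∞ f p.1) :
    ContMDiffAt I.tangent J.tangent ∞ (tangentMap I J f) p := by
  rw [contMDiffAt_infty]
  intro n
  have hn : ((n : ℕ∞ω) + 1) ≠ ∞ := by
    exact_mod_cast ENat.natCast_ne_top (n + 1)
  have h1 : ContMDiffAt I J (n + 1) f p.1 := hf.of_le (by exact_mod_cast le_top)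
  have hn1 : (n : ℕ∞ω) + 1 ≤ ∞ := by exact_mod_cast le_top
  have := IsManifold.of_le (I := I) (M := M) hn1
  have := IsManifold.of_le (I := J) (M := M') hn1
  obtain ⟨u, hu, hfu⟩ := (contMDiffAt_iff_contMDiffOn_nhds hn).1 h1
  obtain ⟨t, htu, hto, hpt⟩ := mem_nhds_iff.1 hu
  have h2 := (hfu.mono htu).contMDiffOn_tangentMapWithin (m := n) le_rfl hto.uniqueMDiffOn
  have h3 : (Bundle.TotalSpace.proj ⁻¹' t : Set (TangentBundle I M)) ∈ 𝓝 p :=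
    (hto.preimage (FiberBundle.continuous_proj E (TangentSpace I))).mem_nhds hpt
  refine (h2.contMDiffAt h3).congr_of_eventuallyEq ?_
  filter_upwards [h3] with q hq
  simp only [tangentMap, tangentMapWithin]
  rw [mfderivWithin_of_isOpen hto hq]

theorem ContMDiffAt.tder_apply {F : Type*} [NormedAddCommGroup F] [NormedSpace ℝ F]
    {f : M → F} {p : M'' → M} {v : M'' → E} {x : M''}
    (hf : ContMDiffAt I 𝓘(ℝ, F) ∞ f (p x))
    (hv : ContMDiffAt K I.tangent ∞ (fun m ↦ (⟨p m, v m⟩ : TangentBundle I M)) x) :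
    ContMDiffAt K 𝓘(ℝ, F) ∞ (fun m ↦ tder I 𝓘(ℝ, F) f (p m) (v m)) x := by
  have h1 := (contMDiffAt_tangentMap (p := ⟨p x, v x⟩) hf).comp x hv
  exact ((contMDiff_snd_tangentBundle_modelSpace F 𝓘(ℝ, F)).contMDiffAt).comp x h1

/-- Smooth sections along the two factors give a smooth section of the tangent bundle of the
product. -/
theorem ContMDiffAt.prodMk_tangent {p : M'' → M} {v : M'' → E} {q : M'' → M'} {w : M'' → E'}
    {x : M''} (hv : ContMDiffAt K I.tangent ∞ (fun m ↦ (⟨p m, v m⟩ : TangentBundle I M)) x)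
    (hw : ContMDiffAt K J.tangent ∞ (fun m ↦ (⟨q m, w m⟩ : TangentBundle J M')) x) :
    ContMDiffAt K (I.prod J).tangent ∞
      (fun m ↦ (⟨(p m, q m), (v m, w m)⟩ : TangentBundle (I.prod J) (M × M'))) x :=
  ((contMDiff_equivTangentBundleProd_symm (I := I) (M := M) (I' := J) (M' := M')
    (n := ∞)).contMDiffAt).comp x (hv.prodMk hw)

theorem contMDiff_zeroTangent {p : M'' → M} (hp : ContMDiff K I ∞ p) :
    ContMDiff K I.tangent ∞ (fun m ↦ (⟨p m, 0⟩ : TangentBundle I M)) :=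
  (Bundle.contMDiff_zeroSection ℝ (TangentSpace I (M := M))).comp hp

end TangentSmooth

/-! ### Vector fields along constant maps and in vector spaces -/

section Vertical

variable {E E' EM M M' : Type*} [NormedAddCommGroup E] [NormedSpace ℝ E]
  [NormedAddCommGroup E'] [NormedSpace ℝ E'] [NormedAddCommGroup EM] [NormedSpace ℝ EM]
  {H : Type*} [TopologicalSpace H] {K : ModelWithCorners ℝ EM H}
  [TopologicalSpace M] [ChartedSpace H M] [TopologicalSpace M'] [ChartedSpace E M']
  [IsManifold 𝓘(ℝ, E) ∞ M']

/-- Smooth maps into a fixed tangent space are smooth as maps into the tangent bundle. -/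
theorem contMDiffAt_mk_const_base {w : M → E} {m : M} (x : M') (h : ContMDiffAt K 𝓘(ℝ, E) ∞ w m) :
    ContMDiffAt K 𝓘(ℝ, E).tangent ∞ (fun m ↦ (⟨x, w m⟩ : TangentBundle 𝓘(ℝ, E) M')) m := by
  refine Bundle.contMDiffAt_totalSpace.2 ⟨contMDiffAt_const, ?_⟩
  convert h using 2 with y
  rw [TangentBundle.trivializationAt_apply]
  exact tangentCoordChange_self (I := 𝓘(ℝ, E)) (x := x) (z := x) (v := w y)
    (mem_extChartAt_source x)

/-- Conversely, a smooth map into a fixed tangent space is smooth as a vector valued map. -/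
theorem contMDiffAt_of_contMDiffAt_tangent {w : M → E} {m : M} {x : M'}
    (h : ContMDiffAt K 𝓘(ℝ, E).tangent ∞ (fun m ↦ (⟨x, w m⟩ : TangentBundle 𝓘(ℝ, E) M')) m) :
    ContMDiffAt K 𝓘(ℝ, E) ∞ w m := by
  have h2 := (Bundle.contMDiffAt_totalSpace.1 h).2
  convert h2 using 2 with y
  rw [TangentBundle.trivializationAt_apply]
  exact (tangentCoordChange_self (I := 𝓘(ℝ, E)) (x := x) (z := x) (v := w y)
    (mem_extChartAt_source x)).symm

/-- Smooth vector fields along maps into a vector space. -/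
theorem contMDiffAt_mk_vectorSpace {p w : M → E} {m : M} (hp : ContMDiffAt K 𝓘(ℝ, E) ∞ p m)
    (h : ContMDiffAt K 𝓘(ℝ, E) ∞ w m) :
    ContMDiffAt K 𝓘(ℝ, E).tangent ∞ (fun m ↦ (⟨p m, w m⟩ : TangentBundle 𝓘(ℝ, E) E)) m := by
  refine Bundle.contMDiffAt_totalSpace.2 ⟨hp, ?_⟩
  convert h using 2 with y
  simp

end Vertical

/-! ### Symmetry of mixed partial derivatives on a product -/

section MixedPartials

variable {E E' F M M' : Type*} [NormedAddCommGroup E] [NormedSpace ℝ E]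
  [NormedAddCommGroup E'] [NormedSpace ℝ E'] [NormedAddCommGroup F] [NormedSpace ℝ F]

/-- Both sides are the second derivative of `f` on `(u, 0)` and `(0, w)`, in the two orders. -/
theorem fderiv_fderiv_prod_comm {f : E × E' → F} {x : E} {y : E'}
    (hf : ContDiffAt ℝ ∞ f (x, y)) (u : E) (w : E') :
    fderiv ℝ (fun a ↦ fderiv ℝ (fun b ↦ f (a, b)) y w) x u =
      fderiv ℝ (fun b ↦ fderiv ℝ (fun a ↦ f (a, b)) x u) y w := by
  have h2 : (2 : ℕ∞ω) ≤ ∞ := ENat.LEInfty.out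
  have hd : ∀ᶠ p in 𝓝 (x, y), DifferentiableAt ℝ f p :=
    ((hf.of_le h2).eventually (by simp)).mono fun p hp ↦ hp.differentiableAt (by simp)
  have hdd : DifferentiableAt ℝ (fderiv ℝ f) (x, y) :=
    (hf.fderiv_right (m := 1) (by simpa using! h2)).differentiableAt (by simp)
  have hc1 : ContinuousAt (fun a : E ↦ (a, y)) x := by fun_prop
  have hc2 : ContinuousAt (fun b : E' ↦ (x, b)) y := by fun_prop
  have e1 : (fun a ↦ fderiv ℝ (fun b ↦ f (a, b)) y w) =ᶠ[𝓝 x]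
      fun a ↦ fderiv ℝ f (a, y) (0, w) := by
    filter_upwards [hc1.tendsto.eventually hd] with a ha
    have : HasFDerivAt (fun b : E' ↦ (a, b)) (ContinuousLinearMap.inr ℝ E E') y :=
      hasFDerivAt_prodMk_right a y
    have h : HasFDerivAt (fun b ↦ f (a, b)) _ y := ha.hasFDerivAt.comp y this
    rw [h.fderiv]
    simp
  have e2 : (fun b ↦ fderiv ℝ (fun a ↦ f (a, b)) x u) =ᶠ[𝓝 y]
      fun b ↦ fderiv ℝ f (x, b) (u, 0) := by
    filter_upwards [hc2.tendsto.eventually hd] with b hb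
    have : HasFDerivAt (fun a : E ↦ (a, b)) (ContinuousLinearMap.inl ℝ E E') x :=
      hasFDerivAt_prodMk_left x b
    have h : HasFDerivAt (fun a ↦ f (a, b)) _ x := hb.hasFDerivAt.comp x this
    rw [h.fderiv]
    simp
  rw [e1.fderiv_eq, e2.fderiv_eq]
  have h1 : HasFDerivAt (fun a ↦ fderiv ℝ f (a, y)) _ x :=
    hdd.hasFDerivAt.comp x (hasFDerivAt_prodMk_left x y)
  have h3 : HasFDerivAt (fun b ↦ fderiv ℝ f (x, b)) _ y :=
    hdd.hasFDerivAt.comp y (hasFDerivAt_prodMk_right x y)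
  rw [(h1.clm_apply (hasFDerivAt_const ((0, w) : E × E') x)).fderiv,
    (h3.clm_apply (hasFDerivAt_const ((u, 0) : E × E') y)).fderiv]
  have := (hf.isSymmSndFDerivAt (by simpa using h2)) (u, 0) (0, w)
  simpa using this

variable [TopologicalSpace M] [ChartedSpace E M] [TopologicalSpace M'] [ChartedSpace E' M']

theorem tder_prodMk_right {f : M × M' → F} {p : M} {q : M'}
    (hf : MDifferentiableAt (𝓘(ℝ, E).prod 𝓘(ℝ, E')) 𝓘(ℝ, F) f (p, q)) (w : E') :
    tder 𝓘(ℝ, E') 𝓘(ℝ, F) (fun n ↦ f (p, n)) q w =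
      tder (𝓘(ℝ, E).prod 𝓘(ℝ, E')) 𝓘(ℝ, F) f (p, q) (0, w) := by
  have h := tder_comp (I := 𝓘(ℝ, E')) (f := fun n : M' ↦ (p, n)) (x := q) hf
    (mdifferentiableAt_const.prodMk mdifferentiableAt_id)
  have h2 : tder 𝓘(ℝ, E') (𝓘(ℝ, E).prod 𝓘(ℝ, E')) (fun n : M' ↦ (p, n)) q =
    ContinuousLinearMap.inr ℝ E E' := mfderiv_prod_right
  rw [h2] at h
  exact congrArg (fun T : E' →L[ℝ] F ↦ T w) h

theorem tder_prodMk_left {f : M × M' → F} {p : M} {q : M'}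
    (hf : MDifferentiableAt (𝓘(ℝ, E).prod 𝓘(ℝ, E')) 𝓘(ℝ, F) f (p, q)) (u : E) :
    tder 𝓘(ℝ, E) 𝓘(ℝ, F) (fun m ↦ f (m, q)) p u =
      tder (𝓘(ℝ, E).prod 𝓘(ℝ, E')) 𝓘(ℝ, F) f (p, q) (u, 0) := by
  have h := tder_comp (I := 𝓘(ℝ, E)) (f := fun m : M ↦ (m, q)) (x := p) hf
    (mdifferentiableAt_id.prodMk mdifferentiableAt_const)
  have h2 : tder 𝓘(ℝ, E) (𝓘(ℝ, E).prod 𝓘(ℝ, E')) (fun m : M ↦ (m, q)) p =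
    ContinuousLinearMap.inl ℝ E E' := mfderiv_prod_left
  rw [h2] at h
  exact congrArg (fun T : E →L[ℝ] F ↦ T u) h

variable [IsManifold 𝓘(ℝ, E) ∞ M]

theorem eventually_mdifferentiableAt {f : M → F} {p : M}
    (hf : ContMDiffAt 𝓘(ℝ, E) 𝓘(ℝ, F) ∞ f p) :
    ∀ᶠ z in 𝓝 p, MDifferentiableAt 𝓘(ℝ, E) 𝓘(ℝ, F) f z :=
  ((contMDiffAt_iff_contMDiffAt_nhds (by simp)).1
    (hf.of_le (ENat.LEInfty.out : (2 : ℕ∞ω) ≤ ∞))).mono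
    fun z hz ↦ hz.mdifferentiableAt (by simp)

variable [IsManifold 𝓘(ℝ, E') ∞ M']

/-- Both derivatives are taken at the fixed points `p` and `q`, so the preferred charts there reduce
the claim to the flat case. Smoothness of the inner partial derivatives must be known before the
outer ones can be read in charts. -/
theorem tder_tder_prod_comm {f : M × M' → F} {p : M} {q : M'}
    (hf : ContMDiff (𝓘(ℝ, E).prod 𝓘(ℝ, E')) 𝓘(ℝ, F) ∞ f) (u : E) (w : E') :
    tder 𝓘(ℝ, E) 𝓘(ℝ, F) (fun m ↦ tder 𝓘(ℝ, E') 𝓘(ℝ, F) (fun n ↦ f (m, n)) q w) p u =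
      tder 𝓘(ℝ, E') 𝓘(ℝ, F) (fun n ↦ tder 𝓘(ℝ, E) 𝓘(ℝ, F) (fun m ↦ f (m, n)) p u) q w := by
  have hfd := hf.mdifferentiable (by simp)
  have s1 : ContMDiffAt 𝓘(ℝ, E) 𝓘(ℝ, F) ∞
      (fun m ↦ tder 𝓘(ℝ, E') 𝓘(ℝ, F) (fun n ↦ f (m, n)) q w) p := by
    simp_rw [tder_prodMk_right (hfd _)]
    exact ContMDiffAt.tder_apply (p := fun m ↦ (m, q)) (v := fun _ ↦ ((0 : E), w)) (hf _)
      (ContMDiffAt.prodMk_tangent (contMDiff_zeroTangent contMDiff_id p)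
        (contMDiffAt_mk_const_base q contMDiffAt_const))
  have s2 : ContMDiffAt 𝓘(ℝ, E') 𝓘(ℝ, F) ∞
      (fun n ↦ tder 𝓘(ℝ, E) 𝓘(ℝ, F) (fun m ↦ f (m, n)) p u) q := by
    simp_rw [tder_prodMk_left (hfd _)]
    exact ContMDiffAt.tder_apply (p := fun n ↦ (p, n)) (v := fun _ ↦ (u, (0 : E'))) (hf _)
      (ContMDiffAt.prodMk_tangent (contMDiffAt_mk_const_base p contMDiffAt_const)
        (contMDiff_zeroTangent contMDiff_id q))
  rw [tder_eq_fderiv (s1.mdifferentiableAt (by simp)),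
    tder_eq_fderiv (s2.mdifferentiableAt (by simp))]
  have c1 (m : M) : tder 𝓘(ℝ, E') 𝓘(ℝ, F) (fun n ↦ f (m, n)) q =
      fderiv ℝ ((fun n ↦ f (m, n)) ∘ (extChartAt 𝓘(ℝ, E') q).symm) (extChartAt 𝓘(ℝ, E') q q) :=
    tder_eq_fderiv ((hfd (m, q)).comp q (mdifferentiableAt_const.prodMk mdifferentiableAt_id))
  have c2 (n : M') : tder 𝓘(ℝ, E) 𝓘(ℝ, F) (fun m ↦ f (m, n)) p =
      fderiv ℝ ((fun m ↦ f (m, n)) ∘ (extChartAt 𝓘(ℝ, E) p).symm) (extChartAt 𝓘(ℝ, E) p p) :=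
    tder_eq_fderiv ((hfd (p, n)).comp p (mdifferentiableAt_id.prodMk mdifferentiableAt_const))
  simp only [c1, c2, Function.comp_def]
  refine fderiv_fderiv_prod_comm (f := fun z ↦ f ((extChartAt 𝓘(ℝ, E) p).symm z.1,
    (extChartAt 𝓘(ℝ, E') q).symm z.2)) ?_ u w
  have := (contMDiffAt_iff.1 (hf (p, q))).2
  rw [extChartAt_model_space_eq_id] at this
  have hr : range (𝓘(ℝ, E).prod 𝓘(ℝ, E')) = univ := by simp
  rw [hr, contDiffWithinAt_univ] at this
  exact this

end MixedPartials

/-! ### Brackets of related vector fields -/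

section Related

variable {E E' M M' : Type*} [NormedAddCommGroup E] [NormedSpace ℝ E] [CompleteSpace E]
  [NormedAddCommGroup E'] [NormedSpace ℝ E'] [CompleteSpace E']
  [TopologicalSpace M] [ChartedSpace E M] [TopologicalSpace M'] [ChartedSpace E' M']
  [IsManifold 𝓘(ℝ, E) ∞ M] [IsManifold 𝓘(ℝ, E') ∞ M']

/-- The Lie bracket as a commutator of derivations, for smooth vector fields. -/
theorem tder_mlieBracket_of_contMDiffAt {F : Type*} [NormedAddCommGroup F] [NormedSpace ℝ F]
    {f : M → F} {x : M} {V W : M → E}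
    (hf : ContMDiffAt 𝓘(ℝ, E) 𝓘(ℝ, F) ∞ f x)
    (hV : ContMDiffAt 𝓘(ℝ, E) 𝓘(ℝ, E).tangent ∞ (fun y ↦ (⟨y, V y⟩ : TangentBundle 𝓘(ℝ, E) M)) x)
    (hW : ContMDiffAt 𝓘(ℝ, E) 𝓘(ℝ, E).tangent ∞
      (fun y ↦ (⟨y, W y⟩ : TangentBundle 𝓘(ℝ, E) M)) x) :
    tder 𝓘(ℝ, E) 𝓘(ℝ, F) f x (VectorField.mlieBracket (M := M) 𝓘(ℝ, E) V W x) =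
      tder 𝓘(ℝ, E) 𝓘(ℝ, F) (fun y ↦ tder 𝓘(ℝ, E) 𝓘(ℝ, F) f y (W y)) x (V x) -
      tder 𝓘(ℝ, E) 𝓘(ℝ, F) (fun y ↦ tder 𝓘(ℝ, E) 𝓘(ℝ, F) f y (V y)) x (W x) :=
  tder_mlieBracket hf (hV.mdifferentiableAt (by simp)) (hW.mdifferentiableAt (by simp))
    ((ContMDiffAt.tder_apply hf hV).mdifferentiableAt (by simp))
    ((ContMDiffAt.tder_apply hf hW).mdifferentiableAt (by simp))

/-- Lie brackets of related vector fields are related. -/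
theorem tder_mlieBracket_of_related {φ : M → M'} {x : M} {V W : M → E} {V' W' : M' → E'}
    (hφ : ContMDiff 𝓘(ℝ, E) 𝓘(ℝ, E') ∞ φ)
    (hV : ContMDiff 𝓘(ℝ, E) 𝓘(ℝ, E).tangent ∞ (fun y ↦ (⟨y, V y⟩ : TangentBundle 𝓘(ℝ, E) M)))
    (hW : ContMDiff 𝓘(ℝ, E) 𝓘(ℝ, E).tangent ∞ (fun y ↦ (⟨y, W y⟩ : TangentBundle 𝓘(ℝ, E) M)))
    (hV' : ContMDiff 𝓘(ℝ, E') 𝓘(ℝ, E').tangent ∞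
      (fun y ↦ (⟨y, V' y⟩ : TangentBundle 𝓘(ℝ, E') M')))
    (hW' : ContMDiff 𝓘(ℝ, E') 𝓘(ℝ, E').tangent ∞
      (fun y ↦ (⟨y, W' y⟩ : TangentBundle 𝓘(ℝ, E') M')))
    (hVV : ∀ y, tder 𝓘(ℝ, E) 𝓘(ℝ, E') φ y (V y) = V' (φ y))
    (hWW : ∀ y, tder 𝓘(ℝ, E) 𝓘(ℝ, E') φ y (W y) = W' (φ y)) :
    tder 𝓘(ℝ, E) 𝓘(ℝ, E') φ x (VectorField.mlieBracket (M := M) 𝓘(ℝ, E) V W x) =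
      VectorField.mlieBracket (M := M') 𝓘(ℝ, E') V' W' (φ x) := by
  -- The test function is the chart at `φ x`: its derivative there is the identity, so it recovers
  -- the whole tangent vector.
  set f : M' → E' := ⇑(extChartAt 𝓘(ℝ, E') (φ x)) with hfdef
  have hf : ContMDiffAt 𝓘(ℝ, E') 𝓘(ℝ, E') ∞ f (φ x) := contMDiffAt_extChartAt
  have hf1 : tder 𝓘(ℝ, E') 𝓘(ℝ, E') f (φ x) = ContinuousLinearMap.id ℝ E' :=
    mfderiv_extChartAt_self
  have hfφ : ContMDiffAt 𝓘(ℝ, E) 𝓘(ℝ, E') ∞ (f ∘ φ) x := hf.comp x (hφ x)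
  have hev : ∀ᶠ y in 𝓝 x, MDifferentiableAt 𝓘(ℝ, E') 𝓘(ℝ, E') f (φ y) :=
    (hφ.continuous.continuousAt.tendsto).eventually (eventually_mdifferentiableAt hf)
  have hφd := hφ.mdifferentiable (by simp)
  have rel {V : M → E} {V' : M' → E'} (hVV : ∀ y, tder 𝓘(ℝ, E) 𝓘(ℝ, E') φ y (V y) = V' (φ y)) :
      (fun y ↦ tder 𝓘(ℝ, E) 𝓘(ℝ, E') (f ∘ φ) y (V y)) =ᶠ[𝓝 x]
        (fun z ↦ tder 𝓘(ℝ, E') 𝓘(ℝ, E') f z (V' z)) ∘ φ := by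
    filter_upwards [hev] with y hy
    rw [tder_comp hy (hφd y)]
    simp [hVV]
  have e1 := tder_mlieBracket_of_contMDiffAt hfφ (hV x) (hW x)
  have e2 := tder_mlieBracket_of_contMDiffAt hf (hV' (φ x)) (hW' (φ x))
  have sV := (ContMDiffAt.tder_apply (p := fun z ↦ z) hf (hV' (φ x))).mdifferentiableAt (by simp)
  have sW := (ContMDiffAt.tder_apply (p := fun z ↦ z) hf (hW' (φ x))).mdifferentiableAt (by simp)
  rw [tder_congr (rel hVV), tder_congr (rel hWW), tder_comp sV (hφd x), tder_comp sW (hφd x),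
    tder_comp (hf.mdifferentiableAt (by simp)) (hφd x)] at e1
  simp only [ContinuousLinearMap.comp_apply, hVV, hWW] at e1
  rw [← e2, hf1] at e1
  exact e1

/-- The Lie bracket of vector fields with values in the model space. -/
def vbracket (V W : M → E) (x : M) : E := VectorField.mlieBracket (M := M) 𝓘(ℝ, E) V W x

omit [CompleteSpace E] [IsManifold 𝓘(ℝ, E) ∞ M] in
theorem vbracket_swap (V W : M → E) (x : M) : vbracket V W x = -vbracket W V x :=
  VectorField.mlieBracket_swap_apply (I := 𝓘(ℝ, E)) (V := V) (W := W)

omit [CompleteSpace E] [IsManifold 𝓘(ℝ, E) ∞ M] in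
theorem vbracket_congr {V W V' W' : M → E} {x : M} (hV : V =ᶠ[𝓝 x] V') (hW : W =ᶠ[𝓝 x] W') :
    vbracket V W x = vbracket V' W' x :=
  Filter.EventuallyEq.mlieBracket_vectorField_eq (I := 𝓘(ℝ, E)) hV hW

end Related

/-! ### Global functions with prescribed differential -/

section Functions

variable {E F M : Type*} [NormedAddCommGroup E] [NormedSpace ℝ E] [FiniteDimensional ℝ E]
  [NormedAddCommGroup F] [NormedSpace ℝ F] [TopologicalSpace M] [T2Space M] [ChartedSpace E M]
  [IsManifold 𝓘(ℝ, E) ∞ M]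

/-- There are global smooth functions with prescribed differential at a point. -/
theorem exists_contMDiff_tder_eq (x : M) (T : E →L[ℝ] F) :
    ∃ f : M → F, ContMDiff 𝓘(ℝ, E) 𝓘(ℝ, F) ∞ f ∧ tder 𝓘(ℝ, E) 𝓘(ℝ, F) f x = T := by
  let χ : SmoothBumpFunction 𝓘(ℝ, E) x := Classical.arbitrary _
  have hT : ContMDiff 𝓘(ℝ, E) 𝓘(ℝ, F) ∞ T := T.contMDiff
  refine ⟨fun y ↦ χ y • T (extChartAt 𝓘(ℝ, E) x y), χ.contMDiff_smul
    (hT.comp_contMDiffOn contMDiffOn_extChartAt), ?_⟩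
  have h1 : (fun y ↦ χ y • T (extChartAt 𝓘(ℝ, E) x y)) =ᶠ[𝓝 x] T ∘ extChartAt 𝓘(ℝ, E) x := by
    filter_upwards [χ.eventuallyEq_one] with y hy
    simp [hy]
  have h2 : tder 𝓘(ℝ, E) 𝓘(ℝ, E) (extChartAt 𝓘(ℝ, E) x) x = ContinuousLinearMap.id ℝ E :=
    mfderiv_extChartAt_self
  have h3 : tder 𝓘(ℝ, E) 𝓘(ℝ, F) T (extChartAt 𝓘(ℝ, E) x x) = T := T.mfderiv_eq
  rw [tder_congr h1, tder_comp (hT.mdifferentiable (by simp) _)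
    (contMDiffAt_extChartAt (n := ∞).mdifferentiableAt (by simp)), h2, h3]
  rfl

end Functions

/-! ### Translations, the adjoint action and the Lie algebra of a Lie group -/

section LieGroups

variable {E G : Type*} [NormedAddCommGroup E] [NormedSpace ℝ E]
  [TopologicalSpace G] [ChartedSpace E G] [Group G]

/-- The differential of the left translation by `g` at `h`. -/
def lT (E : Type*) {G : Type*} [NormedAddCommGroup E] [NormedSpace ℝ E]
    [TopologicalSpace G] [ChartedSpace E G] [Group G] (g h : G) : E →L[ℝ] E :=
  tder 𝓘(ℝ, E) 𝓘(ℝ, E) (fun k ↦ g * k) h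

/-- The differential of the right translation by `k` at `h`. -/
def rT (E : Type*) {G : Type*} [NormedAddCommGroup E] [NormedSpace ℝ E]
    [TopologicalSpace G] [ChartedSpace E G] [Group G] (k h : G) : E →L[ℝ] E :=
  tder 𝓘(ℝ, E) 𝓘(ℝ, E) (fun g ↦ g * k) h

variable [LieGroup 𝓘(ℝ, E) ∞ G]

theorem mdifferentiable_mul_left' (g : G) : MDifferentiable 𝓘(ℝ, E) 𝓘(ℝ, E) (fun k ↦ g * k) :=
  (contMDiff_mul_left (I := 𝓘(ℝ, E)) (n := ∞) (a := g)).mdifferentiable (by simp)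

theorem mdifferentiable_mul_right' (k : G) : MDifferentiable 𝓘(ℝ, E) 𝓘(ℝ, E) (fun g ↦ g * k) :=
  (contMDiff_mul_right (I := 𝓘(ℝ, E)) (n := ∞) (a := k)).mdifferentiable (by simp)

theorem lT_lT (g h k : G) : (lT E g (h * k)).comp (lT E h k) = lT E (g * h) k := by
  have := tder_comp (mdifferentiable_mul_left' (E := E) g (h * k))
    (mdifferentiable_mul_left' (E := E) h k)
  rw [show (fun k ↦ g * k) ∘ (fun k ↦ h * k) = fun k ↦ (g * h) * k by ext; simp [mul_assoc]] at this
  exact this.symm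

theorem rT_rT (g h k : G) : (rT E h (k * g)).comp (rT E g k) = rT E (g * h) k := by
  have := tder_comp (f := fun k ↦ k * g) (mdifferentiable_mul_right' (E := E) h (k * g))
    (mdifferentiable_mul_right' (E := E) g k)
  rw [show (fun k ↦ k * h) ∘ (fun k ↦ k * g) = fun k ↦ k * (g * h) by ext; simp [mul_assoc]] at this
  exact this.symm

theorem lT_rT (g h k : G) : (lT E g (h * k)).comp (rT E k h) = (rT E k (g * h)).comp (lT E g h) := by
  have h1 := tder_comp (f := fun h ↦ h * k) (mdifferentiable_mul_left' (E := E) g (h * k))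
    (mdifferentiable_mul_right' (E := E) k h)
  have h2 := tder_comp (f := fun h ↦ g * h) (mdifferentiable_mul_right' (E := E) k (g * h))
    (mdifferentiable_mul_left' (E := E) g h)
  rw [show (fun h ↦ g * h) ∘ (fun h ↦ h * k) = (fun h ↦ h * k) ∘ (fun h ↦ g * h) by
    ext; simp [mul_assoc]] at h1
  exact h1.symm.trans h2

omit [LieGroup 𝓘(ℝ, E) ∞ G] in
theorem lT_one (h : G) : lT E 1 h = ContinuousLinearMap.id ℝ E := by
  have : (fun k : G ↦ 1 * k) = id := by ext; simp
  rw [lT, this, tder_id]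

omit [LieGroup 𝓘(ℝ, E) ∞ G] in
theorem rT_one (h : G) : rT E 1 h = ContinuousLinearMap.id ℝ E := by
  have : (fun k : G ↦ k * 1) = id := by ext; simp
  rw [rT, this, tder_id]

theorem lT_inv_lT (g h : G) (x : E) : lT E g⁻¹ (g * h) (lT E g h x) = x := by
  have := lT_lT (E := E) g⁻¹ g h
  rw [inv_mul_cancel, lT_one] at this
  exact congrArg (fun T : E →L[ℝ] E ↦ T x) this

theorem lT_lT_inv (g h : G) (x : E) : lT E g (g⁻¹ * h) (lT E g⁻¹ h x) = x := by
  have := lT_lT (E := E) g g⁻¹ h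
  rw [mul_inv_cancel, lT_one] at this
  exact congrArg (fun T : E →L[ℝ] E ↦ T x) this

theorem rT_inv_rT (g h : G) (x : E) : rT E g⁻¹ (h * g) (rT E g h x) = x := by
  have := rT_rT (E := E) g g⁻¹ h
  rw [mul_inv_cancel, rT_one] at this
  exact congrArg (fun T : E →L[ℝ] E ↦ T x) this

theorem rT_rT_inv (g h : G) (x : E) : rT E g (h * g⁻¹) (rT E g⁻¹ h x) = x := by
  have := rT_rT (E := E) g⁻¹ g h
  rw [inv_mul_cancel, rT_one] at this
  exact congrArg (fun T : E →L[ℝ] E ↦ T x) this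

theorem Ad_eq (g : G) : Ad E g = (rT E g⁻¹ g).comp (lT E g 1) :=
  tder_comp_of_eq (f := fun h ↦ g * h) (g := fun h ↦ h * g⁻¹)
    (mdifferentiable_mul_right' (E := E) g⁻¹ g)
    (mdifferentiable_mul_left' (E := E) g 1) (mul_one g)

theorem rT_Ad (g : G) (y : E) : rT E g 1 (Ad E g y) = lT E g 1 y := by
  rw [Ad_eq]
  have := rT_rT_inv (E := E) g g (lT E g 1 y)
  rw [mul_inv_cancel] at this
  exact this

theorem Ad_inv_Ad (g : G) (y : E) : Ad E g⁻¹ (Ad E g y) = y := by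
  have := Ad_mul (EG := E) g⁻¹ g
  rw [inv_mul_cancel, Ad_one] at this
  exact congrArg (fun T : E →L[ℝ] E ↦ T y) this.symm

theorem Ad_Ad_inv (g : G) (y : E) : Ad E g (Ad E g⁻¹ y) = y := by
  simpa using Ad_inv_Ad g⁻¹ y

theorem Ad_mul_apply (g h : G) (y : E) : Ad E (g * h) y = Ad E g (Ad E h y) := by
  rw [Ad_mul]; rfl

variable {EM M H : Type*} [NormedAddCommGroup EM] [NormedSpace ℝ EM] [TopologicalSpace H]
  {K : ModelWithCorners ℝ EM H} [TopologicalSpace M] [ChartedSpace H M]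

theorem ContMDiffAt.mul_tangent {p q : M → G} {u v : M → E} {m : M}
    (hu : ContMDiffAt K 𝓘(ℝ, E).tangent ∞ (fun m ↦ (⟨p m, u m⟩ : TangentBundle 𝓘(ℝ, E) G)) m)
    (hv : ContMDiffAt K 𝓘(ℝ, E).tangent ∞ (fun m ↦ (⟨q m, v m⟩ : TangentBundle 𝓘(ℝ, E) G)) m) :
    ContMDiffAt K 𝓘(ℝ, E).tangent ∞ (fun m ↦ (⟨p m * q m,
      rT E (q m) (p m) (u m) + lT E (p m) (q m) (v m)⟩ : TangentBundle 𝓘(ℝ, E) G)) m := by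
  have hm := contMDiff_mul 𝓘(ℝ, E) ∞ (G := G)
  have h1 := (contMDiffAt_tangentMap (hm (p m, q m)) (p := ⟨(p m, q m), (u m, v m)⟩)).comp m
    (ContMDiffAt.prodMk_tangent hu hv)
  convert h1 using 1
  funext m
  have := mfderiv_prod_eq_add_apply (v := ((u m, v m) : E × E))
    (hm.mdifferentiable (by simp) (p m, q m))
  exact congrArg (fun w : E ↦ (⟨p m * q m, w⟩ : TangentBundle 𝓘(ℝ, E) G)) this.symm

omit [LieGroup 𝓘(ℝ, E) ∞ G] [Group G] in
theorem tangent_mk_eq {x y : G} (h : x = y) (v : E) :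
    (⟨x, v⟩ : TangentBundle 𝓘(ℝ, E) G) = ⟨y, v⟩ := by
  subst h; rfl

theorem ContMDiffAt.lT_tangent {p : M → G} {w : M → E} {m : M} (hp : ContMDiffAt K 𝓘(ℝ, E) ∞ p m)
    (hw : ContMDiffAt K 𝓘(ℝ, E) ∞ w m) :
    ContMDiffAt K 𝓘(ℝ, E).tangent ∞
      (fun m ↦ (⟨p m, lT E (p m) 1 (w m)⟩ : TangentBundle 𝓘(ℝ, E) G)) m := by
  have h0 : ContMDiffAt K 𝓘(ℝ, E).tangent ∞
      (fun m ↦ (⟨p m, (0 : E)⟩ : TangentBundle 𝓘(ℝ, E) G)) m :=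
    (contMDiff_zeroTangent (contMDiff_id (M := G))).contMDiffAt.comp m hp
  have := ContMDiffAt.mul_tangent h0 (contMDiffAt_mk_const_base (M' := G) 1 hw)
  convert this using 1
  funext m
  rw [map_zero, zero_add]
  exact (tangent_mk_eq (mul_one (p m)) _).symm

theorem ContMDiffAt.rT_tangent {p : M → G} {w : M → E} {m : M} (hp : ContMDiffAt K 𝓘(ℝ, E) ∞ p m)
    (hw : ContMDiffAt K 𝓘(ℝ, E) ∞ w m) :
    ContMDiffAt K 𝓘(ℝ, E).tangent ∞
      (fun m ↦ (⟨p m, rT E (p m) 1 (w m)⟩ : TangentBundle 𝓘(ℝ, E) G)) m := by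
  have h0 : ContMDiffAt K 𝓘(ℝ, E).tangent ∞
      (fun m ↦ (⟨p m, (0 : E)⟩ : TangentBundle 𝓘(ℝ, E) G)) m :=
    (contMDiff_zeroTangent (contMDiff_id (M := G))).contMDiffAt.comp m hp
  have := ContMDiffAt.mul_tangent (contMDiffAt_mk_const_base (M' := G) 1 hw) h0
  convert this using 1
  funext m
  rw [map_zero, add_zero]
  exact (tangent_mk_eq (one_mul (p m)) _).symm

/-- Left trivialization of a smooth vector field along a map. -/
theorem ContMDiffAt.lT_inv {p : M → G} {X : M → E} {m : M}
    (hX : ContMDiffAt K 𝓘(ℝ, E).tangent ∞ (fun m ↦ (⟨p m, X m⟩ : TangentBundle 𝓘(ℝ, E) G)) m) :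
    ContMDiffAt K 𝓘(ℝ, E) ∞ (fun m ↦ lT E (p m)⁻¹ (p m) (X m)) m := by
  have hp : ContMDiffAt K 𝓘(ℝ, E) ∞ p m :=
    (Bundle.contMDiffAt_totalSpace.1 hX).1
  have h0 : ContMDiffAt K 𝓘(ℝ, E).tangent ∞
      (fun m ↦ (⟨(p m)⁻¹, (0 : E)⟩ : TangentBundle 𝓘(ℝ, E) G)) m :=
    (contMDiff_zeroTangent (contMDiff_id (M := G))).contMDiffAt.comp m hp.inv
  have := ContMDiffAt.mul_tangent h0 hX
  refine contMDiffAt_of_contMDiffAt_tangent (M' := G) (x := 1) ?_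
  convert this using 1
  funext m
  rw [map_zero, zero_add]
  exact (tangent_mk_eq (inv_mul_cancel (p m)) _).symm

theorem ContMDiffAt.Ad_apply {p : M → G} {w : M → E} {m : M} (hp : ContMDiffAt K 𝓘(ℝ, E) ∞ p m)
    (hw : ContMDiffAt K 𝓘(ℝ, E) ∞ w m) :
    ContMDiffAt K 𝓘(ℝ, E) ∞ (fun m ↦ Ad E (p m) (w m)) m := by
  have h0 : ContMDiffAt K 𝓘(ℝ, E).tangent ∞
      (fun m ↦ (⟨(p m)⁻¹, (0 : E)⟩ : TangentBundle 𝓘(ℝ, E) G)) m :=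
    (contMDiff_zeroTangent (contMDiff_id (M := G))).contMDiffAt.comp m hp.inv
  have := ContMDiffAt.mul_tangent (ContMDiffAt.lT_tangent hp hw) h0
  refine contMDiffAt_of_contMDiffAt_tangent (M' := G) (x := 1) ?_
  convert this using 1
  funext m
  rw [map_zero, add_zero, Ad_eq]
  exact (tangent_mk_eq (mul_inv_cancel (p m)) _).symm

/-! The Lie bracket -/

variable [CompleteSpace E]

/-- The Lie bracket on the model space induced from the tangent space at the identity. -/
def lbr (G : Type*) {E : Type*} [NormedAddCommGroup E] [NormedSpace ℝ E]
    [TopologicalSpace G] [ChartedSpace E G] [Group G] (x y : E) : E :=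
  vbracket (M := G) (fun g ↦ lT E g 1 x) (fun g ↦ lT E g 1 y) 1

omit [CompleteSpace E] in
theorem contMDiff_linv (x : E) : ContMDiff 𝓘(ℝ, E) 𝓘(ℝ, E).tangent ∞
    (fun g ↦ (⟨g, lT E g 1 x⟩ : TangentBundle 𝓘(ℝ, E) G)) := fun _ ↦
  ContMDiffAt.lT_tangent contMDiffAt_id contMDiffAt_const

omit [CompleteSpace E] in
theorem lieGroup_minSmoothness : LieGroup 𝓘(ℝ, E) (minSmoothness ℝ 3) G := by
  simp only [minSmoothness_of_isRCLikeNormedField]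
  exact LieGroup.of_le (n := ∞) ENat.LEInfty.out

theorem vbracket_linv (x y : E) (g : G) :
    vbracket (fun g : G ↦ lT E g 1 x) (fun g ↦ lT E g 1 y) g = lT E g 1 (lbr G x y) := by
  have := lieGroup_minSmoothness (E := E) (G := G)
  exact (congrFun (mulInvariantVector_mlieBracket (I := 𝓘(ℝ, E)) (G := G) x y) g).symm

omit [LieGroup 𝓘(ℝ, E) ∞ G] [CompleteSpace E] in
theorem lbr_swap (x y : E) : lbr G x y = -lbr G y x := vbracket_swap _ _ _

theorem lbr_add (x y z : E) : lbr G x (y + z) = lbr G x y + lbr G x z := by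
  have := lieGroup_minSmoothness (E := E) (G := G)
  exact lie_add (L := GroupLieAlgebra 𝓘(ℝ, E) G) (M := GroupLieAlgebra 𝓘(ℝ, E) G) x y z

theorem lbr_smul (c : ℝ) (x y : E) : lbr G x (c • y) = c • lbr G x y := by
  have := lieGroup_minSmoothness (E := E) (G := G)
  exact lie_smul (L := GroupLieAlgebra 𝓘(ℝ, E) G) (M := GroupLieAlgebra 𝓘(ℝ, E) G) c x y

theorem lbr_jacobi (x y z : E) :
    lbr G x (lbr G y z) + lbr G y (lbr G z x) + lbr G z (lbr G x y) = 0 := by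
  have := lieGroup_minSmoothness (E := E) (G := G)
  exact lie_jacobi (L := GroupLieAlgebra 𝓘(ℝ, E) G) x y z

theorem tder_linv_comm {F : Type*} [NormedAddCommGroup F] [NormedSpace ℝ F] {f : G → F} {g : G}
    (hf : ContMDiffAt 𝓘(ℝ, E) 𝓘(ℝ, F) ∞ f g) (x y : E) :
    tder 𝓘(ℝ, E) 𝓘(ℝ, F) f g (lT E g 1 (lbr G x y)) =
      tder 𝓘(ℝ, E) 𝓘(ℝ, F) (fun h ↦ tder 𝓘(ℝ, E) 𝓘(ℝ, F) f h (lT E h 1 y)) g (lT E g 1 x) -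
      tder 𝓘(ℝ, E) 𝓘(ℝ, F) (fun h ↦ tder 𝓘(ℝ, E) 𝓘(ℝ, F) f h (lT E h 1 x)) g (lT E g 1 y) := by
  rw [← vbracket_linv]
  exact tder_mlieBracket_of_contMDiffAt hf (contMDiff_linv x g) (contMDiff_linv y g)

/-- The differential of a homomorphism of Lie groups preserves brackets. -/
theorem tder_lbr {E' G' : Type*} [NormedAddCommGroup E'] [NormedSpace ℝ E'] [CompleteSpace E']
    [TopologicalSpace G'] [ChartedSpace E' G'] [Group G'] [LieGroup 𝓘(ℝ, E') ∞ G']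
    (φ : G →* G') (hφ : ContMDiff 𝓘(ℝ, E) 𝓘(ℝ, E') ∞ φ) (x y : E) :
    tder 𝓘(ℝ, E) 𝓘(ℝ, E') φ 1 (lbr G x y) =
      lbr G' (tder 𝓘(ℝ, E) 𝓘(ℝ, E') φ 1 x) (tder 𝓘(ℝ, E) 𝓘(ℝ, E') φ 1 y) := by
  have hd := hφ.mdifferentiable (by simp)
  -- Differentiating `φ (g k) = φ g * φ k` in `k` shows that left invariant fields correspond under
  -- `φ`.
  have rel (x : E) (g : G) : tder 𝓘(ℝ, E) 𝓘(ℝ, E') φ g (lT E g 1 x) =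
      lT E' (φ g) 1 (tder 𝓘(ℝ, E) 𝓘(ℝ, E') φ 1 x) := by
    have h1 := tder_comp_of_eq (hd g) (mdifferentiable_mul_left' (E := E) g 1) (mul_one g)
    have h2 := tder_comp_of_eq (mdifferentiable_mul_left' (E := E') (φ g) 1) (hd 1) (map_one φ)
    rw [show φ ∘ (fun k ↦ g * k) = (fun k ↦ φ g * k) ∘ φ by ext; simp, h2] at h1
    exact congrArg (fun T : E →L[ℝ] E' ↦ T x) h1.symm
  have := tder_mlieBracket_of_related (x := (1 : G)) hφ (contMDiff_linv x) (contMDiff_linv y)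
    (contMDiff_linv (G := G') (tder 𝓘(ℝ, E) 𝓘(ℝ, E') φ 1 x))
    (contMDiff_linv (G := G') (tder 𝓘(ℝ, E) 𝓘(ℝ, E') φ 1 y)) (rel x) (rel y)
  rw [map_one] at this
  exact this

theorem Ad_lbr (g : G) (x y : E) : Ad E g (lbr G x y) = lbr G (Ad E g x) (Ad E g y) :=
  tder_lbr (G := G) (MulAut.conj g).toMonoidHom
    ((contMDiff_const.mul contMDiff_id).mul contMDiff_const) x y

end LieGroups

/-! ### The derivative of the adjoint action -/

section AdDerivative

variable {E G : Type*} [NormedAddCommGroup E] [NormedSpace ℝ E] [FiniteDimensional ℝ E]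
  [TopologicalSpace G] [T2Space G] [ChartedSpace E G] [Group G] [LieGroup 𝓘(ℝ, E) ∞ G]

/-- The differential of `g ↦ Ad_g z` at the identity. -/
theorem tder_Ad_one [CompleteSpace E] (x z : E) :
    tder 𝓘(ℝ, E) 𝓘(ℝ, E) (fun g : G ↦ Ad E g z) 1 x = lbr G x z := by
  obtain ⟨f, hf, hf1⟩ := exists_contMDiff_tder_eq (1 : G) (ContinuousLinearMap.id ℝ E)
  have hfd := hf.mdifferentiable (by simp)
  have h1l (h : G) : lT E h (1 : G) = lT E h 1 := rfl
  -- left and right translates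
  have eL (g : G) (y : E) : tder 𝓘(ℝ, E) 𝓘(ℝ, E) (fun h ↦ f (g * h)) 1 y =
      tder 𝓘(ℝ, E) 𝓘(ℝ, E) f g (lT E g 1 y) :=
    congrArg (fun T : E →L[ℝ] E ↦ T y)
      (tder_comp_of_eq (hfd g) (mdifferentiable_mul_left' (E := E) g 1) (mul_one g))
  have eR (g : G) (y : E) : tder 𝓘(ℝ, E) 𝓘(ℝ, E) (fun h ↦ f (h * g)) 1 y =
      tder 𝓘(ℝ, E) 𝓘(ℝ, E) f g (rT E g 1 y) :=
    congrArg (fun T : E →L[ℝ] E ↦ T y)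
      (tder_comp_of_eq (hfd g) (mdifferentiable_mul_right' (E := E) g 1) (one_mul g))
  have hcomm := tder_linv_comm (hf (1 : G)) x z
  simp only [lT_one, hf1, ContinuousLinearMap.id_apply] at hcomm
  rw [hcomm]
  -- Since `dL_g z = dR_g (Ad_g z)`, the derivative of `f` along the left invariant field of `z` is
  -- `Θ` on the diagonal. This separates the dependence through the base point from that through
  -- `Ad`.
  let Θ : G × G → E := fun p ↦ tder 𝓘(ℝ, E) 𝓘(ℝ, E) f p.1 (rT E p.1 1 (Ad E p.2 z))
  have hΘ : ContMDiff (𝓘(ℝ, E).prod 𝓘(ℝ, E)) 𝓘(ℝ, E) ∞ Θ := fun p ↦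
    ContMDiffAt.tder_apply (hf p.1) (ContMDiffAt.rT_tangent contMDiffAt_fst
      (ContMDiffAt.Ad_apply contMDiffAt_snd contMDiffAt_const))
  have hΘd := hΘ.mdifferentiable (by simp)
  have e1 : tder 𝓘(ℝ, E) 𝓘(ℝ, E) (fun h ↦ tder 𝓘(ℝ, E) 𝓘(ℝ, E) f h (lT E h 1 z)) 1 x =
      tder (𝓘(ℝ, E).prod 𝓘(ℝ, E)) 𝓘(ℝ, E) Θ (1, 1) (x, x) := by
    have h2 := tder_comp (I := 𝓘(ℝ, E)) (f := fun g : G ↦ (g, g)) (x := 1) (hΘd _)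
      (mdifferentiableAt_id.prodMk mdifferentiableAt_id)
    have h3 : tder 𝓘(ℝ, E) (𝓘(ℝ, E).prod 𝓘(ℝ, E)) (fun g : G ↦ (g, g)) 1 =
        (ContinuousLinearMap.id ℝ E).prod (ContinuousLinearMap.id ℝ E) := by
      refine (mfderiv_prodMk (I := 𝓘(ℝ, E)) (x := (1 : G)) mdifferentiableAt_id
        mdifferentiableAt_id).trans ?_
      rw [mfderiv_id]; rfl
    have h4 : (fun h ↦ tder 𝓘(ℝ, E) 𝓘(ℝ, E) f h (lT E h 1 z)) = Θ ∘ fun g : G ↦ (g, g) := by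
      funext g
      simp [Θ, rT_Ad]
    rw [h4, h2, h3]; rfl
  have e2 : tder (𝓘(ℝ, E).prod 𝓘(ℝ, E)) 𝓘(ℝ, E) Θ (1, 1) (x, x) =
      tder 𝓘(ℝ, E) 𝓘(ℝ, E) (fun g ↦ Θ (g, 1)) 1 x +
      tder 𝓘(ℝ, E) 𝓘(ℝ, E) (fun g ↦ Θ (1, g)) 1 x := by
    rw [tder_prodMk_left (hΘd _), tder_prodMk_right (hΘd _), ← map_add]
    simp
  have e3 : (fun g ↦ Θ (1, g)) = fun g : G ↦ Ad E g z := by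
    funext g
    simp [Θ, hf1, rT_one]
  have e4 : (fun g ↦ Θ (g, 1)) = fun g : G ↦ tder 𝓘(ℝ, E) 𝓘(ℝ, E) (fun h ↦ f (h * g)) 1 z := by
    funext g
    rw [eR]
    simp [Θ, Ad_one]
  -- The first slot contributes a mixed derivative of `(h, g) ↦ f (h * g)`. By symmetry it equals
  -- the second term of the commutator and cancels, leaving the derivative of `Ad`.
  have e5 := tder_tder_prod_comm (f := fun p : G × G ↦ f (p.1 * p.2)) (p := 1) (q := 1)
    (hf.comp (contMDiff_mul 𝓘(ℝ, E) ∞)) z x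
  simp only [eL] at e5
  rw [e1, e2, e3, e4, ← e5]
  abel

/-- Writing points near `g` as `h * g`, the relation `Ad_{hg} = Ad_h Ad_g` moves the computation to
the identity. -/
theorem tder_Ad [CompleteSpace E] (g : G) (x z : E) :
    tder 𝓘(ℝ, E) 𝓘(ℝ, E) (fun g : G ↦ Ad E g z) g (rT E g 1 x) = lbr G x (Ad E g z) := by
  have hs (y : E) : MDifferentiable 𝓘(ℝ, E) 𝓘(ℝ, E) (fun g : G ↦ Ad E g y) := fun g ↦
    (ContMDiffAt.Ad_apply (m := g) contMDiffAt_id contMDiffAt_const).mdifferentiableAt (by simp)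
  have h1 := tder_comp_of_eq (hs z g) (mdifferentiable_mul_right' (E := E) g 1) (one_mul g)
  rw [show (fun g ↦ Ad E g z) ∘ (fun h ↦ h * g) = fun h : G ↦ Ad E h (Ad E g z) by
    funext h; exact Ad_mul_apply h g z] at h1
  rw [← tder_Ad_one, h1]
  rfl

end AdDerivative

/-! ### Dimension of smooth images and the inverse function theorem -/

section Charts

variable {E H N : Type*} [NormedAddCommGroup E] [NormedSpace ℝ E] [TopologicalSpace H]
  {I : ModelWithCorners ℝ E H} [I.Boundaryless] [TopologicalSpace N] [ChartedSpace H N]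
  {F : Type*} [NormedAddCommGroup F] [NormedSpace ℝ F]

theorem contDiffAt_comp_extChartAt_symm {f : N → F} {p : N} (hf : ContMDiffAt I 𝓘(ℝ, F) ∞ f p) :
    ContDiffAt ℝ ∞ (f ∘ (extChartAt I p).symm) (extChartAt I p p) := by
  have := (contMDiffAt_iff.1 hf).2
  rw [I.range_eq_univ, contDiffWithinAt_univ, extChartAt_model_space_eq_id] at this
  exact this

theorem tder_eq_fderiv_extChartAt {f : N → F} {p : N} (hf : MDifferentiableAt I 𝓘(ℝ, F) f p) :
    tder I 𝓘(ℝ, F) f p = fderiv ℝ (f ∘ (extChartAt I p).symm) (extChartAt I p p) := by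
  have h := hf.mfderiv
  simp only [writtenInExtChartAt, extChartAt_model_space_eq_id, PartialEquiv.refl_coe,
    I.range_eq_univ, fderivWithin_univ, Function.id_comp] at h
  exact h

variable {E' M : Type*} [NormedAddCommGroup E'] [NormedSpace ℝ E'] [TopologicalSpace M]
  [ChartedSpace E' M] [IsManifold 𝓘(ℝ, E') ∞ M]

/-- A smooth map from a second countable manifold whose range has nonempty interior does not raise
the dimension. -/
theorem finrank_le_of_isOpen_subset_range [FiniteDimensional ℝ E] [FiniteDimensional ℝ E']
    [SecondCountableTopology N] {f : N → M} (hf : ContMDiff I 𝓘(ℝ, E') ∞ f) {U : Set M}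
    (hU : IsOpen U) {x₀ : M} (hx₀ : x₀ ∈ U) (hr : U ⊆ range f) :
    Module.finrank ℝ E' ≤ Module.finrank ℝ E := by
  set ψ := extChartAt 𝓘(ℝ, E') x₀ with hψ
  set s : Set N := f ⁻¹' ψ.source
  -- In charts `f` is `C¹` on a ball around the image of `p`, and such maps do not raise Hausdorff
  -- dimension.
  have key : ∀ p ∈ s, ∃ V ∈ 𝓝[s] p, dimH ((ψ ∘ f) '' V) ≤ Module.finrank ℝ E := by
    intro p hp
    have h1 : ContMDiffAt I 𝓘(ℝ, E') ∞ (ψ ∘ f) p :=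
      (contMDiffAt_extChartAt' (by rw [← extChartAt_source 𝓘(ℝ, E')]; exact hp)).comp p (hf p)
    have h2 := contDiffAt_comp_extChartAt_symm h1
    obtain ⟨u, hu, hcu⟩ := (h2.of_le (m := 1) (ENat.LEInfty.out)).contDiffOn le_rfl (by simp)
    obtain ⟨r, hr, hball⟩ := Metric.mem_nhds_iff.1 hu
    refine ⟨(extChartAt I p).source ∩ extChartAt I p ⁻¹' Metric.ball (extChartAt I p p) r,
      mem_nhdsWithin_of_mem_nhds (Filter.inter_mem (extChartAt_source_mem_nhds p)
        ((continuousAt_extChartAt p).preimage_mem_nhds (Metric.ball_mem_nhds _ hr))), ?_⟩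
    have h3 : (ψ ∘ f) '' ((extChartAt I p).source ∩
        extChartAt I p ⁻¹' Metric.ball (extChartAt I p p) r) ⊆
        ((ψ ∘ f) ∘ (extChartAt I p).symm) '' Metric.ball (extChartAt I p p) r := by
      rintro _ ⟨q, ⟨hq, hq2⟩, rfl⟩
      exact ⟨_, hq2, congrArg (ψ ∘ f) ((extChartAt I p).left_inv hq)⟩
    calc _ ≤ dimH _ := dimH_mono h3
      _ ≤ dimH (Metric.ball (extChartAt I p p) r) :=
        (hcu.mono hball).dimH_image_le (convex_ball _ _) subset_rfl
      _ ≤ dimH (univ : Set E) := dimH_mono (subset_univ _)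
      _ = _ := Real.dimH_univ_eq_finrank E
  choose! V hV hdim using key
  -- By second countability countably many of these pieces suffice, and the Hausdorff dimension of a
  -- countable union is the supremum.
  obtain ⟨t, hts, htc, hst⟩ := TopologicalSpace.countable_cover_nhdsWithin hV
  have h1 : ψ '' (U ∩ ψ.source) ⊆ ⋃ p ∈ t, (ψ ∘ f) '' V p := by
    rintro _ ⟨x, ⟨hxU, hxs⟩, rfl⟩
    obtain ⟨q, rfl⟩ := hr hxU
    obtain ⟨p, hp, hq⟩ := mem_iUnion₂.1 (hst (show q ∈ s from hxs))
    exact mem_iUnion₂.2 ⟨p, hp, q, hq, rfl⟩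
  have h2 : ψ '' (U ∩ ψ.source) ∈ 𝓝 (ψ x₀) :=
    extChartAt_image_nhds_mem_nhds_of_boundaryless
      (Filter.inter_mem (hU.mem_nhds hx₀) (extChartAt_source_mem_nhds x₀))
  have h3 := Real.dimH_of_mem_nhds h2
  have h4 : (Module.finrank ℝ E' : ENNReal) ≤ Module.finrank ℝ E := by
    rw [← h3]
    refine (dimH_mono h1).trans ?_
    rw [dimH_bUnion htc]
    exact iSup₂_le fun p hp ↦ hdim p (hts hp)
  exact_mod_cast h4

/-- The inverse function theorem on manifolds: a smooth map with bijective differential has a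
smooth local section. -/
theorem exists_contMDiffAt_local_section [FiniteDimensional ℝ E] [IsManifold I ∞ N] {f : N → M}
    {p : N} {y : M}
    (hf : ContMDiffAt I 𝓘(ℝ, E') ∞ f p) (hy : f p = y) (e : E ≃L[ℝ] E')
    (he : tder I 𝓘(ℝ, E') f p = e) :
    ∃ σ : M → N, ContMDiffAt 𝓘(ℝ, E') I ∞ σ y ∧ σ y = p ∧ ∀ᶠ z in 𝓝 y, f (σ z) = z := by
  subst hy
  have := FiniteDimensional.complete ℝ E
  set ψ := extChartAt 𝓘(ℝ, E') (f p) with hψ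
  set φ := extChartAt I p with hφ
  have h1 : ContMDiffAt I 𝓘(ℝ, E') ∞ (ψ ∘ f) p := contMDiffAt_extChartAt.comp p hf
  have h2 := contDiffAt_comp_extChartAt_symm h1
  have hd : tder I 𝓘(ℝ, E') (ψ ∘ f) p = e := by
    rw [tder_comp (contMDiffAt_extChartAt (n := ∞).mdifferentiableAt (by simp))
      (hf.mdifferentiableAt (by simp)), he]
    have h2 : tder 𝓘(ℝ, E') 𝓘(ℝ, E') ψ (f p) = ContinuousLinearMap.id ℝ E' :=
      mfderiv_extChartAt_self
    rw [h2]; rfl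
  have h3 : HasFDerivAt ((ψ ∘ f) ∘ φ.symm) (e : E →L[ℝ] E') (φ p) := by
    rw [← hd, tder_eq_fderiv_extChartAt (h1.mdifferentiableAt (by simp))]
    exact (h2.differentiableAt (by simp)).hasFDerivAt
  have hval : ((ψ ∘ f) ∘ φ.symm) (φ p) = ψ (f p) := by simp [φ]
  have h4 := h2.to_localInverse h3 (by simp)
  have h5 := h2.localInverse_apply_image h3 (by simp)
  have h6 := (h2.hasStrictFDerivAt' h3 (by simp)).eventually_right_inverse
  change ∀ᶠ y in _, ((ψ ∘ f) ∘ φ.symm) (h2.localInverse h3 (by simp) y) = y at h6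
  set τ := h2.localInverse h3 (by simp) with hτ
  rw [hval] at h4 h5 h6
  have hψc : ContinuousAt ψ (f p) := continuousAt_extChartAt _
  have hτs : ContMDiffAt 𝓘(ℝ, E') 𝓘(ℝ, E) ∞ (τ ∘ ψ) (f p) :=
    h4.contMDiffAt.comp (f p) contMDiffAt_extChartAt
  have hφs : ContMDiffAt 𝓘(ℝ, E) I ∞ φ.symm (φ p) := by
    have := contMDiffWithinAt_extChartAt_symm_range (I := I) (n := ∞) p (mem_extChartAt_target p)
    rwa [I.range_eq_univ, contMDiffWithinAt_univ] at this
  have hσ : ContMDiffAt 𝓘(ℝ, E') I ∞ (φ.symm ∘ (τ ∘ ψ)) (f p) :=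
    ContMDiffAt.comp_of_eq hφs hτs h5
  have hσp : (φ.symm ∘ (τ ∘ ψ)) (f p) = p := by simp [h5, φ]
  refine ⟨_, hσ, hσp, ?_⟩
  have hc : ContinuousAt (f ∘ (φ.symm ∘ (τ ∘ ψ))) (f p) :=
    ContinuousAt.comp (by rw [hσp]; exact hf.continuousAt) hσ.continuousAt
  -- The equality obtained in the chart descends to the manifold only where `ψ` is injective, so `f
  -- (σ z)` must be known to lie in its domain.
  have h7 : ∀ᶠ z in 𝓝 (f p), f ((φ.symm ∘ (τ ∘ ψ)) z) ∈ ψ.source :=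
    hc.preimage_mem_nhds (by
      rw [Function.comp_apply, hσp]; exact extChartAt_source_mem_nhds (f p))
  filter_upwards [h7, extChartAt_source_mem_nhds (I := 𝓘(ℝ, E')) (f p),
    hψc.tendsto.eventually h6] with z hz1 hz2 hz3
  exact ψ.injOn hz1 hz2 hz3

end Charts

/-! ### Lie subgroups and their Lie algebras -/

section Subgroups

variable {EG EB EC G : Type*} [NormedAddCommGroup EG] [NormedSpace ℝ EG]
  [NormedAddCommGroup EB] [NormedSpace ℝ EB] [NormedAddCommGroup EC] [NormedSpace ℝ EC]
  [TopologicalSpace G] [ChartedSpace EG G] [Group G]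

section

variable (B : Subgroup G) [ChartedSpace EB B] [hB : IsLieSubgroup EG EB B]

variable (EG EB) in
theorem contMDiff_val : ContMDiff 𝓘(ℝ, EB) 𝓘(ℝ, EG) ∞ (Subtype.val : B → G) :=
  hB.isSmoothEmbedding.contMDiff

variable (EG EB) in
theorem mdifferentiable_val : MDifferentiable 𝓘(ℝ, EB) 𝓘(ℝ, EG) (Subtype.val : B → G) :=
  (contMDiff_val EG EB B).mdifferentiable (by simp)

variable (EG EB) in
include hB in
theorem lieGroup_subgroup : LieGroup 𝓘(ℝ, EB) ∞ B := hB.toLieGroup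

variable [LieGroup 𝓘(ℝ, EG) ∞ G]

theorem inclDeriv_lT (a b : B) (x : EB) :
    inclDeriv EG EB B (a * b) (lT EB a b x) = lT EG (a : G) b (inclDeriv EG EB B b x) := by
  have h1 := tder_comp (mdifferentiable_val EG EB B (a * b))
    (mdifferentiable_mul_left' (E := EB) a b)
  have h2 := tder_comp (mdifferentiable_mul_left' (E := EG) (a : G) b)
    (mdifferentiable_val EG EB B b)
  exact congrArg (fun T : EB →L[ℝ] EG ↦ T x) (h1.symm.trans h2)

theorem inclDeriv_rT (a b : B) (x : EB) :
    inclDeriv EG EB B (b * a) (rT EB a b x) = rT EG (a : G) b (inclDeriv EG EB B b x) := by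
  have h1 := tder_comp (f := fun b ↦ b * a) (mdifferentiable_val EG EB B (b * a))
    (mdifferentiable_mul_right' (E := EB) a b)
  have h2 := tder_comp (mdifferentiable_mul_right' (E := EG) (a : G) b)
    (mdifferentiable_val EG EB B b)
  exact congrArg (fun T : EB →L[ℝ] EG ↦ T x) (h1.symm.trans h2)

theorem inclDeriv_lT_one (b : B) (x : EB) :
    inclDeriv EG EB B b (lT EB b 1 x) = lT EG (b : G) 1 (inclDeriv EG EB B 1 x) := by
  have := inclDeriv_lT (EG := EG) B b 1 x
  rwa [mul_one] at this

theorem inclDeriv_rT_one (b : B) (x : EB) :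
    inclDeriv EG EB B b (rT EB b 1 x) = rT EG (b : G) 1 (inclDeriv EG EB B 1 x) := by
  have := inclDeriv_rT (EG := EG) B b 1 x
  rwa [one_mul] at this

theorem inclDeriv_lbr [CompleteSpace EB] [CompleteSpace EG] (x y : EB) :
    inclDeriv EG EB B 1 (lbr B x y) = lbr G (inclDeriv EG EB B 1 x) (inclDeriv EG EB B 1 y) :=
  tder_lbr B.subtype (contMDiff_val EG EB B) x y

theorem Ad_inclDeriv (b : B) (x : EB) :
    Ad EG (b : G) (inclDeriv EG EB B 1 x) = inclDeriv EG EB B 1 (Ad EB b x) := by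
  have h1 := inclDeriv_lT_one (EG := EG) B b x
  have h2 := inclDeriv_rT (EG := EG) B b⁻¹ b (lT EB b 1 x)
  rw [mul_inv_cancel, h1] at h2
  rw [Ad_eq, Ad_eq]
  exact h2.symm

/-- An integral curve of the left invariant vector field on `G` inside the subgroup. -/
theorem exists_isMIntegralCurveAt_subgroup [CompleteSpace EB] (x : EB) :
    ∃ γ : ℝ → B, γ 0 = 1 ∧ HasMFDerivAt 𝓘(ℝ, ℝ) 𝓘(ℝ, EB) γ 0
        ((1 : ℝ →L[ℝ] ℝ).smulRight (lT EB (γ 0) 1 x)) ∧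
      IsMIntegralCurveAt (I := 𝓘(ℝ, EG)) (fun t ↦ (γ t : G))
        (fun g : G ↦ (lT EG g 1 (inclDeriv EG EB B 1 x) : EG)) 0 := by
  obtain ⟨γ, h0, hγ⟩ := exists_isMIntegralCurveAt_of_contMDiffAt_boundaryless
    (I := 𝓘(ℝ, EB)) (M := B) (v := fun b ↦ (lT EB b 1 x : EB)) (x₀ := 1) 0
    ((contMDiff_linv x 1).of_le (ENat.LEInfty.out))
  refine ⟨γ, h0, hγ.self_of_nhds, ?_⟩
  filter_upwards [hγ] with t ht
  have h1 := ((mdifferentiable_val EG EB B (γ t)).hasMFDerivAt).comp t ht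
  have h2 : (tder 𝓘(ℝ, EB) 𝓘(ℝ, EG) (Subtype.val : B → G) (γ t)).comp
      ((1 : ℝ →L[ℝ] ℝ).smulRight (lT EB (γ t) 1 x)) =
      (1 : ℝ →L[ℝ] ℝ).smulRight (lT EG (γ t : G) 1 (inclDeriv EG EB B 1 x)) := by
    ext
    have : tder 𝓘(ℝ, EB) 𝓘(ℝ, EG) (Subtype.val : B → G) (γ t) (lT EB (γ t) 1 x) =
      lT EG (γ t : G) 1 (inclDeriv EG EB B 1 x) := inclDeriv_lT_one (EG := EG) B (γ t) x
    simpa using this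
  exact h2 ▸ h1

end

section

variable {B C : Subgroup G} [ChartedSpace EB B] [IsLieSubgroup EG EB B]
  [ChartedSpace EC C] [IsLieSubgroup EG EC C] [LieGroup 𝓘(ℝ, EG) ∞ G]

/-- The Lie algebras of subgroups with trivial intersection are independent. -/
theorem inclDeriv_eq_inclDeriv [T2Space G] [CompleteSpace EG] [CompleteSpace EB] [CompleteSpace EC]
    (h : B ⊓ C = ⊥) {x : EB} {y : EC} (hxy : inclDeriv EG EB B 1 x = inclDeriv EG EC C 1 y) :
    x = 0 := by
  obtain ⟨γ, h0, hd, hγ⟩ := exists_isMIntegralCurveAt_subgroup (EG := EG) B x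
  obtain ⟨δ, k0, -, hδ⟩ := exists_isMIntegralCurveAt_subgroup (EG := EG) C y
  rw [← hxy] at hδ
  -- Both curves integrate the same left invariant field on `G` and start at `1`. By uniqueness they
  -- agree near `0`, so they lie in `B ⊓ C` and are constant there.
  have hev := isMIntegralCurveAt_eventuallyEq_of_contMDiffAt_boundaryless
    ((contMDiff_linv (inclDeriv EG EB B 1 x) _).of_le (ENat.LEInfty.out)) hγ hδ
    (by rw [h0, k0]; rfl)
  have h1 : γ =ᶠ[𝓝 0] fun _ ↦ 1 := by
    filter_upwards [hev] with t ht
    have : (γ t : G) ∈ B ⊓ C := ⟨(γ t).2, by rw [ht]; exact (δ t).2⟩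
    rw [h, Subgroup.mem_bot] at this
    exact Subtype.ext this
  have h2 : tder 𝓘(ℝ, ℝ) 𝓘(ℝ, EB) γ 0 = (1 : ℝ →L[ℝ] ℝ).smulRight (lT EB (γ 0) 1 x) := hd.mfderiv
  rw [tder_congr h1, tder_const, h0, lT_one] at h2
  have := congrArg (fun T : ℝ →L[ℝ] EB ↦ T 1) h2
  simpa using this.symm

end

end Subgroups

/-! ### Factorizations in a matched pair -/

section Algebra

variable {G : Type*} [Group G] {B C : Subgroup G}

/-- Two factorizations of one element differ by an element of `B ⊓ C`, so the choice made in
`sourceMap` does not matter. -/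
theorem sourceMap_mul (h : B ⊓ C = ⊥) (c : C) (b : B) : sourceMap B C ((c : G) * b) = b := by
  have hex : ∃ b' : B, ∃ c' : C, (c' : G) * b' = c * b := ⟨b, c, rfl⟩
  rw [sourceMap, dif_pos hex]
  obtain ⟨c', hc'⟩ := hex.choose_spec
  set b' := hex.choose
  have h1 : (b' : G) * (b : G)⁻¹ = (c' : G)⁻¹ * c := by
    rw [mul_inv_eq_iff_eq_mul, mul_assoc, ← hc', inv_mul_cancel_left]
  have h2 : (b' : G) * (b : G)⁻¹ ∈ B ⊓ C :=
    ⟨B.mul_mem b'.2 (B.inv_mem b.2), by rw [h1]; exact C.mul_mem (C.inv_mem c'.2) c.2⟩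
  rw [h, Subgroup.mem_bot, mul_inv_eq_one] at h2
  exact Subtype.ext h2

theorem rangeMap_mul (h : B ⊓ C = ⊥) (b : B) (c : C) : rangeMap B C ((b : G) * c) = b := by
  have hex : ∃ b' : B, ∃ c' : C, (b' : G) * c' = b * c := ⟨b, c, rfl⟩
  rw [rangeMap, dif_pos hex]
  obtain ⟨c', hc'⟩ := hex.choose_spec
  set b' := hex.choose
  have h1 : (b : G)⁻¹ * b' = c * (c' : G)⁻¹ := by
    rw [inv_mul_eq_iff_eq_mul, ← mul_assoc, ← hc', mul_inv_cancel_right]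
  have h2 : (b : G)⁻¹ * b' ∈ B ⊓ C :=
    ⟨B.mul_mem (B.inv_mem b.2) b'.2, by rw [h1]; exact C.mul_mem c.2 (C.inv_mem c'.2)⟩
  rw [h, Subgroup.mem_bot, inv_mul_eq_one] at h2
  exact Subtype.ext h2.symm

theorem sourceMap_coe (h : B ⊓ C = ⊥) (b : B) : sourceMap B C (b : G) = b := by
  simpa using sourceMap_mul h 1 b

theorem sourceMap_coe_right (h : B ⊓ C = ⊥) (c : C) : sourceMap B C (c : G) = 1 := by
  simpa using sourceMap_mul h c 1

end Algebra

/-! ### The splitting `𝔤 = 𝔟 ⊕ 𝔠` and smoothness of the source map at the identity -/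

section MatchedPairs

variable {EG EB EC G : Type*} [NormedAddCommGroup EG] [NormedSpace ℝ EG]
  [NormedAddCommGroup EB] [NormedSpace ℝ EB] [NormedAddCommGroup EC] [NormedSpace ℝ EC]
  [FiniteDimensional ℝ EG] [FiniteDimensional ℝ EB] [FiniteDimensional ℝ EC]
  [TopologicalSpace G] [T2Space G] [SecondCountableTopology G] [ChartedSpace EG G] [Group G]
  [LieGroup 𝓘(ℝ, EG) ∞ G]
  {B C : Subgroup G} [ChartedSpace EB B] [IsLieSubgroup EG EB B]
  [ChartedSpace EC C] [IsLieSubgroup EG EC C]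

omit [FiniteDimensional ℝ EG] [FiniteDimensional ℝ EB] [FiniteDimensional ℝ EC] [T2Space G]
  [SecondCountableTopology G] in
variable (EG EB EC) in
theorem contMDiff_subgroup_mul : ContMDiff (𝓘(ℝ, EB).prod 𝓘(ℝ, EC)) 𝓘(ℝ, EG) ∞
    (fun p : B × C ↦ (p.2 : G) * (p.1 : G)) :=
  ((contMDiff_val EG EC C).comp contMDiff_snd).mul ((contMDiff_val EG EB B).comp contMDiff_fst)

variable (EG EB EC) in
/-- The Lie algebra of `G` is the direct sum of the Lie algebras of `B` and `C`. -/
theorem exists_splitting (hBC : IsMatchedPair B C) : ∃ e : (EB × EC) ≃L[ℝ] EG,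
    ∀ p, e p = inclDeriv EG EB B 1 p.1 + inclDeriv EG EC C 1 p.2 := by
  have := FiniteDimensional.complete ℝ EG
  have := FiniteDimensional.complete ℝ EB
  have := FiniteDimensional.complete ℝ EC
  let T : (EB × EC) →ₗ[ℝ] EG :=
    (inclDeriv EG EB B 1).toLinearMap.coprod (inclDeriv EG EC C 1).toLinearMap
  have hT (p : EB × EC) : T p = inclDeriv EG EB B 1 p.1 + inclDeriv EG EC C 1 p.2 := by simp [T]
  have hinj : Function.Injective T := by
    rw [← LinearMap.ker_eq_bot, LinearMap.ker_eq_bot']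
    rintro ⟨x, y⟩ hp
    rw [hT] at hp
    have h1 : inclDeriv EG EB B 1 x = inclDeriv EG EC C 1 (-y) := by
      rw [map_neg]; exact eq_neg_of_add_eq_zero_left hp
    have h2 : inclDeriv EG EC C 1 y = inclDeriv EG EB B 1 (-x) := by
      rw [map_neg]; exact eq_neg_of_add_eq_zero_right hp
    exact Prod.ext (inclDeriv_eq_inclDeriv hBC.inf_eq_bot h1)
      (inclDeriv_eq_inclDeriv (inf_comm B C ▸ hBC.inf_eq_bot) h2)
  have : SecondCountableTopology B := TopologicalSpace.Subtype.secondCountableTopology _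
  have : SecondCountableTopology C := TopologicalSpace.Subtype.secondCountableTopology _
  -- Surjectivity is obtained by counting dimensions: multiplication `B × C → G` covers the open set
  -- `B C`.
  have hle : Module.finrank ℝ EG ≤ Module.finrank ℝ (EB × EC) := by
    refine finrank_le_of_isOpen_subset_range (I := 𝓘(ℝ, EB).prod 𝓘(ℝ, EC)) (N := B × C)
      (f := fun p ↦ (p.1 : G) * p.2)
      (((contMDiff_val EG EB B).comp contMDiff_fst).mul ((contMDiff_val EG EC C).comp contMDiff_snd))
      hBC.isOpen_mul (x₀ := 1) ⟨1, B.one_mem, 1, C.one_mem, mul_one 1⟩ ?_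
    rintro _ ⟨b, hb, c, hc, rfl⟩
    exact ⟨(⟨b, hb⟩, ⟨c, hc⟩), rfl⟩
  have heq := le_antisymm (LinearMap.finrank_le_finrank_of_injective hinj) hle
  exact ⟨(LinearEquiv.ofInjectiveOfFinrankEq T hinj heq).toContinuousLinearEquiv, fun p ↦ hT p⟩

variable (EG EB EC) in
-- The order `c b`, rather than `b c`, is the one that computes the source map. At the unit,
-- multiplication has the splitting isomorphism as its differential, so the inverse function theorem
-- applies.
theorem exists_local_decomposition (hBC : IsMatchedPair B C) :
    ∃ σ : G → B × C, ContMDiffAt 𝓘(ℝ, EG) (𝓘(ℝ, EB).prod 𝓘(ℝ, EC)) ∞ σ 1 ∧ σ 1 = 1 ∧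
      ∀ᶠ g in 𝓝 1, ((σ g).2 : G) * (σ g).1 = g := by
  have := lieGroup_subgroup EG EB B
  have := lieGroup_subgroup EG EC C
  obtain ⟨e, he⟩ := exists_splitting EG EB EC hBC
  have hm := contMDiff_subgroup_mul EG EB EC (B := B) (C := C)
  have hmd := hm.mdifferentiable (by simp)
  refine exists_contMDiffAt_local_section (p := 1) (y := 1) (hm 1) (mul_one 1) e ?_
  have h1 (x : EB) : tder (𝓘(ℝ, EB).prod 𝓘(ℝ, EC)) 𝓘(ℝ, EG)
      (fun p : B × C ↦ (p.2 : G) * (p.1 : G)) 1 (x, 0) = inclDeriv EG EB B 1 x := by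
    have h2 := tder_comp_of_eq (I := 𝓘(ℝ, EB)) (f := fun b : B ↦ (b, (1 : C))) (x := 1) (hmd 1)
      (mdifferentiableAt_id.prodMk mdifferentiableAt_const) rfl
    have h3 : tder 𝓘(ℝ, EB) (𝓘(ℝ, EB).prod 𝓘(ℝ, EC)) (fun b : B ↦ (b, (1 : C))) 1 =
      ContinuousLinearMap.inl ℝ EB EC := mfderiv_prod_left
    rw [h3] at h2
    have h4 : (fun p : B × C ↦ (p.2 : G) * (p.1 : G)) ∘ (fun b : B ↦ (b, (1 : C))) =
      Subtype.val := by ext; simp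
    rw [h4] at h2
    exact congrArg (fun T : EB →L[ℝ] EG ↦ T x) h2.symm
  have h1' (y : EC) : tder (𝓘(ℝ, EB).prod 𝓘(ℝ, EC)) 𝓘(ℝ, EG)
      (fun p : B × C ↦ (p.2 : G) * (p.1 : G)) 1 (0, y) = inclDeriv EG EC C 1 y := by
    have h2 := tder_comp_of_eq (I := 𝓘(ℝ, EC)) (f := fun c : C ↦ ((1 : B), c)) (x := 1) (hmd 1)
      (mdifferentiableAt_const.prodMk mdifferentiableAt_id) rfl
    have h3 : tder 𝓘(ℝ, EC) (𝓘(ℝ, EB).prod 𝓘(ℝ, EC)) (fun c : C ↦ ((1 : B), c)) 1 =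
      ContinuousLinearMap.inr ℝ EB EC := mfderiv_prod_right
    rw [h3] at h2
    have h4 : (fun p : B × C ↦ (p.2 : G) * (p.1 : G)) ∘ (fun c : C ↦ ((1 : B), c)) =
      Subtype.val := by ext; simp
    rw [h4] at h2
    exact congrArg (fun T : EC →L[ℝ] EG ↦ T y) h2.symm
  refine ContinuousLinearMap.ext fun p ↦ ?_
  have h5 : p = (p.1, 0) + (0, p.2) := by simp
  rw [h5, map_add, h1, h1', ContinuousLinearEquiv.coe_coe, he]
  simp

variable (EG EB B C) in
/-- The projection `𝔤 → 𝔟` along `𝔠`, as the differential of the source map at the unit. -/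
def projB : EG →L[ℝ] EB := tder 𝓘(ℝ, EG) 𝓘(ℝ, EB) (sourceMap B C) 1

variable (EG EB B C) in
/-- The properties of the source map of a matched pair that do not mention the smooth structure of
the second subgroup. -/
structure HasSmoothSource : Prop where
  inf_eq_bot : B ⊓ C = ⊥
  mul_mem_nhds : ∀ᶠ g in 𝓝 (1 : G), ∃ c : C, ∃ b : B, (c : G) * b = g
  contMDiffAt : ContMDiffAt 𝓘(ℝ, EG) 𝓘(ℝ, EB) ∞ (sourceMap B C) 1
  projB_inclDeriv : ∀ x, projB EG EB B C (inclDeriv EG EB B 1 x) = x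
  projB_lbr : ∀ x y : EG, projB EG EB B C x = 0 → projB EG EB B C y = 0 →
    projB EG EB B C (lbr G x y) = 0

variable (EG EB EC) in
include EC in
-- The source map is the identity on `B` and constant on `C`, so its differential at `1` is the
-- projection onto `𝔟` along `𝔠`. The kernel is then the Lie algebra of `C`, hence closed under
-- brackets. Later arguments use these properties and not the smooth structure of `C`.
theorem IsMatchedPair.hasSmoothSource (hBC : IsMatchedPair B C) : HasSmoothSource EG EB B C := by
  have := FiniteDimensional.complete ℝ EG
  have := FiniteDimensional.complete ℝ EB
  have := FiniteDimensional.complete ℝ EC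
  obtain ⟨σ, hσ, -, hev⟩ := exists_local_decomposition EG EB EC hBC
  have hs : ContMDiffAt 𝓘(ℝ, EG) 𝓘(ℝ, EB) ∞ (sourceMap B C) 1 := by
    refine (contMDiffAt_fst.comp 1 hσ).congr_of_eventuallyEq ?_
    filter_upwards [hev] with g hg
    conv_lhs => rw [← hg]
    exact sourceMap_mul hBC.inf_eq_bot _ _
  have hB (x : EB) : projB EG EB B C (inclDeriv EG EB B 1 x) = x := by
    have h := tder_comp (x := (1 : B)) (hs.mdifferentiableAt (by simp))
      (mdifferentiable_val EG EB B 1)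
    rw [show sourceMap B C ∘ (Subtype.val : B → G) = id from
      funext fun b ↦ sourceMap_coe hBC.inf_eq_bot b, tder_id] at h
    exact congrArg (fun T : EB →L[ℝ] EB ↦ T x) h.symm
  have hC (y : EC) : projB EG EB B C (inclDeriv EG EC C 1 y) = 0 := by
    have h := tder_comp (x := (1 : C)) (hs.mdifferentiableAt (by simp))
      (mdifferentiable_val EG EC C 1)
    rw [show sourceMap B C ∘ (Subtype.val : C → G) = fun _ ↦ 1 from
      funext fun c ↦ sourceMap_coe_right hBC.inf_eq_bot c, tder_const] at h
    exact congrArg (fun T : EC →L[ℝ] EB ↦ T y) h.symm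
  obtain ⟨e, he⟩ := exists_splitting EG EB EC hBC
  have hker (x : EG) (hx : projB EG EB B C x = 0) : ∃ y, x = inclDeriv EG EC C 1 y := by
    refine ⟨(e.symm x).2, ?_⟩
    have h1 := he (e.symm x)
    rw [e.apply_symm_apply] at h1
    rw [h1, map_add, hB, hC, add_zero] at hx
    rwa [hx, map_zero, zero_add] at h1
  refine ⟨hBC.inf_eq_bot, hev.mono fun g hg ↦ ⟨_, _, hg⟩, hs, hB, fun x y hx hy ↦ ?_⟩
  obtain ⟨x, rfl⟩ := hker x hx
  obtain ⟨y, rfl⟩ := hker y hy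
  rw [← inclDeriv_lbr, hC]

end MatchedPairs

/-! ### Chain rule for graphs and the derivative of inversion -/

section ChainRule

variable {E E' F M M' : Type*} [NormedAddCommGroup E] [NormedSpace ℝ E]
  [NormedAddCommGroup E'] [NormedSpace ℝ E'] [NormedAddCommGroup F] [NormedSpace ℝ F]
  [TopologicalSpace M] [ChartedSpace E M] [TopologicalSpace M'] [ChartedSpace E' M']

theorem tder_comp_prodMk {Φ : M × M' → F} {q : M → M'} {p : M}
    (hΦ : MDifferentiableAt (𝓘(ℝ, E).prod 𝓘(ℝ, E')) 𝓘(ℝ, F) Φ (p, q p))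
    (hq : MDifferentiableAt 𝓘(ℝ, E) 𝓘(ℝ, E') q p) (u : E) :
    tder 𝓘(ℝ, E) 𝓘(ℝ, F) (fun m ↦ Φ (m, q m)) p u =
      tder 𝓘(ℝ, E) 𝓘(ℝ, F) (fun m ↦ Φ (m, q p)) p u +
      tder 𝓘(ℝ, E') 𝓘(ℝ, F) (fun n ↦ Φ (p, n)) (q p) (tder 𝓘(ℝ, E) 𝓘(ℝ, E') q p u) := by
  have h1 := tder_comp (I := 𝓘(ℝ, E)) (f := fun m : M ↦ (m, q m)) (x := p) hΦ
    (mdifferentiableAt_id.prodMk hq)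
  have h2 : tder 𝓘(ℝ, E) (𝓘(ℝ, E).prod 𝓘(ℝ, E')) (fun m : M ↦ (m, q m)) p =
      (ContinuousLinearMap.id ℝ E).prod (tder 𝓘(ℝ, E) 𝓘(ℝ, E') q p) := by
    refine (mfderiv_prodMk (I := 𝓘(ℝ, E)) (x := p) mdifferentiableAt_id hq).trans ?_
    rw [mfderiv_id]; rfl
  rw [h2] at h1
  rw [tder_prodMk_left hΦ, tder_prodMk_right hΦ, ← map_add]
  have h3 : ((u, 0) + (0, tder 𝓘(ℝ, E) 𝓘(ℝ, E') q p u) : E × E') =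
    (u, tder 𝓘(ℝ, E) 𝓘(ℝ, E') q p u) := by simp
  rw [h3]
  exact congrArg (fun T : E →L[ℝ] F ↦ T u) h1

end ChainRule

theorem tder_inv_one {E G : Type*} [NormedAddCommGroup E] [NormedSpace ℝ E] [TopologicalSpace G]
    [ChartedSpace E G] [Group G] [LieGroup 𝓘(ℝ, E) ∞ G] (x : E) :
    tder 𝓘(ℝ, E) 𝓘(ℝ, E) (fun g : G ↦ g⁻¹) 1 x = -x := by
  have hi : MDifferentiable 𝓘(ℝ, E) 𝓘(ℝ, E) (fun g : G ↦ g⁻¹) :=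
    (contMDiff_inv 𝓘(ℝ, E) ∞).mdifferentiable (by simp)
  have hm : MDifferentiable (𝓘(ℝ, E).prod 𝓘(ℝ, E)) 𝓘(ℝ, E) (fun p : G × G ↦ p.1 * p.2) :=
    (contMDiff_mul 𝓘(ℝ, E) ∞).mdifferentiable (by simp)
  have h1 := tder_comp (I := 𝓘(ℝ, E)) (f := fun g : G ↦ (g, g⁻¹)) (x := 1) (hm _)
    (mdifferentiableAt_id.prodMk (hi 1))
  have h2 : tder 𝓘(ℝ, E) (𝓘(ℝ, E).prod 𝓘(ℝ, E)) (fun g : G ↦ (g, g⁻¹)) 1 =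
      (ContinuousLinearMap.id ℝ E).prod (tder 𝓘(ℝ, E) 𝓘(ℝ, E) (fun g : G ↦ g⁻¹) 1) := by
    refine (mfderiv_prodMk (I := 𝓘(ℝ, E)) (x := (1 : G)) mdifferentiableAt_id (hi 1)).trans ?_
    rw [mfderiv_id]; rfl
  rw [show (fun p : G × G ↦ p.1 * p.2) ∘ (fun g : G ↦ (g, g⁻¹)) = fun _ ↦ 1 by ext; simp,
    tder_const, h2] at h1
  have h3 := congrArg (fun T : E →L[ℝ] E ↦ T x) h1
  have h4 := mfderiv_prod_eq_add_apply (v := ((x, tder 𝓘(ℝ, E) 𝓘(ℝ, E) (fun g : G ↦ g⁻¹) 1 x)))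
    (hm ((1 : G), (1 : G)⁻¹))
  have h5 : (0 : E) = rT E (1 : G)⁻¹ 1 x +
      lT E 1 (1 : G)⁻¹ (tder 𝓘(ℝ, E) 𝓘(ℝ, E) (fun g : G ↦ g⁻¹) 1 x) := h3.trans h4
  rw [inv_one, rT_one, lT_one] at h5
  exact (neg_eq_of_add_eq_zero_right h5.symm).symm

/-! ### Differentials of the source and range maps -/

section Source

variable {EG EB G : Type*} [NormedAddCommGroup EG] [NormedSpace ℝ EG]
  [NormedAddCommGroup EB] [NormedSpace ℝ EB]
  [TopologicalSpace G] [ChartedSpace EG G] [Group G] [LieGroup 𝓘(ℝ, EG) ∞ G]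
  {B C : Subgroup G} [ChartedSpace EB B] [IsLieSubgroup EG EB B]

variable (EG EB B C) in
/-- The value at `b` of the anchor on the left translate of `y`. -/
def anchorVec (y : EG) (b : B) : EB := rT EB b 1 (projB EG EB B C (Ad EG (b : G) y))

variable (EG EB B C) in
/-- The projection of the Lie algebra onto `𝔠` along `𝔟`. -/
def projC : EG →L[ℝ] EG :=
  ContinuousLinearMap.id ℝ EG - (inclDeriv EG EB B 1).comp (projB EG EB B C)

omit [LieGroup 𝓘(ℝ, EG) ∞ G] [IsLieSubgroup EG EB B] in
theorem projC_apply (y : EG) :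
    projC EG EB B C y = y - inclDeriv EG EB B 1 (projB EG EB B C y) := rfl

namespace HasSmoothSource

variable (h : HasSmoothSource EG EB B C)
include h

omit [LieGroup 𝓘(ℝ, EG) ∞ G] [IsLieSubgroup EG EB B] in
theorem projB_projC (y : EG) : projB EG EB B C (projC EG EB B C y) = 0 := by
  rw [projC_apply, map_sub, h.projB_inclDeriv, sub_self]

omit [LieGroup 𝓘(ℝ, EG) ∞ G] [IsLieSubgroup EG EB B] in
theorem projC_inclDeriv (x : EB) : projC EG EB B C (inclDeriv EG EB B 1 x) = 0 := by
  rw [projC_apply, h.projB_inclDeriv, sub_self]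

/-- For `k` near `c b` the element `c⁻¹ k b⁻¹` is near `1` and hence factors; multiplying back
factors `k`. This carries the behaviour of `s` at `1` to every point of `C B`, and also shows that
`C B` is open. -/
theorem eventually_sourceMap {g : G} {c : C} {b : B} (hg : (c : G) * b = g) :
    ∀ᶠ k in 𝓝 g, (∃ c' : C, ∃ b' : B, (c' : G) * b' = k) ∧
      sourceMap B C k = sourceMap B C ((c : G)⁻¹ * (k * (b : G)⁻¹)) * b := by
  have := topologicalGroup_of_lieGroup 𝓘(ℝ, EG) ∞ (G := G)
  have hc : ContinuousAt (fun k : G ↦ (c : G)⁻¹ * (k * (b : G)⁻¹)) g := by fun_prop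
  have h1 : (c : G)⁻¹ * (g * (b : G)⁻¹) = 1 := by rw [← hg]; group
  have h2 := hc.tendsto
  rw [h1] at h2
  filter_upwards [h2.eventually h.mul_mem_nhds] with k ⟨c', b', hk⟩
  have h3 : k = ((c * c' : C) : G) * ((b' * b : B) : G) := by
    push_cast
    rw [mul_assoc, ← mul_assoc (c' : G), hk]; group
  refine ⟨⟨_, _, h3.symm⟩, ?_⟩
  rw [← hk, sourceMap_mul h.inf_eq_bot]
  conv_lhs => rw [h3]
  rw [sourceMap_mul h.inf_eq_bot]

theorem contMDiffAt_sourceMap {g : G} {c : C} {b : B} (hg : (c : G) * b = g) :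
    ContMDiffAt 𝓘(ℝ, EG) 𝓘(ℝ, EB) ∞ (sourceMap B C) g := by
  have := lieGroup_subgroup EG EB B
  have h1 : (c : G)⁻¹ * (g * (b : G)⁻¹) = 1 := by rw [← hg]; group
  have h2 : ContMDiffAt 𝓘(ℝ, EG) 𝓘(ℝ, EG) ∞ (fun k : G ↦ (c : G)⁻¹ * (k * (b : G)⁻¹)) g :=
    contMDiffAt_const.mul (contMDiffAt_id.mul contMDiffAt_const)
  refine ContMDiffAt.congr_of_eventuallyEq (f := fun k ↦
    sourceMap B C ((c : G)⁻¹ * (k * (b : G)⁻¹)) * b) ?_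
    ((h.eventually_sourceMap hg).mono fun _ hk ↦ hk.2)
  exact (ContMDiffAt.comp_of_eq h.contMDiffAt h2 h1).mul contMDiffAt_const

/-- Moving `dL_g y` back to the identity by `c⁻¹` on the left and `b⁻¹` on the right turns it into
`Ad_b y`. The result depends on `g` only through `b = s g`, so left invariant fields on `G` are
`s`-related to fields on `B`. -/
theorem tder_sourceMap {g : G} {c : C} {b : B} (hg : (c : G) * b = g) (y : EG) :
    tder 𝓘(ℝ, EG) 𝓘(ℝ, EB) (sourceMap B C) g (lT EG g 1 y) = anchorVec EG EB B C y b := by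
  have := lieGroup_subgroup EG EB B
  have h1 : (c : G)⁻¹ * (g * (b : G)⁻¹) = 1 := by rw [← hg]; group
  have h0 : (c : G)⁻¹ * g = b := by rw [← hg]; group
  have e1 := tder_comp (f := fun k : G ↦ k * (b : G)⁻¹) (g := fun k : G ↦ (c : G)⁻¹ * k) (x := g)
    (mdifferentiable_mul_left' (E := EG) _ _) (mdifferentiable_mul_right' (E := EG) _ _)
  have d1 : MDifferentiableAt 𝓘(ℝ, EG) 𝓘(ℝ, EG)
    ((fun k : G ↦ (c : G)⁻¹ * k) ∘ (fun k : G ↦ k * (b : G)⁻¹)) g :=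
    (mdifferentiable_mul_left' (E := EG) _ _).comp g (mdifferentiable_mul_right' (E := EG) _ _)
  have e2 := tder_comp_of_eq (h.contMDiffAt.mdifferentiableAt (by simp)) d1 h1
  have d2 : MDifferentiableAt 𝓘(ℝ, EG) 𝓘(ℝ, EB)
    (sourceMap B C ∘ ((fun k : G ↦ (c : G)⁻¹ * k) ∘ (fun k : G ↦ k * (b : G)⁻¹))) g :=
    MDifferentiableAt.comp_of_eq _ (h.contMDiffAt.mdifferentiableAt (by simp)) d1 h1
  have e3 := tder_comp_of_eq (mdifferentiable_mul_right' (E := EB) b 1) d2 (by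
    have := sourceMap_coe h.inf_eq_bot (1 : B)
    simpa [h1] using this)
  rw [tder_congr ((h.eventually_sourceMap hg).mono fun _ hk ↦ hk.2)]
  change tder 𝓘(ℝ, EG) 𝓘(ℝ, EB) ((fun b' : B ↦ b' * b) ∘ (sourceMap B C ∘
    ((fun k : G ↦ (c : G)⁻¹ * k) ∘ (fun k : G ↦ k * (b : G)⁻¹)))) g (lT EG g 1 y) = _
  rw [e3, e2, e1]
  have e4 : lT EG (c : G)⁻¹ (g * (b : G)⁻¹) (rT EG (b : G)⁻¹ g (lT EG g 1 y)) = Ad EG (b : G) y := by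
    have k1 := congrArg (fun T : EG →L[ℝ] EG ↦ T (lT EG g 1 y)) (lT_rT (E := EG) (c : G)⁻¹ g (b : G)⁻¹)
    have k2 := congrArg (fun T : EG →L[ℝ] EG ↦ T y) (lT_lT (E := EG) (c : G)⁻¹ g 1)
    simp only [ContinuousLinearMap.comp_apply, mul_one] at k1 k2
    rw [k1, k2, h0, Ad_eq]; rfl
  change rT EB b 1 (projB EG EB B C (lT EG (c : G)⁻¹ (g * (b : G)⁻¹)
    (rT EG (b : G)⁻¹ g (lT EG g 1 y)))) = _
  rw [e4]; rfl

theorem tder_sourceMap_coe (b : B) (y : EG) :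
    tder 𝓘(ℝ, EG) 𝓘(ℝ, EB) (sourceMap B C) (b : G) (lT EG (b : G) 1 y) =
      anchorVec EG EB B C y b :=
  h.tder_sourceMap (c := 1) (one_mul (b : G)) y

/-- Inversion exchanges `B C` and `C B`, so the range map needs no local analysis of its own. -/
theorem eventually_rangeMap (b : B) : ∀ᶠ k in 𝓝 (b : G),
    rangeMap B C k = b * (sourceMap B C ((b : G)⁻¹ * k)⁻¹)⁻¹ := by
  have := topologicalGroup_of_lieGroup 𝓘(ℝ, EG) ∞ (G := G)
  have hc : ContinuousAt (fun k : G ↦ ((b : G)⁻¹ * k)⁻¹) b := by fun_prop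
  have h2 := hc.tendsto
  rw [inv_mul_cancel, inv_one] at h2
  filter_upwards [h2.eventually h.mul_mem_nhds] with k ⟨c', b', hk⟩
  have h3 : k = ((b * b'⁻¹ : B) : G) * ((c'⁻¹ : C) : G) := by
    push_cast
    rw [mul_assoc, ← mul_inv_rev, hk]; group
  rw [← hk, sourceMap_mul h.inf_eq_bot]
  conv_lhs => rw [h3]
  rw [rangeMap_mul h.inf_eq_bot]

theorem tder_rangeMap (b : B) (X : EG) :
    tder 𝓘(ℝ, EG) 𝓘(ℝ, EB) (rangeMap B C) (b : G) X =
      lT EB b 1 (projB EG EB B C (lT EG (b : G)⁻¹ b X)) := by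
  have := lieGroup_subgroup EG EB B
  have hiG : MDifferentiable 𝓘(ℝ, EG) 𝓘(ℝ, EG) (fun g : G ↦ g⁻¹) :=
    (contMDiff_inv 𝓘(ℝ, EG) ∞).mdifferentiable (by simp)
  have hiB : MDifferentiable 𝓘(ℝ, EB) 𝓘(ℝ, EB) (fun g : B ↦ g⁻¹) :=
    (contMDiff_inv 𝓘(ℝ, EB) ∞).mdifferentiable (by simp)
  have h1 : (b : G)⁻¹ * (b : G) = 1 := inv_mul_cancel _
  have hs1 : sourceMap B C 1 = 1 := by simpa using sourceMap_coe h.inf_eq_bot (1 : B)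
  have d1 := mdifferentiable_mul_left' (E := EG) (b : G)⁻¹ (b : G)
  have e1 := tder_comp_of_eq (hiG 1) d1 h1
  have d2 : MDifferentiableAt 𝓘(ℝ, EG) 𝓘(ℝ, EG)
    ((fun k : G ↦ k⁻¹) ∘ (fun k : G ↦ (b : G)⁻¹ * k)) b := (hiG _).comp _ d1
  have v2 : ((fun k : G ↦ k⁻¹) ∘ (fun k : G ↦ (b : G)⁻¹ * k)) b = 1 := by simp
  have dS : MDifferentiableAt 𝓘(ℝ, EG) 𝓘(ℝ, EB) (sourceMap B C) 1 :=
    h.contMDiffAt.mdifferentiableAt (by simp)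
  have e2 := tder_comp_of_eq dS d2 v2
  have d3 := MDifferentiableAt.comp_of_eq _ dS d2 v2
  have v3 : (sourceMap B C ∘ ((fun k : G ↦ k⁻¹) ∘ (fun k : G ↦ (b : G)⁻¹ * k))) b = 1 := by
    rw [Function.comp_apply, v2, hs1]
  have e3 := tder_comp_of_eq (hiB 1) d3 v3
  have d4 := MDifferentiableAt.comp_of_eq _ (hiB 1) d3 v3
  have v4 : ((fun k : B ↦ k⁻¹) ∘
      (sourceMap B C ∘ ((fun k : G ↦ k⁻¹) ∘ (fun k : G ↦ (b : G)⁻¹ * k)))) b = 1 := by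
    rw [Function.comp_apply, v3, inv_one]
  have e4 := tder_comp_of_eq (mdifferentiable_mul_left' (E := EB) b 1) d4 v4
  rw [tder_congr (h.eventually_rangeMap b)]
  change tder 𝓘(ℝ, EG) 𝓘(ℝ, EB) ((fun k : B ↦ b * k) ∘ ((fun k : B ↦ k⁻¹) ∘
      (sourceMap B C ∘ ((fun k : G ↦ k⁻¹) ∘ (fun k : G ↦ (b : G)⁻¹ * k))))) b X = _
  rw [e4, e3, e2, e1]
  -- Inversion occurs once in `G` and once in `B`; the two signs cancel.
  simp only [ContinuousLinearMap.comp_apply, tder_inv_one, map_neg, neg_neg]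
  rfl

/-- The fibre at `b` is thus the left translate of `𝔠`, which is why sections are trivialized from
the left. -/
theorem mem_algebroidFibre {b : B} {X : EG} :
    X ∈ algebroidFibre EG EB B C b ↔ projB EG EB B C (lT EG (b : G)⁻¹ b X) = 0 := by
  have := lieGroup_subgroup EG EB B
  have h1 : X ∈ algebroidFibre EG EB B C b ↔
    tder 𝓘(ℝ, EG) 𝓘(ℝ, EB) (rangeMap B C) (b : G) X = 0 := Iff.rfl
  rw [h1, h.tder_rangeMap]
  refine ⟨fun h2 ↦ ?_, fun h2 ↦ by rw [h2, map_zero]⟩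
  have := lT_inv_lT (E := EB) b 1 (projB EG EB B C (lT EG (b : G)⁻¹ b X))
  rw [← this, h2, map_zero]

end HasSmoothSource

end Source

/-! ### The Lie algebroid as an action algebroid -/

section Sections

variable {EG EB G : Type*} [NormedAddCommGroup EG] [NormedSpace ℝ EG]
  [NormedAddCommGroup EB] [NormedSpace ℝ EB]
  [TopologicalSpace G] [ChartedSpace EG G] [Group G] [LieGroup 𝓘(ℝ, EG) ∞ G]
  {B C : Subgroup G} [ChartedSpace EB B] [hB : IsLieSubgroup EG EB B]

/-- The left trivialization of a section of the Lie algebroid. -/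
def AlgebroidSection.coeff (X : AlgebroidSection EG EB B C) (b : B) : EG :=
  lT EG (b : G)⁻¹ b (X.toFun b)

omit hB in
theorem AlgebroidSection.lT_coeff (X : AlgebroidSection EG EB B C) (b : B) :
    lT EG (b : G) 1 (X.coeff b) = X.toFun b := by
  have := lT_lT_inv (E := EG) (b : G) b (X.toFun b)
  rw [inv_mul_cancel] at this
  exact this

omit hB in
theorem AlgebroidSection.contMDiff_coeff (X : AlgebroidSection EG EB B C) :
    ContMDiff 𝓘(ℝ, EB) 𝓘(ℝ, EG) ∞ X.coeff := fun b ↦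
  ContMDiffAt.lT_inv (X.contMDiff b)

/-- Groupoid translation by `g` is group translation by `g (s g)⁻¹`, so left trivialization keeps
the coefficient found at the unit `s g`. -/
theorem AlgebroidSection.leftInvariantField_eq (X : AlgebroidSection EG EB B C) (g : G) :
    X.leftInvariantField g = lT EG g 1 (X.coeff (sourceMap B C g)) := by
  have h1 := lT_lT (E := EG) g (sourceMap B C g : G)⁻¹ (sourceMap B C g : G)
  rw [inv_mul_cancel] at h1
  exact (congrArg (fun T : EG →L[ℝ] EG ↦ T (X.toFun (sourceMap B C g))) h1).symm

namespace HasSmoothSource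

variable (h : HasSmoothSource EG EB B C)
include h

theorem projB_coeff (X : AlgebroidSection EG EB B C) (b : B) :
    projB EG EB B C (X.coeff b) = 0 :=
  h.mem_algebroidFibre.1 (X.mem_fibre b)

/-- The section of the Lie algebroid with given left trivialization. -/
def mkSection (y : B → EG) (hy : ContMDiff 𝓘(ℝ, EB) 𝓘(ℝ, EG) ∞ y)
    (hy0 : ∀ b, projB EG EB B C (y b) = 0) : AlgebroidSection EG EB B C where
  toFun b := lT EG (b : G) 1 (y b)
  mem_fibre b := by
    refine h.mem_algebroidFibre.2 ?_
    have := lT_inv_lT (E := EG) (b : G) 1 (y b)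
    rw [mul_one] at this
    rw [this]; exact hy0 b
  contMDiff b := ContMDiffAt.lT_tangent (contMDiff_val EG EB B b) (hy b)

theorem coeff_mkSection (y : B → EG) (hy : ContMDiff 𝓘(ℝ, EB) 𝓘(ℝ, EG) ∞ y)
    (hy0 : ∀ b, projB EG EB B C (y b) = 0) (b : B) : (h.mkSection y hy hy0).coeff b = y b := by
  have := lT_inv_lT (E := EG) (b : G) 1 (y b)
  rw [mul_one] at this
  exact this

theorem anchor_eq (X : AlgebroidSection EG EB B C) (b : B) :
    X.anchor b = anchorVec EG EB B C (X.coeff b) b := by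
  rw [← h.tder_sourceMap_coe, X.lT_coeff]; rfl

/-- The Lie algebroid bracket in the left trivialization. -/
theorem bracket_eq [FiniteDimensional ℝ EG] [T2Space G] (X Y : AlgebroidSection EG EB B C) (b : B) :
    X.bracket Y b = lT EG (b : G) 1 (lbr G (X.coeff b) (Y.coeff b) +
      tder 𝓘(ℝ, EB) 𝓘(ℝ, EG) Y.coeff b (anchorVec EG EB B C (X.coeff b) b) -
      tder 𝓘(ℝ, EB) 𝓘(ℝ, EG) X.coeff b (anchorVec EG EB B C (Y.coeff b) b)) := by
  have := FiniteDimensional.complete ℝ EG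
  obtain ⟨f, hf, hf1⟩ := exists_contMDiff_tder_eq (b : G) (ContinuousLinearMap.id ℝ EG)
  -- In `Φ` the point and the coefficient are independent variables; the field of a section arises
  -- by inserting `coeff ∘ s` in the second slot.
  let Φ : G × EG → EG := fun p ↦ tder 𝓘(ℝ, EG) 𝓘(ℝ, EG) f p.1 (lT EG p.1 1 p.2)
  have hΦ : ContMDiff (𝓘(ℝ, EG).prod 𝓘(ℝ, EG)) 𝓘(ℝ, EG) ∞ Φ := fun p ↦
    ContMDiffAt.tder_apply (hf p.1) (ContMDiffAt.lT_tangent contMDiffAt_fst contMDiffAt_snd)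
  have hs : ContMDiffAt 𝓘(ℝ, EG) 𝓘(ℝ, EB) ∞ (sourceMap B C) (b : G) :=
    h.contMDiffAt_sourceMap (c := 1) (one_mul (b : G))
  have hsb : sourceMap B C (b : G) = b := sourceMap_coe h.inf_eq_bot b
  have hc (X : AlgebroidSection EG EB B C) :
      ContMDiffAt 𝓘(ℝ, EG) 𝓘(ℝ, EG) ∞ (fun g ↦ X.coeff (sourceMap B C g)) (b : G) :=
    ContMDiffAt.comp_of_eq (X.contMDiff_coeff b) hs hsb
  have hder (X : AlgebroidSection EG EB B C) (u : EG) :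
      tder 𝓘(ℝ, EG) 𝓘(ℝ, EG) (fun g ↦ X.coeff (sourceMap B C g)) (b : G) (lT EG (b : G) 1 u) =
      tder 𝓘(ℝ, EB) 𝓘(ℝ, EG) X.coeff b (anchorVec EG EB B C u b) := by
    rw [← h.tder_sourceMap_coe]
    exact congrArg (fun T : EG →L[ℝ] EG ↦ T (lT EG (b : G) 1 u))
      (tder_comp_of_eq ((X.contMDiff_coeff b).mdifferentiableAt (by simp))
        (hs.mdifferentiableAt (by simp)) hsb)
  have hV (X : AlgebroidSection EG EB B C) : ContMDiffAt 𝓘(ℝ, EG) 𝓘(ℝ, EG).tangent ∞ (fun g ↦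
      (⟨g, lT EG g 1 (X.coeff (sourceMap B C g))⟩ : TangentBundle 𝓘(ℝ, EG) G)) (b : G) :=
    ContMDiffAt.lT_tangent contMDiffAt_id (hc X)
  have hbr : X.bracket Y b = vbracket (E := EG) (M := G) (fun g ↦ lT EG g 1 (X.coeff (sourceMap B C g)))
      (fun g ↦ lT EG g 1 (Y.coeff (sourceMap B C g))) (b : G) :=
    vbracket_congr (E := EG) (M := G) (Eventually.of_forall X.leftInvariantField_eq)
      (Eventually.of_forall Y.leftInvariantField_eq)
  have key := tder_mlieBracket_of_contMDiffAt (hf (b : G)) (hV X) (hV Y)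
  -- The coefficient frozen at `b` contributes a derivative along a left invariant field; its
  -- variation contributes a derivative along the anchor. The frozen parts will combine to the
  -- bracket of `𝔤`.
  have hpart (X Y : AlgebroidSection EG EB B C) :
      tder 𝓘(ℝ, EG) 𝓘(ℝ, EG) (fun g ↦ tder 𝓘(ℝ, EG) 𝓘(ℝ, EG) f g
        (lT EG g 1 (Y.coeff (sourceMap B C g)))) (b : G) (lT EG (b : G) 1 (X.coeff b)) =
      tder 𝓘(ℝ, EG) 𝓘(ℝ, EG) (fun g ↦ tder 𝓘(ℝ, EG) 𝓘(ℝ, EG) f g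
        (lT EG g 1 (Y.coeff b))) (b : G) (lT EG (b : G) 1 (X.coeff b)) +
      lT EG (b : G) 1 (tder 𝓘(ℝ, EB) 𝓘(ℝ, EG) Y.coeff b
        (anchorVec EG EB B C (X.coeff b) b)) := by
    have h1 := tder_comp_prodMk (Φ := Φ) (q := fun g ↦ Y.coeff (sourceMap B C g)) (p := (b : G))
      ((hΦ _).mdifferentiableAt (by simp)) ((hc Y).mdifferentiableAt (by simp))
      (lT EG (b : G) 1 (X.coeff b))
    rw [hder] at h1
    have h2 : (fun n ↦ Φ ((b : G), n)) = lT EG (b : G) 1 := by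
      funext n
      simp [Φ, hf1]
    have h3 (p : EG) : tder 𝓘(ℝ, EG) 𝓘(ℝ, EG) (lT EG (b : G) 1) p = lT EG (b : G) 1 :=
      (lT EG (b : G) 1).mfderiv_eq
    rw [h2, h3] at h1
    simp only [hsb] at h1
    exact h1
  rw [hsb, hpart X Y, hpart Y X, hf1] at key
  have hlie := tder_linv_comm (hf (b : G)) (X.coeff b) (Y.coeff b)
  rw [hf1] at hlie
  rw [hbr, map_sub, map_add]
  simp only [ContinuousLinearMap.id_apply] at hlie
  rw [hlie]
  refine Eq.trans key ?_
  abel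

/-- The anchor is a morphism of Lie algebras from `𝔠` to vector fields on `B`. -/
theorem anchorVec_lbr [CompleteSpace EG] {f : B → ℝ} (hf : ContMDiff 𝓘(ℝ, EB) 𝓘(ℝ) ∞ f)
    (x y : EG) (b : B) :
    tder 𝓘(ℝ, EB) 𝓘(ℝ) f b (anchorVec EG EB B C (lbr G x y) b) =
      tder 𝓘(ℝ, EB) 𝓘(ℝ) (fun a ↦ tder 𝓘(ℝ, EB) 𝓘(ℝ) f a (anchorVec EG EB B C y a)) b
        (anchorVec EG EB B C x b) -
      tder 𝓘(ℝ, EB) 𝓘(ℝ) (fun a ↦ tder 𝓘(ℝ, EB) 𝓘(ℝ) f a (anchorVec EG EB B C x a)) b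
        (anchorVec EG EB B C y b) := by
  have := lieGroup_subgroup EG EB B
  have hs : ContMDiffAt 𝓘(ℝ, EG) 𝓘(ℝ, EB) ∞ (sourceMap B C) (b : G) :=
    h.contMDiffAt_sourceMap (c := 1) (one_mul (b : G))
  have hsb : sourceMap B C (b : G) = b := sourceMap_coe h.inf_eq_bot b
  have hfd := hf.mdifferentiable (by simp)
  -- Pulling back along `s` intertwines the left invariant field of any `y ∈ 𝔤` with its anchor
  -- field. The commutator formula on `G` thereby descends to `B`.
  have e1 (f : B → ℝ) (hf : MDifferentiable 𝓘(ℝ, EB) 𝓘(ℝ) f) (y : EG) :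
      (fun g ↦ tder 𝓘(ℝ, EG) 𝓘(ℝ) (f ∘ sourceMap B C) g (lT EG g 1 y)) =ᶠ[𝓝 (b : G)]
      (fun a ↦ tder 𝓘(ℝ, EB) 𝓘(ℝ) f a (anchorVec EG EB B C y a)) ∘ sourceMap B C := by
    filter_upwards [h.eventually_sourceMap (c := 1) (one_mul (b : G))] with g ⟨⟨c, b', hg⟩, _⟩
    rw [tder_comp (hf _) ((h.contMDiffAt_sourceMap hg).mdifferentiableAt (by simp)),
      ContinuousLinearMap.comp_apply, h.tder_sourceMap hg, Function.comp_apply]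
    rw [← hg, sourceMap_mul h.inf_eq_bot]
  have hA (y : EG) : ContMDiff 𝓘(ℝ, EB) 𝓘(ℝ) ∞
      (fun a ↦ tder 𝓘(ℝ, EB) 𝓘(ℝ) f a (anchorVec EG EB B C y a)) := fun a ↦
    ContMDiffAt.tder_apply (hf a) (ContMDiffAt.rT_tangent contMDiffAt_id
      (((projB EG EB B C).contMDiff _).comp a
        (ContMDiffAt.Ad_apply (contMDiff_val EG EB B a) contMDiffAt_const)))
  have key := tder_linv_comm (f := f ∘ sourceMap B C) (ContMDiffAt.comp_of_eq (hf b) hs hsb) x y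
  have e2 (f : B → ℝ) (hf : MDifferentiable 𝓘(ℝ, EB) 𝓘(ℝ) f) (y : EG) :
      tder 𝓘(ℝ, EG) 𝓘(ℝ) (f ∘ sourceMap B C) b (lT EG (b : G) 1 y) =
      tder 𝓘(ℝ, EB) 𝓘(ℝ) f b (anchorVec EG EB B C y b) := by
    have := (e1 f hf y).self_of_nhds
    simpa only [Function.comp_apply, hsb] using this
  rw [e2 f hfd, tder_congr (e1 f hfd _), tder_congr (e1 f hfd _),
    e2 _ ((hA y).mdifferentiable (by simp)), e2 _ ((hA x).mdifferentiable (by simp))] at key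
  exact key

end HasSmoothSource

end Sections

/-! ### Hadamard's lemma -/

section Hadamard

variable {E F : Type*} [NormedAddCommGroup E] [NormedSpace ℝ E]
  [NormedAddCommGroup F] [NormedSpace ℝ F]

/-- Integrals depending smoothly on a parameter. -/
theorem contDiff_intervalIntegral {Φ : E × ℝ → F} (hΦ : ContDiff ℝ ∞ Φ) :
    ContDiff ℝ ∞ (fun u ↦ ∫ t in (0 : ℝ)..1, Φ (u, t)) := by
  -- The integral is the value at `0` of the convolution of the indicator of `(0, 1]` with `t ↦ χ t
  -- • Φ (u, -t)`. The cutoff provides compact support and equals `1` wherever the indicator is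
  -- supported, up to sign of `t`.
  let χ : ContDiffBump (0 : ℝ) := ⟨1, 2, by norm_num, by norm_num⟩
  have hg : ContDiff ℝ ∞ (fun q : E × ℝ ↦ χ q.2 • Φ (q.1, -q.2)) :=
    (χ.contDiff.comp contDiff_snd).smul (hΦ.comp (contDiff_fst.prodMk contDiff_snd.neg))
  have h1 := MeasureTheory.contDiffOn_convolution_right_with_param_comp (𝕜 := ℝ) (μ := MeasureTheory.volume)
    (n := (⊤ : ℕ∞))
    (ContinuousLinearMap.lsmul ℝ ℝ : ℝ →L[ℝ] F →L[ℝ] F) (s := (univ : Set E))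
    (v := fun _ ↦ (0 : ℝ)) contDiffOn_const (f := (Ioc (0 : ℝ) 1).indicator fun _ ↦ (1 : ℝ))
    (g := fun (u : E) (t : ℝ) ↦ χ t • Φ (u, -t)) (k := Metric.closedBall 0 2) isOpen_univ
    (isCompact_closedBall _ _) (fun u t _ ht ↦ by
      rw [χ.zero_of_le_dist (not_le.1 ht).le, zero_smul])
    ((MeasureTheory.integrable_indicator_iff measurableSet_Ioc).2
      (by simp)).locallyIntegrable hg.contDiffOn
  rw [contDiffOn_univ] at h1
  convert h1 using 2 with u
  rw [MeasureTheory.convolution_def, intervalIntegral.integral_of_le zero_le_one,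
    ← MeasureTheory.integral_indicator measurableSet_Ioc]
  congr 1
  funext t
  by_cases ht : t ∈ Ioc (0 : ℝ) 1
  · have : χ (0 - t) = 1 := χ.one_of_mem_closedBall (by
      simp only [zero_sub, mem_closedBall_zero_iff, norm_neg, Real.norm_eq_abs, χ]
      rw [abs_of_pos ht.1]; exact ht.2)
    rw [indicator_of_mem ht, indicator_of_mem ht, this]
    simp
  · simp [indicator_of_notMem ht]

/-- Hadamard's lemma. -/
theorem exists_contDiff_eq_apply_sub {K : E → ℝ} (hK : ContDiff ℝ ∞ K) {p : E} (h0 : K p = 0)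
    (h1 : fderiv ℝ K p = 0) :
    ∃ A : E → E →L[ℝ] ℝ, ContDiff ℝ ∞ A ∧ A p = 0 ∧ ∀ u, K u = A u (u - p) := by
  have hd : ContDiff ℝ ∞ (fderiv ℝ K) := hK.fderiv_right (by simp)
  have hΦ : ContDiff ℝ ∞ (fun q : E × ℝ ↦ fderiv ℝ K (p + q.2 • (q.1 - p))) :=
    hd.comp (contDiff_const.add (contDiff_snd.smul (contDiff_fst.sub contDiff_const)))
  -- The average of the derivative over the segment from `p` to `u`; at `u = p` it is `fderiv ℝ K p
  -- = 0`.
  refine ⟨fun u ↦ ∫ t in (0 : ℝ)..1, fderiv ℝ K (p + t • (u - p)),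
    contDiff_intervalIntegral hΦ, by simp [h1], fun u ↦ ?_⟩
  have hc : Continuous fun t : ℝ ↦ fderiv ℝ K (p + t • (u - p)) :=
    hΦ.continuous.comp (continuous_const.prodMk continuous_id)
  rw [ContinuousLinearMap.intervalIntegral_apply (hc.intervalIntegrable _ _)]
  have hder (t : ℝ) : HasDerivAt (fun t : ℝ ↦ K (p + t • (u - p)))
      (fderiv ℝ K (p + t • (u - p)) (u - p)) t := by
    have e1 : HasDerivAt (fun t : ℝ ↦ p + t • (u - p)) (u - p) t := by
      simpa using ((hasDerivAt_id t).smul_const (u - p)).const_add p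
    exact ((hK.differentiable (by simp) _).hasFDerivAt).comp_hasDerivAt t e1
  rw [intervalIntegral.integral_eq_sub_of_hasDerivAt (fun t _ ↦ hder t)
    ((hc.clm_apply continuous_const).intervalIntegrable _ _)]
  simp [h0]

end Hadamard

/-! ### Point derivations depend only on differentials -/

section PointDerivations

variable {E H M : Type*} [NormedAddCommGroup E] [NormedSpace ℝ E] [FiniteDimensional ℝ E]
  [TopologicalSpace H] {I : ModelWithCorners ℝ E H} [I.Boundaryless]
  [TopologicalSpace M] [T2Space M] [ChartedSpace H M] [IsManifold I ∞ M]

/-- Near a point, a smooth function that vanishes there to first order is a sum of products of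
smooth functions vanishing at the point. -/
theorem exists_eventuallyEq_sum_mul {f : M → ℝ} (hf : ContMDiff I 𝓘(ℝ) ∞ f) {p : M} (h0 : f p = 0)
    (h1 : tder I 𝓘(ℝ) f p = 0) :
    ∃ (n : ℕ) (g k : Fin n → C^∞⟮I, M; 𝓘(ℝ), ℝ⟯), (∀ i, g i p = 0) ∧ (∀ i, k i p = 0) ∧
      f =ᶠ[𝓝 p] fun x ↦ ∑ i, g i x * k i x := by
  set φ := extChartAt I p with hφ
  have hFt : ContDiffOn ℝ ∞ (f ∘ φ.symm) φ.target :=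
    contMDiffOn_iff_contDiffOn.1 (hf.comp_contMDiffOn (contMDiffOn_extChartAt_symm p))
  have hto : IsOpen φ.target := isOpen_extChartAt_target p
  obtain ⟨r, hr, hball⟩ := Metric.mem_nhds_iff.1 (hto.mem_nhds (mem_extChartAt_target (I := I) p))
  let ψ : ContDiffBump (φ p) := ⟨r / 4, r / 2, by positivity, by linarith⟩
  have hsub : Metric.closedBall (φ p) ψ.rOut ⊆ φ.target :=
    (Metric.closedBall_subset_ball (by simp only [ψ]; linarith)).trans hball
  -- The cutoff extends the chart expression to all of `E`, so that segments to `φ p` never leave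
  -- the domain.
  have hK : ContDiff ℝ ∞ fun u ↦ ψ u * (f ∘ φ.symm) u := by
    refine contDiff_iff_contDiffAt.2 fun u ↦ ?_
    by_cases hu : u ∈ φ.target
    · exact ψ.contDiff.contDiffAt.mul (hFt.contDiffAt (hto.mem_nhds hu))
    · refine (contDiffAt_const (c := 0)).congr_of_eventuallyEq ?_
      have : u ∉ tsupport ψ := fun h ↦ hu (hsub (by rwa [ψ.tsupport_eq] at h))
      filter_upwards [notMem_tsupport_iff_eventuallyEq.1 this] with z hz
      simp [hz]
  have hKF : (fun u ↦ ψ u * (f ∘ φ.symm) u) =ᶠ[𝓝 (φ p)] f ∘ φ.symm := by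
    filter_upwards [ψ.eventuallyEq_one] with u hu
    simp [hu]
  have hφp : φ.symm (φ p) = p := extChartAt_to_inv p
  obtain ⟨A, hA, hA0, hAK⟩ := exists_contDiff_eq_apply_sub hK (p := φ p)
    (by simp [hφp, h0]) (by
      rw [hKF.fderiv_eq, ← tder_eq_fderiv_extChartAt (hf.mdifferentiable (by simp) p), h1])
  let χ : SmoothBumpFunction I p := Classical.arbitrary _
  let b := Module.finBasis ℝ E
  have hcoord (i : Fin (Module.finrank ℝ E)) : ContDiff ℝ ∞ (fun u ↦ b.coord i (u - φ p)) :=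
    (LinearMap.toContinuousLinearMap (b.coord i)).contDiff.comp (contDiff_id.sub contDiff_const)
  have hAi (i : Fin (Module.finrank ℝ E)) : ContDiff ℝ ∞ (fun u ↦ A u (b i)) :=
    hA.clm_apply contDiff_const
  refine ⟨Module.finrank ℝ E,
    fun i ↦ ⟨fun x ↦ χ x • b.coord i (φ x - φ p), χ.contMDiff_smul
      ((hcoord i).contMDiff.comp_contMDiffOn contMDiffOn_extChartAt)⟩,
    fun i ↦ ⟨fun x ↦ χ x • A (φ x) (b i), χ.contMDiff_smul
      ((hAi i).contMDiff.comp_contMDiffOn contMDiffOn_extChartAt)⟩, fun i ↦ ?_, fun i ↦ ?_, ?_⟩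
  · change χ p • b.coord i (φ p - φ p) = 0
    simp
  · change χ p • A (φ p) (b i) = 0
    simp [hA0]
  · filter_upwards [χ.eventuallyEq_one, extChartAt_source_mem_nhds (I := I) p,
      (continuousAt_extChartAt (I := I) p).tendsto.eventually hKF] with x hx hxs hxK
    change f x = ∑ i, (χ x • b.coord i (φ x - φ p)) * (χ x • A (φ x) (b i))
    have e1 : f x = A (φ x) (φ x - φ p) := by
      rw [← hAK, hxK]
      simp only [Function.comp_apply]
      rw [φ.left_inv hxs]
    rw [e1]
    conv_lhs => rw [← b.sum_repr (φ x - φ p), map_sum]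
    refine Finset.sum_congr rfl fun i _ ↦ ?_
    simp [hx]

/-- A point derivation vanishes on functions vanishing near the point. -/
theorem pointDerivation_eq_zero_of_eventuallyEq {p : M} (δ : C^∞⟮I, M; 𝓘(ℝ), ℝ⟯ →ₗ[ℝ] ℝ)
    (hδ : ∀ f g, δ (f * g) = δ f * g p + f p * δ g) {f : C^∞⟮I, M; 𝓘(ℝ), ℝ⟯}
    (hf : (f : M → ℝ) =ᶠ[𝓝 p] 0) : δ f = 0 := by
  obtain ⟨χ, -, hχ⟩ := (SmoothBumpFunction.nhds_basis_tsupport (I := I) p).mem_iff.1 hf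
  -- As `χ` is `1` at `p` and supported where `f` vanishes, the Leibniz rule for `χ f = 0` reads `δ
  -- f = 0`.
  let χ' : C^∞⟮I, M; 𝓘(ℝ), ℝ⟯ := ⟨χ, χ.contMDiff⟩
  have h0 : χ' * f = 0 := by
    ext x
    by_cases hx : x ∈ tsupport χ
    · have : f x = 0 := hχ hx
      simp [this]
    · have : χ x = 0 := image_eq_zero_of_notMem_tsupport hx
      change χ x * f x = 0
      rw [this, zero_mul]
  have h1 := hδ χ' f
  have h2 : f p = 0 := hf.self_of_nhds
  have h3 : χ' p = 1 := χ.eventuallyEq_one.self_of_nhds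
  rw [h0, map_zero, h2, h3] at h1
  linarith

/-- Up to a constant, `f` is near `p` a sum of products of functions vanishing at `p`, and the
Leibniz rule kills each product. -/
theorem pointDerivation_eq_zero_of_tder_eq_zero {p : M} (δ : C^∞⟮I, M; 𝓘(ℝ), ℝ⟯ →ₗ[ℝ] ℝ)
    (hδ : ∀ f g, δ (f * g) = δ f * g p + f p * δ g) {f : C^∞⟮I, M; 𝓘(ℝ), ℝ⟯}
    (h1 : tder I 𝓘(ℝ) f p = 0) : δ f = 0 := by
  have hone : δ 1 = 0 := by
    have := hδ 1 1
    rw [mul_one] at this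
    simp only [ContMDiffMap.coe_one, Pi.one_apply, mul_one, one_mul] at this
    linarith
  set f₀ : C^∞⟮I, M; 𝓘(ℝ), ℝ⟯ := f - f p • 1
  have hf₀ : δ f = δ f₀ := by simp [f₀, hone]
  have h0 : f₀ p = 0 := by
    change f p - f p * 1 = 0
    ring
  have hd : tder I 𝓘(ℝ) f₀ p = 0 := by
    have : tder I 𝓘(ℝ) ((f : M → ℝ) - fun _ ↦ f p * 1) p =
        tder I 𝓘(ℝ) f p - tder I 𝓘(ℝ) (fun _ ↦ f p * 1) p :=
      mfderiv_sub (f.contMDiff.mdifferentiable (by simp) p) mdifferentiableAt_const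
    change tder I 𝓘(ℝ) ((f : M → ℝ) - fun _ ↦ f p * 1) p = 0
    rw [this, h1, tder_const, sub_zero]
  obtain ⟨n, g, k, hg, hk, hev⟩ := exists_eventuallyEq_sum_mul f₀.contMDiff h0 hd
  have hz : δ (f₀ - ∑ i, g i * k i) = 0 := by
    refine pointDerivation_eq_zero_of_eventuallyEq δ hδ ?_
    filter_upwards [hev] with x hx
    change f₀ x - (∑ i, g i * k i : C^∞⟮I, M; 𝓘(ℝ), ℝ⟯) x = 0
    rw [hx, sub_eq_zero]
    have := map_sum (ContMDiffMap.evalRingHom (I := I) (n := ∞) x :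
      C^∞⟮I, M; 𝓘(ℝ), ℝ⟯ →+* ℝ) (fun i ↦ g i * k i) Finset.univ
    exact this.symm
  rw [map_sub, map_sum, sub_eq_zero] at hz
  rw [hf₀, hz]
  exact Finset.sum_eq_zero fun i _ ↦ by rw [hδ, hg, hk]; ring

/-- A point derivation vanishes as soon as it vanishes on a set of functions with separating
differentials. -/
theorem pointDerivation_eq_zero {p : M} (δ : C^∞⟮I, M; 𝓘(ℝ), ℝ⟯ →ₗ[ℝ] ℝ)
    (hδ : ∀ f g, δ (f * g) = δ f * g p + f p * δ g) {S : Set C^∞⟮I, M; 𝓘(ℝ), ℝ⟯}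
    (hS : ∀ x : E, (∀ s ∈ S, tder I 𝓘(ℝ) s p x = 0) → x = 0) (h0 : ∀ s ∈ S, δ s = 0)
    (f : C^∞⟮I, M; 𝓘(ℝ), ℝ⟯) : δ f = 0 := by
  have hmd (f : C^∞⟮I, M; 𝓘(ℝ), ℝ⟯) : MDifferentiableAt I 𝓘(ℝ) f p :=
    f.contMDiff.mdifferentiable (by simp) p
  let T : C^∞⟮I, M; 𝓘(ℝ), ℝ⟯ →ₗ[ℝ] Module.Dual ℝ E :=
    { toFun := fun f ↦ (tder I 𝓘(ℝ) f p).toLinearMap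
      map_add' := fun f g ↦ by
        have : tder I 𝓘(ℝ) (f + g : C^∞⟮I, M; 𝓘(ℝ), ℝ⟯) p = tder I 𝓘(ℝ) f p + tder I 𝓘(ℝ) g p :=
          mfderiv_add (hmd f) (hmd g)
        rw [this]; rfl
      map_smul' := fun c f ↦ by
        have : tder I 𝓘(ℝ) (c • f : C^∞⟮I, M; 𝓘(ℝ), ℝ⟯) p = c • tder I 𝓘(ℝ) f p :=
          const_smul_mfderiv (hmd f) c
        rw [this]; rfl }
  -- Separation says that the differentials of `S` have no common kernel. In finite dimension they
  -- therefore span the cotangent space, and `f` agrees to first order with an element of the span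
  -- of `S`.
  have hspan : (Submodule.span ℝ S).map T = ⊤ := by
    rw [← Subspace.dualCoannihilator_dualAnnihilator_eq (W := (Submodule.span ℝ S).map T)]
    have : ((Submodule.span ℝ S).map T).dualCoannihilator = ⊥ := by
      refine (Submodule.eq_bot_iff _).2 fun x hx ↦ hS x fun s hs ↦ ?_
      rw [Submodule.mem_dualCoannihilator] at hx
      exact hx (T s) (Submodule.mem_map_of_mem (Submodule.subset_span hs))
    rw [this, Submodule.dualAnnihilator_bot]
  obtain ⟨s, hs, hsT⟩ : T f ∈ (Submodule.span ℝ S).map T := by rw [hspan]; trivial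
  have hs0 : δ s = 0 := by
    have : Submodule.span ℝ S ≤ LinearMap.ker δ := Submodule.span_le.2 h0
    exact this hs
  have hz : δ (f - s) = 0 := by
    refine pointDerivation_eq_zero_of_tder_eq_zero δ hδ ?_
    have h1 : T (f - s) = 0 := by rw [map_sub, hsT, sub_self]
    exact ContinuousLinearMap.coe_injective h1
  rw [map_sub, hs0, sub_zero] at hz
  exact hz

end PointDerivations

/-! ### Algebra of antisymmetric biderivations -/

section Biderivations

variable {A : Type*} [CommRing A] [Algebra ℝ A]

/-- The antisymmetric biderivation `∑ ∂ᵢ ∧ Dᵢ + ∑ Λᵢⱼ ∂ᵢ ⊗ ∂ⱼ`. -/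
def biderivation {ι : Type*} [Fintype ι] (d D : ι → Derivation ℝ A A) (Λ : ι → ι → A) :
    A →ₗ[ℝ] A →ₗ[ℝ] A :=
  LinearMap.mk₂ ℝ (fun f k ↦ ∑ i, (d i f * D i k - d i k * D i f) +
      ∑ i, ∑ j, Λ i j * (d i f * d j k))
    (fun f f' k ↦ by
      simp only [map_add, add_mul, mul_add, Finset.sum_add_distrib, Finset.sum_sub_distrib]
      ring)
    (fun c f k ↦ by
      simp only [Derivation.map_smul, smul_mul_assoc, mul_smul_comm, ← smul_sub,
        ← Finset.smul_sum, smul_add])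
    (fun f k k' ↦ by
      simp only [map_add, add_mul, mul_add, Finset.sum_add_distrib, Finset.sum_sub_distrib]
      ring)
    (fun c f k ↦ by
      simp only [Derivation.map_smul, smul_mul_assoc, mul_smul_comm, ← smul_sub,
        ← Finset.smul_sum, smul_add])

section

variable {ι : Type*} [Fintype ι] (d D : ι → Derivation ℝ A A) (Λ : ι → ι → A)

theorem biderivation_apply (f k : A) : biderivation d D Λ f k =
    ∑ i, (d i f * D i k - d i k * D i f) + ∑ i, ∑ j, Λ i j * (d i f * d j k) := rfl

theorem biderivation_self (hΛ : ∀ i j, Λ i j = -Λ j i) (f : A) : biderivation d D Λ f f = 0 := by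
  rw [biderivation_apply, Finset.sum_eq_zero fun i _ ↦ by ring, zero_add]
  set s := ∑ i, ∑ j, Λ i j * (d i f * d j f) with hs
  have h1 : s = -s := by
    conv_lhs => rw [hs, Finset.sum_comm]
    rw [hs, ← Finset.sum_neg_distrib]
    refine Finset.sum_congr rfl fun i _ ↦ ?_
    rw [← Finset.sum_neg_distrib]
    exact Finset.sum_congr rfl fun j _ ↦ by rw [hΛ j i]; ring
  have h2 : (2 : ℝ) • s = 0 := by rw [two_smul]; nth_rw 1 [h1]; exact neg_add_cancel s
  simpa using h2

theorem biderivation_leibniz (f g k : A) : biderivation d D Λ f (g * k) =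
    biderivation d D Λ f g * k + g * biderivation d D Λ f k := by
  simp only [biderivation_apply, Derivation.leibniz, smul_eq_mul]
  rw [add_mul, mul_add, add_add_add_comm]
  simp only [Finset.sum_mul, Finset.mul_sum, ← Finset.sum_add_distrib]
  refine Finset.sum_congr rfl fun i _ ↦ congrArg₂ (· + ·) (by ring) ?_
  exact Finset.sum_congr rfl fun j _ ↦ by ring

end

variable {br : A →ₗ[ℝ] A →ₗ[ℝ] A} (hself : ∀ f, br f f = 0)
include hself

theorem bracket_swap_of_self (f g : A) : br f g = -br g f := by
  have := hself (f + g)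
  simp only [map_add, LinearMap.add_apply, hself, zero_add, add_zero] at this
  exact eq_neg_of_add_eq_zero_right this

variable (hleib : ∀ f g k, br f (g * k) = br f g * k + g * br f k)
include hleib

theorem bracket_leibniz_left (f g k : A) : br (f * g) k = br f k * g + f * br g k := by
  rw [bracket_swap_of_self hself, hleib, bracket_swap_of_self hself k f,
    bracket_swap_of_self hself k g]
  ring

/-- The Jacobiator involves second derivatives only in appearance: by antisymmetry the mixed
products of brackets cancel. -/
theorem jacobiator_leibniz (f g k l : A) :
    br f (br g (k * l)) + br g (br (k * l) f) + br (k * l) (br f g) =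
      (br f (br g k) + br g (br k f) + br k (br f g)) * l +
      k * (br f (br g l) + br g (br l f) + br l (br f g)) := by
  have hs := bracket_swap_of_self hself
  rw [hs (k * l) (br f g), hs (k * l) f, hs k f, hs l f, hs k (br f g), hs l (br f g)]
  simp only [hleib, map_add, map_neg]
  ring

end Biderivations

/-! ### Testing biderivations and the Jacobi identity on generators -/

section Separating

variable {E H M : Type*} [NormedAddCommGroup E] [NormedSpace ℝ E] [FiniteDimensional ℝ E]
  [TopologicalSpace H] {I : ModelWithCorners ℝ E H} [I.Boundaryless]
  [TopologicalSpace M] [T2Space M] [ChartedSpace H M] [IsManifold I ∞ M]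

theorem pointBiderivation_eq_zero {p : M}
    (D : C^∞⟮I, M; 𝓘(ℝ), ℝ⟯ →ₗ[ℝ] C^∞⟮I, M; 𝓘(ℝ), ℝ⟯ →ₗ[ℝ] ℝ)
    (h1 : ∀ f g k, D (f * g) k = D f k * g p + f p * D g k)
    (h2 : ∀ f g k, D f (g * k) = D f g * k p + g p * D f k)
    {S : Set C^∞⟮I, M; 𝓘(ℝ), ℝ⟯}
    (hS : ∀ x : E, (∀ s ∈ S, tder I 𝓘(ℝ) s p x = 0) → x = 0)
    (h0 : ∀ s ∈ S, ∀ t ∈ S, D s t = 0) (f k : C^∞⟮I, M; 𝓘(ℝ), ℝ⟯) : D f k = 0 := by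
  refine pointDerivation_eq_zero (p := p) (D.flip k) (fun f g ↦ h1 f g k) hS (fun s hs ↦ ?_) f
  exact pointDerivation_eq_zero (p := p) (D s) (h2 s) hS (h0 s hs) k

/-- An antisymmetric biderivation satisfies the Jacobi identity if it does so on a set of
functions with separating differentials. -/
theorem jacobi_of_separating
    {br : C^∞⟮I, M; 𝓘(ℝ), ℝ⟯ →ₗ[ℝ] C^∞⟮I, M; 𝓘(ℝ), ℝ⟯ →ₗ[ℝ] C^∞⟮I, M; 𝓘(ℝ), ℝ⟯}
    (hself : ∀ f, br f f = 0) (hleib : ∀ f g k, br f (g * k) = br f g * k + g * br f k)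
    {S : Set C^∞⟮I, M; 𝓘(ℝ), ℝ⟯}
    (hS : ∀ (p : M) (x : E), (∀ s ∈ S, tder I 𝓘(ℝ) s p x = 0) → x = 0)
    (h0 : ∀ f ∈ S, ∀ g ∈ S, ∀ k ∈ S, br f (br g k) + br g (br k f) + br k (br f g) = 0)
    (f g k : C^∞⟮I, M; 𝓘(ℝ), ℝ⟯) : br f (br g k) + br g (br k f) + br k (br f g) = 0 := by
  have step (f g : C^∞⟮I, M; 𝓘(ℝ), ℝ⟯)
      (h : ∀ k ∈ S, br f (br g k) + br g (br k f) + br k (br f g) = 0)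
      (k : C^∞⟮I, M; 𝓘(ℝ), ℝ⟯) : br f (br g k) + br g (br k f) + br k (br f g) = 0 := by
    ext p
    let δ : C^∞⟮I, M; 𝓘(ℝ), ℝ⟯ →ₗ[ℝ] ℝ :=
      { toFun := fun k ↦ (br f (br g k) + br g (br k f) + br k (br f g)) p
        map_add' := fun k l ↦ by
          simp only [map_add, LinearMap.add_apply, ContMDiffMap.coe_add, Pi.add_apply]
          ring
        map_smul' := fun c k ↦ by
          simp only [map_smul, LinearMap.smul_apply, ContMDiffMap.coe_add, Pi.add_apply,
            ContMDiffMap.coe_smul, Pi.smul_apply, smul_eq_mul, RingHom.id_apply]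
          ring }
    refine pointDerivation_eq_zero (p := p) δ (fun k l ↦ ?_) (hS p) (fun s hs ↦ ?_) k
    · change (br f (br g (k * l)) + br g (br (k * l) f) + br (k * l) (br f g)) p = _
      rw [jacobiator_leibniz hself hleib]
      rfl
    · change (br f (br g s) + br g (br s f) + br s (br f g)) p = 0
      rw [h s hs]; rfl
  have rot (f g k : C^∞⟮I, M; 𝓘(ℝ), ℝ⟯)
      (h : br f (br g k) + br g (br k f) + br k (br f g) = 0) :
      br g (br k f) + br k (br f g) + br f (br g k) = 0 := by
    rw [← h]; abel
  -- One slot at a time is reduced to `S`; the Jacobiator is cyclic, so each slot can be rotated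
  -- into the last place.
  refine step f g (fun k hk ↦ ?_) k
  refine rot _ _ _ (step k f (fun g hg ↦ ?_) g)
  exact rot _ _ _ (step g k (fun f hf ↦ h0 g hg k hk f hf) f)

variable (I) in
/-- The derivation of the algebra of smooth functions defined by a smooth vector field. -/
def fieldDerivation (V : M → E)
    (hV : ∀ x, ContMDiffAt I I.tangent ∞ (fun x ↦ (⟨x, V x⟩ : TangentBundle I M)) x) :
    Derivation ℝ C^∞⟮I, M; 𝓘(ℝ), ℝ⟯ C^∞⟮I, M; 𝓘(ℝ), ℝ⟯ :=
  Derivation.mk'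
    { toFun := fun f ↦ ⟨fun x ↦ tder I 𝓘(ℝ) f x (V x),
        fun x ↦ ContMDiffAt.tder_apply (p := fun x ↦ x) (f.contMDiff x) (hV x)⟩
      map_add' := fun f g ↦ by
        ext x
        exact congrArg (fun T : E →L[ℝ] ℝ ↦ T (V x)) (mfderiv_add
          (f.contMDiff.mdifferentiable (by simp) x) (g.contMDiff.mdifferentiable (by simp) x))
      map_smul' := fun c f ↦ by
        ext x
        exact congrArg (fun T : E →L[ℝ] ℝ ↦ T (V x))
          (const_smul_mfderiv (f.contMDiff.mdifferentiable (by simp) x) c) }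
    (fun f g ↦ by
      ext x
      exact congrArg (fun T : E →L[ℝ] ℝ ↦ T (V x)) (HasMFDerivAt.mul
        (f.contMDiff.mdifferentiable (by simp) x).hasMFDerivAt
        (g.contMDiff.mdifferentiable (by simp) x).hasMFDerivAt).mfderiv)

end Separating

/-! ### Smooth maps into subspaces and dual spaces -/

section FiniteDimensionalTargets

variable {V E H N : Type*} [NormedAddCommGroup V] [NormedSpace ℝ V] [FiniteDimensional ℝ V]
  [NormedAddCommGroup E] [NormedSpace ℝ E] [TopologicalSpace H] {J : ModelWithCorners ℝ E H}
  [TopologicalSpace N] [ChartedSpace H N]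

/-- A linear retraction of `V` onto `W` recovers `f` from its composite with the inclusion. -/
theorem contMDiffAt_of_coe {W : Submodule ℝ V} {f : N → W} {m : N}
    (hf : ContMDiffAt J 𝓘(ℝ, V) ∞ (fun m ↦ (f m : V)) m) : ContMDiffAt J 𝓘(ℝ, W) ∞ f m := by
  obtain ⟨L, hL⟩ := W.subtype.exists_leftInverse_of_injective W.ker_subtype
  have h1 : f = (LinearMap.toContinuousLinearMap L) ∘ fun m ↦ (f m : V) := by
    funext m
    exact (LinearMap.congr_fun hL (f m)).symm
  rw [h1]
  exact ((LinearMap.toContinuousLinearMap L).contMDiff (n := ∞) _).comp m hf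

theorem contMDiffAt_of_apply {f : N → V →L[ℝ] ℝ} {m : N}
    (hf : ∀ x, ContMDiffAt J 𝓘(ℝ) ∞ (fun m ↦ f m x) m) : ContMDiffAt J 𝓘(ℝ, V →L[ℝ] ℝ) ∞ f m := by
  let b := Module.finBasis ℝ V
  have h1 : f = fun m ↦ ∑ i, f m (b i) • LinearMap.toContinuousLinearMap (b.coord i) := by
    funext m
    ext x
    conv_lhs => rw [← b.sum_repr x, map_sum]
    rw [sum_apply]
    refine Finset.sum_congr rfl fun i _ ↦ ?_
    rw [map_smul, smul_apply, LinearMap.coe_toContinuousLinearMap',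
      Module.Basis.coord_apply, smul_eq_mul, smul_eq_mul, mul_comm]
  rw [h1]
  exact contMDiffAt_finsetSum fun i _ ↦ (hf (b i)).smul contMDiffAt_const

end FiniteDimensionalTargets

theorem tder_clm {V F : Type*} [NormedAddCommGroup V] [NormedSpace ℝ V]
    [NormedAddCommGroup F] [NormedSpace ℝ F] (L : V →L[ℝ] F) (x : V) :
    tder 𝓘(ℝ, V) 𝓘(ℝ, F) L x = L := L.mfderiv_eq

/-! ### The bundle `E` as a Lie group and its distinguished functions -/

section Bundle

variable {EG EB G : Type*} [NormedAddCommGroup EG] [NormedSpace ℝ EG]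
  [NormedAddCommGroup EB] [NormedSpace ℝ EB]
  [TopologicalSpace G] [ChartedSpace EG G] [Group G]
  {B C : Subgroup G} [ChartedSpace EB B]

namespace DualBundle

instance [T2Space G] : T2Space (DualBundle EG EB B) :=
  inferInstanceAs (T2Space (annihilator EG EB B × B))

theorem isManifold [IsManifold 𝓘(ℝ, EB) ∞ B] : IsManifold (model EG EB B) ∞ (DualBundle EG EB B) :=
  inferInstanceAs (IsManifold (𝓘(ℝ, annihilator EG EB B).prod 𝓘(ℝ, EB)) ∞ (annihilator EG EB B × B))

theorem contMDiff_fibre : ContMDiff (model EG EB B) 𝓘(ℝ, annihilator EG EB B) ∞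
    (fibre : DualBundle EG EB B → annihilator EG EB B) :=
  contMDiff_fst (I := 𝓘(ℝ, annihilator EG EB B)) (M := annihilator EG EB B)

theorem contMDiff_base : ContMDiff (model EG EB B) 𝓘(ℝ, EB) ∞ (base : DualBundle EG EB B → B) :=
  contMDiff_snd (I := 𝓘(ℝ, annihilator EG EB B)) (M := annihilator EG EB B)

theorem contMDiff_coe_fibre : ContMDiff (model EG EB B) 𝓘(ℝ, EG →L[ℝ] ℝ) ∞
    (fun g : DualBundle EG EB B ↦ (g.fibre : EG →L[ℝ] ℝ)) :=
  ContMDiff.comp (I' := 𝓘(ℝ, annihilator EG EB B)) (g := (annihilator EG EB B).subtypeL)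
    (ContinuousLinearMap.contMDiff (𝕜 := ℝ) (E := annihilator EG EB B) (F := EG →L[ℝ] ℝ)
      (n := ∞) (annihilator EG EB B).subtypeL) contMDiff_fibre

variable [LieGroup 𝓘(ℝ, EG) ∞ G]

/-- `E` is trivialized from the right and `L` from the left; the adjoint action compares the two. -/
theorem covector_lT (g : DualBundle EG EB B) (y : EG) :
    g.covector (lT EG (g.base : G) 1 y) = (g.fibre : EG →L[ℝ] ℝ) (Ad EG (g.base : G) y) := by
  rw [Ad_eq]; rfl

variable [hB : IsLieSubgroup EG EB B] [FiniteDimensional ℝ EG]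

theorem lieGroup : LieGroup (model EG EB B) ∞ (DualBundle EG EB B) := by
  have := lieGroup_subgroup EG EB B
  have hval := contMDiff_val EG EB B
  refine { isManifold with contMDiff_mul := fun p ↦ ?_, contMDiff_inv := fun g ↦ ?_ }
  · have hp1 : ContMDiffAt ((model EG EB B).prod (model EG EB B)) (model EG EB B) ∞
        (Prod.fst : DualBundle EG EB B × DualBundle EG EB B → _) p := contMDiffAt_fst
    have hp2 : ContMDiffAt ((model EG EB B).prod (model EG EB B)) (model EG EB B) ∞
        (Prod.snd : DualBundle EG EB B × DualBundle EG EB B → _) p := contMDiffAt_snd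
    have h1 : ContMDiffAt ((model EG EB B).prod (model EG EB B)) 𝓘(ℝ, annihilator EG EB B) ∞
        (fun p : DualBundle EG EB B × DualBundle EG EB B ↦ (p.1 * p.2).fibre) p := by
      refine contMDiffAt_of_coe (contMDiffAt_of_apply fun x ↦ ?_)
      have e1 := (contMDiff_coe_fibre (EG := EG) (EB := EB) (B := B) p.1).comp p hp1
      have e2 := (contMDiff_coe_fibre (EG := EG) (EB := EB) (B := B) p.2).comp p hp2
      have e3 : ContMDiffAt ((model EG EB B).prod (model EG EB B)) 𝓘(ℝ, EG) ∞
          (fun p : DualBundle EG EB B × DualBundle EG EB B ↦ Ad EG (p.1.base : G)⁻¹ x) p :=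
        ContMDiffAt.Ad_apply (((hval _).comp p ((contMDiff_base p.1).comp p hp1)).inv)
          contMDiffAt_const
      exact (e1.clm_apply contMDiffAt_const).add (e2.clm_apply e3)
    have h2 : ContMDiffAt ((model EG EB B).prod (model EG EB B)) 𝓘(ℝ, EB) ∞
        (fun p : DualBundle EG EB B × DualBundle EG EB B ↦ (p.1 * p.2).base) p :=
      ((contMDiff_base p.1).comp p hp1).mul
        ((contMDiff_base p.2).comp p hp2)
    exact h1.prodMk h2
  · have h1 : ContMDiffAt (model EG EB B) 𝓘(ℝ, annihilator EG EB B) ∞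
        (fun g : DualBundle EG EB B ↦ (g⁻¹).fibre) g := by
      refine contMDiffAt_of_coe (contMDiffAt_of_apply fun x ↦ ?_)
      have e3 : ContMDiffAt (model EG EB B) 𝓘(ℝ, EG) ∞
          (fun g : DualBundle EG EB B ↦ Ad EG ((g.base⁻¹ : B) : G)⁻¹ x) g :=
        ContMDiffAt.Ad_apply ((hval _).comp g (contMDiff_base g).inv).inv contMDiffAt_const
      exact ((contMDiff_coe_fibre g).clm_apply e3).neg
    have h2 : ContMDiffAt (model EG EB B) 𝓘(ℝ, EB) ∞
        (fun g : DualBundle EG EB B ↦ (g⁻¹).base) g := (contMDiff_base g).inv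
    exact h1.prodMk h2

end DualBundle

variable [LieGroup 𝓘(ℝ, EG) ∞ G] [hB : IsLieSubgroup EG EB B]

theorem linearFun_apply (X : AlgebroidSection EG EB B C) (g : DualBundle EG EB B) :
    linearFun X g = (g.fibre : EG →L[ℝ] ℝ) (Ad EG (g.base : G) (X.coeff g.base)) := by
  rw [← DualBundle.covector_lT, X.lT_coeff]; rfl

omit [LieGroup 𝓘(ℝ, EG) ∞ G] hB in
theorem pullback_apply (f : C^∞⟮𝓘(ℝ, EB), B; 𝓘(ℝ), ℝ⟯) (g : DualBundle EG EB B) :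
    pullback f g = f g.base := rfl

omit [LieGroup 𝓘(ℝ, EG) ∞ G] hB in
theorem tder_pullback (f : C^∞⟮𝓘(ℝ, EB), B; 𝓘(ℝ), ℝ⟯) (g : DualBundle EG EB B)
    (x : annihilator EG EB B × EB) :
    tder (DualBundle.model EG EB B) 𝓘(ℝ) (pullback (EG := EG) f) g x =
      tder 𝓘(ℝ, EB) 𝓘(ℝ) f g.base x.2 := by
  have h1 := tder_comp (I := DualBundle.model EG EB B) (x := g)
    (f.contMDiff.mdifferentiable (by simp) g.base)
    (DualBundle.contMDiff_base.mdifferentiable (by simp) g)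
  have h2 : tder (DualBundle.model EG EB B) 𝓘(ℝ, EB)
      (DualBundle.base : DualBundle EG EB B → B) g = ContinuousLinearMap.snd ℝ _ _ :=
    mfderiv_snd (I := 𝓘(ℝ, annihilator EG EB B)) (M := annihilator EG EB B)
  rw [h2] at h1
  exact congrArg (fun T : annihilator EG EB B × EB →L[ℝ] ℝ ↦ T x) h1

/-- The vertical derivative of a fibrewise linear function. -/
theorem tder_linearFun_vertical (X : AlgebroidSection EG EB B C) (g : DualBundle EG EB B)
    (w : annihilator EG EB B) :
    tder (DualBundle.model EG EB B) 𝓘(ℝ) (linearFun X) g (w, 0) =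
      (w : EG →L[ℝ] ℝ) (Ad EG (g.base : G) (X.coeff g.base)) := by
  have h1 := tder_prodMk_left (M := annihilator EG EB B) (M' := B) (f := linearFun X)
    (p := g.fibre) (q := g.base) ((linearFun X).contMDiff.mdifferentiable (by simp) g) w
  refine Eq.trans h1.symm ?_
  let L : annihilator EG EB B →L[ℝ] ℝ :=
    (ContinuousLinearMap.apply ℝ ℝ (Ad EG (g.base : G) (X.coeff g.base))).comp
      (annihilator EG EB B).subtypeL
  have h2 : (fun v : annihilator EG EB B ↦ linearFun X (v, g.base)) = L := by
    funext v
    exact linearFun_apply X (DualBundle.mk v g.base)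
  rw [h2]
  have h3 : tder 𝓘(ℝ, annihilator EG EB B) 𝓘(ℝ) L g.fibre = L :=
    tder_clm (V := annihilator EG EB B) (F := ℝ) L g.fibre
  rw [h3]
  rfl

end Bundle

/-! ### Duality with the algebroid and the generators `ℓ_y`, `π^* f` -/

section Bundle

variable {EG EB G : Type*} [NormedAddCommGroup EG] [NormedSpace ℝ EG]
  [NormedAddCommGroup EB] [NormedSpace ℝ EB]
  [TopologicalSpace G] [ChartedSpace EG G] [Group G] [LieGroup 𝓘(ℝ, EG) ∞ G]
  {B C : Subgroup G} [ChartedSpace EB B] [hB : IsLieSubgroup EG EB B]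

/-- Right translation by `b` carries `𝔟` onto `T_b B`, so its transpose matches the two
annihilators. -/
theorem covector_bijOn (b : B) :
    Set.BijOn (fun v : annihilator EG EB B ↦ (DualBundle.mk v b).covector) Set.univ
      (conormal EG EB B b) := by
  have hcov (v : annihilator EG EB B) (X : EG) :
      (DualBundle.mk v b).covector X = (v : EG →L[ℝ] ℝ) (rT EG (b : G)⁻¹ b X) := rfl
  have hmem (v : annihilator EG EB B) (x : EB) :
      (v : EG →L[ℝ] ℝ) (inclDeriv EG EB B 1 x) = 0 := v.2 x
  refine ⟨fun v _ x ↦ ?_, fun v _ w _ hvw ↦ ?_, fun φ hφ ↦ ?_⟩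
  · have h1 := inclDeriv_rT (EG := EG) B b⁻¹ b x
    rw [mul_inv_cancel] at h1
    change (v : EG →L[ℝ] ℝ) (rT EG ((b⁻¹ : B) : G) b (inclDeriv EG EB B b x)) = 0
    rw [← h1, hmem]
  · refine Subtype.ext (ContinuousLinearMap.ext fun z ↦ ?_)
    have h1 := congrArg (fun φ : EG →L[ℝ] ℝ ↦ φ (rT EG (b : G) 1 z)) hvw
    have h2 := rT_inv_rT (E := EG) (b : G) 1 z
    rw [one_mul] at h2
    simp only [hcov, h2] at h1
    exact h1
  · refine ⟨⟨φ.comp (rT EG (b : G) 1), fun x ↦ ?_⟩, mem_univ _, ContinuousLinearMap.ext fun X ↦ ?_⟩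
    · rw [ContinuousLinearMap.comp_apply, ← inclDeriv_rT_one]
      exact hφ _
    · have h2 := rT_rT_inv (E := EG) (b : G) b X
      rw [mul_inv_cancel] at h2
      exact congrArg φ h2

namespace HasSmoothSource

variable (h : HasSmoothSource EG EB B C)
include h

omit hB in
theorem lT_mem_algebroidFibre (b : B) {y : EG} (hy : projB EG EB B C y = 0) [IsLieSubgroup EG EB B] :
    lT EG (b : G) 1 y ∈ algebroidFibre EG EB B C b := by
  refine h.mem_algebroidFibre.2 ?_
  have := lT_inv_lT (E := EG) (b : G) 1 y
  rw [mul_one] at this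
  rw [this, hy]

/-- As `Ad_b` preserves `𝔟`, also `𝔤 = 𝔟 ⊕ Ad_b 𝔠`. An element of `𝔟⁰` is thus the same as a
functional on `Ad_b 𝔠`, and the fibre at `b` is the right translate of `Ad_b 𝔠`. -/
theorem toDual_bijective [FiniteDimensional ℝ EG] (b : B) :
    Function.Bijective (β := Module.Dual ℝ (algebroidFibre EG EB B C b))
      (fun v : annihilator EG EB B ↦ (DualBundle.mk v b).toDual C) := by
  have hcov (v : annihilator EG EB B) (y : EG) :
      (DualBundle.mk v b).covector (lT EG (b : G) 1 y) = (v : EG →L[ℝ] ℝ) (Ad EG (b : G) y) :=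
    DualBundle.covector_lT (DualBundle.mk v b) y
  have hAd (v : annihilator EG EB B) (z : EG) : (v : EG →L[ℝ] ℝ) z =
      (v : EG →L[ℝ] ℝ) (Ad EG (b : G) (projC EG EB B C (Ad EG (b : G)⁻¹ z))) := by
    rw [projC_apply, map_sub, map_sub, Ad_Ad_inv, Ad_inclDeriv, v.2, sub_zero]
  constructor
  · intro v w hvw
    refine Subtype.ext (ContinuousLinearMap.ext fun z ↦ ?_)
    rw [hAd v, hAd w, ← hcov, ← hcov]
    exact congrArg (fun φ : Module.Dual ℝ (algebroidFibre EG EB B C b) ↦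
      φ ⟨_, h.lT_mem_algebroidFibre b (h.projB_projC (Ad EG (b : G)⁻¹ z))⟩) hvw
  · intro φ
    let ψ : EG →ₗ[ℝ] ℝ := φ.comp (LinearMap.codRestrict (algebroidFibre EG EB B C b)
      (((lT EG (b : G) 1).comp ((projC EG EB B C).comp (Ad EG (b : G)⁻¹))).toLinearMap)
      fun z ↦ h.lT_mem_algebroidFibre b (h.projB_projC _))
    have hψ (z : EG) : ψ z = φ ⟨lT EG (b : G) 1 (projC EG EB B C (Ad EG (b : G)⁻¹ z)),
      h.lT_mem_algebroidFibre b (h.projB_projC _)⟩ := rfl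
    have hv : LinearMap.toContinuousLinearMap ψ ∈ annihilator EG EB B := fun x ↦ by
      rw [LinearMap.coe_toContinuousLinearMap', hψ]
      have e1 : projC EG EB B C (Ad EG (b : G)⁻¹ (inclDeriv EG EB B 1 x)) = 0 := by
        have := Ad_inclDeriv (EG := EG) B b⁻¹ x
        rw [← Subgroup.coe_inv, this, h.projC_inclDeriv]
      refine Eq.trans (congrArg φ (Subtype.ext ?_)) (map_zero φ)
      change lT EG (b : G) 1 (projC EG EB B C (Ad EG (b : G)⁻¹ (inclDeriv EG EB B 1 x))) = 0
      rw [e1, map_zero]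
    refine ⟨⟨LinearMap.toContinuousLinearMap ψ, hv⟩, LinearMap.ext fun X ↦ ?_⟩
    · obtain ⟨X, hX⟩ := X
      set y := lT EG (b : G)⁻¹ b X
      have hy : projB EG EB B C y = 0 := h.mem_algebroidFibre.1 hX
      have hX2 : X = lT EG (b : G) 1 y := by
        have := lT_lT_inv (E := EG) (b : G) b X
        rw [inv_mul_cancel] at this
        exact this.symm
      refine Eq.trans (congrArg (DualBundle.mk (⟨LinearMap.toContinuousLinearMap ψ, hv⟩ :
        annihilator EG EB B) b).covector hX2) ?_
      rw [hcov]
      change ψ (Ad EG (b : G) y) = φ ⟨X, hX⟩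
      rw [hψ]
      refine congrArg φ (Subtype.ext ?_)
      change lT EG (b : G) 1 (projC EG EB B C (Ad EG (b : G)⁻¹ (Ad EG (b : G) y))) = X
      rw [Ad_inv_Ad, projC_apply, hy, map_zero, sub_zero, hX2]

end HasSmoothSource

variable (EG EB B C) in
/-- The Lie algebra `𝔠`, as the kernel of the projection onto `𝔟`. -/
abbrev kerB : Submodule ℝ EG := LinearMap.ker (projB EG EB B C).toLinearMap

/-- The function on `B` obtained by applying the anchor of the left translates of `y`. -/
def anchorFun (f : C^∞⟮𝓘(ℝ, EB), B; 𝓘(ℝ), ℝ⟯) (y : EG) : C^∞⟮𝓘(ℝ, EB), B; 𝓘(ℝ), ℝ⟯ where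
  val b := tder 𝓘(ℝ, EB) 𝓘(ℝ) f b (anchorVec EG EB B C y b)
  property := by
    have := lieGroup_subgroup EG EB B
    exact fun b ↦ ContMDiffAt.tder_apply (f.contMDiff b) (ContMDiffAt.rT_tangent contMDiffAt_id
      (((projB EG EB B C).contMDiff _).comp b
        (ContMDiffAt.Ad_apply (contMDiff_val EG EB B b) contMDiffAt_const)))

theorem anchorFun_apply (f : C^∞⟮𝓘(ℝ, EB), B; 𝓘(ℝ), ℝ⟯) (y : EG) (b : B) :
    anchorFun (C := C) f y b = tder 𝓘(ℝ, EB) 𝓘(ℝ) f b (anchorVec EG EB B C y b) := rfl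

variable (EG EB B C) in
theorem anchorVec_add (y z : EG) (b : B) :
    anchorVec EG EB B C (y + z) b = anchorVec EG EB B C y b + anchorVec EG EB B C z b := by
  simp [anchorVec]

variable (EG EB B C) in
theorem anchorVec_smul (c : ℝ) (y : EG) (b : B) :
    anchorVec EG EB B C (c • y) b = c • anchorVec EG EB B C y b := by
  simp [anchorVec]

/-- The pullback to `E` of `anchorFun f y`, as a linear function of `y`. -/
def anchorPullback (f : C^∞⟮𝓘(ℝ, EB), B; 𝓘(ℝ), ℝ⟯) :
    kerB EG EB B C →ₗ[ℝ] C^∞⟮DualBundle.model EG EB B, DualBundle EG EB B; 𝓘(ℝ), ℝ⟯ where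
  toFun y := pullback (anchorFun (C := C) f (y : EG))
  map_add' y z := by
    ext g
    simp only [pullback_apply, anchorFun_apply, ContMDiffMap.coe_add, Pi.add_apply,
      Submodule.coe_add, anchorVec_add, map_add]
  map_smul' c y := by
    ext g
    simp only [pullback_apply, anchorFun_apply, ContMDiffMap.coe_smul, Pi.smul_apply,
      Submodule.coe_smul, anchorVec_smul, map_smul, RingHom.id_apply]

namespace HasSmoothSource

variable (h : HasSmoothSource EG EB B C)

/-- The left translates of `y ∈ 𝔠`, as a section of the Lie algebroid. -/
def constSection (y : kerB EG EB B C) : AlgebroidSection EG EB B C :=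
  h.mkSection (fun _ ↦ (y : EG)) contMDiff_const fun _ ↦ LinearMap.mem_ker.1 y.2

theorem coeff_constSection (y : kerB EG EB B C) (b : B) : (h.constSection y).coeff b = y :=
  h.coeff_mkSection _ _ _ b

/-- The fibrewise linear function defined by the left translates of `y ∈ 𝔠`. -/
def ell : kerB EG EB B C →ₗ[ℝ] C^∞⟮DualBundle.model EG EB B, DualBundle EG EB B; 𝓘(ℝ), ℝ⟯ where
  toFun y := linearFun (h.constSection y)
  map_add' y z := by
    ext g
    simp only [linearFun_apply, coeff_constSection, ContMDiffMap.coe_add, Pi.add_apply,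
      Submodule.coe_add, map_add]
  map_smul' c y := by
    ext g
    simp only [linearFun_apply, coeff_constSection, ContMDiffMap.coe_smul, Pi.smul_apply,
      Submodule.coe_smul, map_smul, RingHom.id_apply]

theorem ell_apply (y : kerB EG EB B C) (g : DualBundle EG EB B) :
    h.ell y g = (g.fibre : EG →L[ℝ] ℝ) (Ad EG (g.base : G) y) := by
  change linearFun _ g = _
  rw [linearFun_apply, coeff_constSection]

theorem tder_ell_vertical (y : kerB EG EB B C) (g : DualBundle EG EB B)
    (w : annihilator EG EB B) :
    tder (DualBundle.model EG EB B) 𝓘(ℝ) (h.ell y) g (w, 0) =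
      (w : EG →L[ℝ] ℝ) (Ad EG (g.base : G) y) := by
  refine (tder_linearFun_vertical _ g w).trans ?_
  rw [coeff_constSection]

/-- The Lie bracket of `𝔠`. -/
def bracketC [CompleteSpace EG] : kerB EG EB B C →ₗ[ℝ] kerB EG EB B C →ₗ[ℝ] kerB EG EB B C :=
  LinearMap.mk₂ ℝ (fun y z ↦ ⟨lbr G (y : EG) z, h.projB_lbr y z y.2 z.2⟩)
    (fun x y z ↦ Subtype.ext (by
      change lbr G ((x : EG) + y) (z : EG) = lbr G (x : EG) z + lbr G (y : EG) z
      rw [lbr_swap, lbr_add, neg_add, ← lbr_swap, ← lbr_swap]))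
    (fun c x y ↦ Subtype.ext (by
      change lbr G (c • (x : EG)) (y : EG) = c • lbr G (x : EG) y
      rw [lbr_swap, lbr_smul, ← smul_neg, ← lbr_swap]))
    (fun x y z ↦ Subtype.ext (lbr_add (G := G) (x : EG) y z))
    (fun c x y ↦ Subtype.ext (lbr_smul (G := G) c (x : EG) y))

theorem coe_bracketC [CompleteSpace EG] (y z : kerB EG EB B C) :
    (h.bracketC y z : EG) = lbr G (y : EG) z := rfl

/-- The functions `ℓ_y` and `π^* f`. -/
def generators : Set C^∞⟮DualBundle.model EG EB B, DualBundle EG EB B; 𝓘(ℝ), ℝ⟯ :=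
  range h.ell ∪ range pullback

/-- The functions `π^* f` detect the component along `B`. On a vertical vector `w` the `ℓ_y` give
the values of `w` on `Ad_b 𝔠`, which determine `w` because it kills the complement `𝔟`. -/
theorem generators_separating [FiniteDimensional ℝ EB] [T2Space G] (g : DualBundle EG EB B)
    (x : annihilator EG EB B × EB)
    (hx : ∀ s ∈ h.generators, tder (DualBundle.model EG EB B) 𝓘(ℝ) s g x = 0) : x = 0 := by
  have := lieGroup_subgroup EG EB B
  obtain ⟨w, u⟩ := x
  have hu : u = 0 := by
    refine (Module.forall_dual_apply_eq_zero_iff ℝ u).1 fun T ↦ ?_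
    obtain ⟨f, hf, hf1⟩ := exists_contMDiff_tder_eq g.base (LinearMap.toContinuousLinearMap T)
    have : tder 𝓘(ℝ, EB) 𝓘(ℝ) f g.base u = 0 :=
      (tder_pullback (EG := EG) ⟨f, hf⟩ g (w, u)).symm.trans (hx (pullback ⟨f, hf⟩) (Or.inr ⟨_, rfl⟩))
    rw [hf1] at this
    exact this
  subst hu
  have hw : w = 0 := by
    refine Subtype.ext (ContinuousLinearMap.ext fun z ↦ ?_)
    have h1 := hx (h.ell ⟨projC EG EB B C (Ad EG (g.base : G)⁻¹ z), h.projB_projC _⟩)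
      (Or.inl ⟨_, rfl⟩)
    rw [tder_ell_vertical] at h1
    change (w : EG →L[ℝ] ℝ) (Ad EG (g.base : G) (projC EG EB B C (Ad EG (g.base : G)⁻¹ z))) = 0 at h1
    rw [projC_apply, map_sub, map_sub, Ad_Ad_inv, Ad_inclDeriv, w.2, sub_zero] at h1
    exact h1
  rw [hw]; rfl

end HasSmoothSource

end Bundle

/-! ### Existence of the bivector -/

section Existence

variable {EG EB G : Type*} [NormedAddCommGroup EG] [NormedSpace ℝ EG]
  [NormedAddCommGroup EB] [NormedSpace ℝ EB]
  [TopologicalSpace G] [ChartedSpace EG G] [Group G]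
  {B C : Subgroup G} [ChartedSpace EB B] [hB : IsLieSubgroup EG EB B]

instance : IsManifold (DualBundle.model EG EB B) ∞ (DualBundle EG EB B) := by
  have := lieGroup_subgroup EG EB B
  exact DualBundle.isManifold

variable (EG EB B) in
/-- The algebra of smooth functions on the bundle `E`. -/
abbrev BundleFun : Type _ := C^∞⟮DualBundle.model EG EB B, DualBundle EG EB B; 𝓘(ℝ), ℝ⟯

variable [LieGroup 𝓘(ℝ, EG) ∞ G]

/-- The derivation along the vertical field whose value at `(v, b)` is `Ad*_b w`. -/
def vertDerivation [FiniteDimensional ℝ EG] (w : annihilator EG EB B) :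
    Derivation ℝ (BundleFun EG EB B) (BundleFun EG EB B) :=
  fieldDerivation (DualBundle.model EG EB B)
    (fun g : DualBundle EG EB B ↦ ((⟨coAd EG (g.base : G) w, coAd_mem EB B g.base w.2⟩, 0) :
      annihilator EG EB B × EB)) fun g ↦ by
    have := lieGroup_subgroup EG EB B
    have h1 : ContMDiffAt (DualBundle.model EG EB B) 𝓘(ℝ, annihilator EG EB B) ∞
        (fun g : DualBundle EG EB B ↦ (⟨coAd EG (g.base : G) w, coAd_mem EB B g.base w.2⟩ :
          annihilator EG EB B)) g := by
      refine contMDiffAt_of_coe (contMDiffAt_of_apply fun x ↦ ?_)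
      exact ((w : EG →L[ℝ] ℝ).contMDiff (n := ∞) _).comp g (ContMDiffAt.Ad_apply
        ((contMDiff_val EG EB B _).comp g (DualBundle.contMDiff_base g)).inv contMDiffAt_const)
    exact ContMDiffAt.prodMk_tangent (contMDiffAt_mk_vectorSpace (DualBundle.contMDiff_fibre g) h1)
      (contMDiff_zeroTangent DualBundle.contMDiff_base g)

variable (C) in
/-- The derivation along the anchor of the left translates of `y`. -/
def anchorDerivation (y : EG) : Derivation ℝ (BundleFun EG EB B) (BundleFun EG EB B) :=
  fieldDerivation (DualBundle.model EG EB B)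
    (fun g : DualBundle EG EB B ↦ ((0, anchorVec EG EB B C y g.base) : annihilator EG EB B × EB))
    fun g ↦ by
    have := lieGroup_subgroup EG EB B
    refine ContMDiffAt.prodMk_tangent (contMDiff_zeroTangent DualBundle.contMDiff_fibre g)
      (ContMDiffAt.rT_tangent (DualBundle.contMDiff_base g) ?_)
    exact ((projB EG EB B C).contMDiff (n := ∞) _).comp g (ContMDiffAt.Ad_apply
      ((contMDiff_val EG EB B _).comp g (DualBundle.contMDiff_base g)) contMDiffAt_const)

theorem vertDerivation_pullback [FiniteDimensional ℝ EG] (w : annihilator EG EB B)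
    (f : C^∞⟮𝓘(ℝ, EB), B; 𝓘(ℝ), ℝ⟯) : vertDerivation w (pullback f) = 0 := by
  ext g
  exact (tder_pullback f g _).trans (map_zero _)

theorem anchorDerivation_pullback (y : kerB EG EB B C) (f : C^∞⟮𝓘(ℝ, EB), B; 𝓘(ℝ), ℝ⟯) :
    anchorDerivation C (y : EG) (pullback f) = anchorPullback f y := by
  ext g
  exact tder_pullback f g _

namespace HasSmoothSource

variable (h : HasSmoothSource EG EB B C)

/-- The twist by `Ad*_b` in the vertical field cancels the `Ad_b` in `ℓ_y`. The result is constant,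
so dual bases yield derivations dual to the `ℓ`'s. -/
theorem vertDerivation_ell [FiniteDimensional ℝ EG] (w : annihilator EG EB B)
    (y : kerB EG EB B C) : vertDerivation w (h.ell y) = ((w : EG →L[ℝ] ℝ) y) • 1 := by
  ext g
  refine (h.tder_ell_vertical y g _).trans ?_
  change (w : EG →L[ℝ] ℝ) (Ad EG (g.base : G)⁻¹ (Ad EG (g.base : G) y)) =
    (w : EG →L[ℝ] ℝ) y * 1
  rw [Ad_inv_Ad, mul_one]

/-- An antisymmetric biderivation with the prescribed values on the generators. -/
structure IsLinearBracket [CompleteSpace EG]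
    (br : BundleFun EG EB B →ₗ[ℝ] BundleFun EG EB B →ₗ[ℝ] BundleFun EG EB B) : Prop where
  self : ∀ f, br f f = 0
  leibniz : ∀ f g k, br f (g * k) = br f g * k + g * br f k
  ell_ell : ∀ y z, br (h.ell y) (h.ell z) = h.ell (h.bracketC y z)
  ell_pullback : ∀ y f, br (h.ell y) (pullback f) = anchorPullback f y
  pullback_pullback : ∀ f k, br (pullback f) (pullback k) = 0

/-- With `d i` dual to the functions `ℓ` of a basis of `𝔠` and zero on pullbacks, the terms `d i ∧ D
i` give the required brackets with pullbacks. The coefficients `Λ` then adjust the brackets of two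
`ℓ`'s without disturbing the others. -/
theorem exists_isLinearBracket [FiniteDimensional ℝ EG] [CompleteSpace EG] :
    ∃ br, h.IsLinearBracket br := by
  let e := Module.finBasis ℝ (kerB EG EB B C)
  let q : EG →ₗ[ℝ] kerB EG EB B C :=
    LinearMap.codRestrict _ (projC EG EB B C).toLinearMap fun z ↦ h.projB_projC z
  have hq (y : kerB EG EB B C) : q y = y := by
    refine Subtype.ext ?_
    change projC EG EB B C (y : EG) = y
    rw [projC_apply, show projB EG EB B C (y : EG) = 0 from y.2, map_zero, sub_zero]
  -- The dual basis of `𝔠`, extended by zero on `𝔟` so as to lie in `𝔟⁰`.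
  let ε (i : Fin (Module.finrank ℝ (kerB EG EB B C))) : annihilator EG EB B :=
    ⟨LinearMap.toContinuousLinearMap ((e.coord i).comp q), fun x ↦ by
      change e.coord i (q (inclDeriv EG EB B 1 x)) = 0
      have : q (inclDeriv EG EB B 1 x) = 0 := Subtype.ext (h.projC_inclDeriv x)
      rw [this, map_zero]⟩
  have hε (i j) : ((ε i : annihilator EG EB B) : EG →L[ℝ] ℝ) (e j) = if j = i then 1 else 0 := by
    change e.coord i (q (e j)) = _
    rw [hq, Module.Basis.coord_apply, Module.Basis.repr_self, Finsupp.single_apply]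
  let d i := vertDerivation (ε i)
  let D i := anchorDerivation (B := B) (EB := EB) C (e i : EG)
  -- The first sum already contributes `D i ℓ_j - D j ℓ_i` to the bracket of `ℓ_i` and `ℓ_j`; the
  -- last two terms remove it.
  let Λ i j : BundleFun EG EB B :=
    h.ell (h.bracketC (e i) (e j)) - D i (h.ell (e j)) + D j (h.ell (e i))
  have hΛ (i j) : Λ i j = -Λ j i := by
    have : h.bracketC (e i) (e j) = -h.bracketC (e j) (e i) :=
      Subtype.ext (lbr_swap (G := G) (e i : EG) (e j))
    simp only [Λ, this, map_neg]
    abel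
  have hdp (i f) : d i (pullback f) = 0 := vertDerivation_pullback _ f
  have hde (i j) : d i (h.ell (e j)) = if j = i then 1 else 0 := by
    change vertDerivation (ε i) (h.ell (e j)) = _
    rw [vertDerivation_ell, hε]
    split_ifs <;> simp
  refine ⟨biderivation d D Λ, biderivation_self d D Λ hΛ, biderivation_leibniz d D Λ, ?_, ?_, ?_⟩
  · have : (biderivation d D Λ).compl₁₂ h.ell h.ell = h.bracketC.compr₂ h.ell := by
      refine LinearMap.ext_basis e e fun i j ↦ ?_
      rw [LinearMap.compl₁₂_apply, LinearMap.compr₂_apply, biderivation_apply]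
      simp only [hde, ite_mul, one_mul, zero_mul, Finset.sum_sub_distrib, mul_ite, mul_one,
        mul_zero, Finset.sum_ite_eq, Finset.mem_univ, if_true]
      simp only [Λ]
      abel
    exact fun y z ↦ congrArg (fun T : kerB EG EB B C →ₗ[ℝ] kerB EG EB B C →ₗ[ℝ]
      BundleFun EG EB B ↦ T y z) this
  · intro y f
    have : ((biderivation d D Λ).flip (pullback f)).comp h.ell = anchorPullback f := by
      refine e.ext fun i ↦ ?_
      rw [LinearMap.comp_apply, LinearMap.flip_apply, biderivation_apply]
      simp only [hde, hdp, ite_mul, one_mul, zero_mul, mul_zero, sub_zero, Finset.sum_ite_eq,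
        Finset.mem_univ, if_true, Finset.sum_const_zero, add_zero]
      exact anchorDerivation_pullback (e i) f
    exact congrArg (fun T : kerB EG EB B C →ₗ[ℝ] BundleFun EG EB B ↦ T y) this
  · intro f k
    rw [biderivation_apply]
    simp only [hdp, zero_mul, mul_zero, sub_zero, Finset.sum_const_zero, add_zero]

end HasSmoothSource

end Existence

/-! ### Jacobi identity, uniqueness, and the relations for all sections -/

section LinearPoisson

variable {EG EB G : Type*} [NormedAddCommGroup EG] [NormedSpace ℝ EG]
  [NormedAddCommGroup EB] [NormedSpace ℝ EB]
  [TopologicalSpace G] [ChartedSpace EG G] [Group G] [LieGroup 𝓘(ℝ, EG) ∞ G]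
  {B C : Subgroup G} [ChartedSpace EB B] [hB : IsLieSubgroup EG EB B]

theorem anchorPullback_apply (f : C^∞⟮𝓘(ℝ, EB), B; 𝓘(ℝ), ℝ⟯) (y : kerB EG EB B C)
    (g : DualBundle EG EB B) : anchorPullback f y g =
      tder 𝓘(ℝ, EB) 𝓘(ℝ) f g.base (anchorVec EG EB B C y g.base) := rfl

theorem anchorPullback_eq (f : C^∞⟮𝓘(ℝ, EB), B; 𝓘(ℝ), ℝ⟯) (y : kerB EG EB B C) :
    anchorPullback f y = pullback (anchorFun (C := C) f (y : EG)) := rfl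

namespace HasSmoothSource

variable (h : HasSmoothSource EG EB B C)

theorem anchorPullback_bracketC [CompleteSpace EG] (f : C^∞⟮𝓘(ℝ, EB), B; 𝓘(ℝ), ℝ⟯)
    (y z : kerB EG EB B C) : anchorPullback f (h.bracketC y z) =
      anchorPullback (anchorFun (C := C) f (z : EG)) y -
      anchorPullback (anchorFun (C := C) f (y : EG)) z := by
  ext g
  exact h.anchorVec_lbr f.contMDiff (y : EG) z g.base

theorem bracketC_jacobi [CompleteSpace EG] (x y z : kerB EG EB B C) :
    h.bracketC x (h.bracketC y z) + h.bracketC y (h.bracketC z x) +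
      h.bracketC z (h.bracketC x y) = 0 :=
  Subtype.ext (lbr_jacobi (G := G) (x : EG) y z)

namespace IsLinearBracket

variable {h} [CompleteSpace EG]
  {br : BundleFun EG EB B →ₗ[ℝ] BundleFun EG EB B →ₗ[ℝ] BundleFun EG EB B}

theorem pullback_ell (hbr : h.IsLinearBracket br) (y : kerB EG EB B C)
    (f : C^∞⟮𝓘(ℝ, EB), B; 𝓘(ℝ), ℝ⟯) : br (pullback f) (h.ell y) = -anchorPullback f y := by
  rw [bracket_swap_of_self hbr.self, hbr.ell_pullback]

/-- Three `ℓ`'s give the Jacobi identity of `𝔠`; two `ℓ`'s and a pullback give compatibility of the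
anchor with brackets. With at least two pullbacks every term vanishes. -/
theorem jacobi [FiniteDimensional ℝ EG] [FiniteDimensional ℝ EB] [T2Space G]
    (hbr : h.IsLinearBracket br) (f g k : BundleFun EG EB B) :
    br f (br g k) + br g (br k f) + br k (br f g) = 0 := by
  have rot {f g k : BundleFun EG EB B} (h : br f (br g k) + br g (br k f) + br k (br f g) = 0) :
      br g (br k f) + br k (br f g) + br f (br g k) = 0 := by
    rw [← h]; abel
  have key2 (y z : kerB EG EB B C) (f : C^∞⟮𝓘(ℝ, EB), B; 𝓘(ℝ), ℝ⟯) :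
      br (h.ell y) (br (h.ell z) (pullback f)) + br (h.ell z) (br (pullback f) (h.ell y)) +
        br (pullback f) (br (h.ell y) (h.ell z)) = 0 := by
    rw [hbr.ell_pullback, hbr.pullback_ell, hbr.ell_ell, hbr.pullback_ell, map_neg,
      h.anchorPullback_bracketC, anchorPullback_eq, anchorPullback_eq, hbr.ell_pullback,
      hbr.ell_pullback]
    abel
  have key1 (y : kerB EG EB B C) (f k : C^∞⟮𝓘(ℝ, EB), B; 𝓘(ℝ), ℝ⟯) :
      br (h.ell y) (br (pullback f) (pullback k)) + br (pullback f) (br (pullback k) (h.ell y)) +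
        br (pullback k) (br (h.ell y) (pullback f)) = 0 := by
    rw [hbr.ell_pullback, hbr.pullback_ell, hbr.pullback_pullback, map_neg, map_zero,
      anchorPullback_eq, anchorPullback_eq, hbr.pullback_pullback, hbr.pullback_pullback]
    simp
  refine jacobi_of_separating hbr.self hbr.leibniz (S := h.generators) h.generators_separating
    (fun f hf g hg k hk ↦ ?_) f g k
  rcases hf with ⟨y, rfl⟩ | ⟨f, rfl⟩ <;> rcases hg with ⟨z, rfl⟩ | ⟨g, rfl⟩ <;>
    rcases hk with ⟨w, rfl⟩ | ⟨k, rfl⟩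
  · simp only [hbr.ell_ell, ← map_add, bracketC_jacobi, map_zero]
  · exact key2 y z k
  · exact rot (key2 w y g)
  · exact key1 y g k
  · exact rot (rot (key2 z w f))
  · exact rot (rot (key1 z k f))
  · exact rot (key1 w f g)
  · simp only [hbr.pullback_pullback, map_zero, add_zero]

theorem unique [FiniteDimensional ℝ EG] [FiniteDimensional ℝ EB] [T2Space G]
    (hbr : h.IsLinearBracket br)
    {br' : BundleFun EG EB B →ₗ[ℝ] BundleFun EG EB B →ₗ[ℝ] BundleFun EG EB B}
    (hbr' : h.IsLinearBracket br') : br = br' := by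
  refine LinearMap.ext₂ fun f k ↦ ?_
  ext p
  let D : BundleFun EG EB B →ₗ[ℝ] BundleFun EG EB B →ₗ[ℝ] ℝ :=
    LinearMap.mk₂ ℝ (fun f k ↦ br f k p - br' f k p)
      (fun f f' k ↦ by
        simp only [map_add, LinearMap.add_apply, ContMDiffMap.coe_add, Pi.add_apply]; ring)
      (fun c f k ↦ by
        simp only [map_smul, LinearMap.smul_apply, ContMDiffMap.coe_smul, Pi.smul_apply, smul_sub])
      (fun f k k' ↦ by
        simp only [map_add, ContMDiffMap.coe_add, Pi.add_apply]; ring)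
      (fun c f k ↦ by
        simp only [map_smul, ContMDiffMap.coe_smul, Pi.smul_apply, smul_sub])
  have hD (f k) : D f k = br f k p - br' f k p := rfl
  have := pointBiderivation_eq_zero (p := p) D (S := h.generators) (fun f g k ↦ by
      simp only [hD, bracket_leibniz_left hbr.self hbr.leibniz,
        bracket_leibniz_left hbr'.self hbr'.leibniz, ContMDiffMap.coe_add, Pi.add_apply,
        ContMDiffMap.coe_mul, Pi.mul_apply]
      ring) (fun f g k ↦ by
      simp only [hD, hbr.leibniz, hbr'.leibniz, ContMDiffMap.coe_add, Pi.add_apply,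
        ContMDiffMap.coe_mul, Pi.mul_apply]
      ring) (h.generators_separating p) (fun s hs t ht ↦ ?_) f k
  · exact sub_eq_zero.1 this
  · rw [hD, sub_eq_zero]
    refine congrArg (fun F : BundleFun EG EB B ↦ F p) ?_
    rcases hs with ⟨y, rfl⟩ | ⟨f, rfl⟩ <;> rcases ht with ⟨z, rfl⟩ | ⟨g, rfl⟩
    · rw [hbr.ell_ell, hbr'.ell_ell]
    · rw [hbr.ell_pullback, hbr'.ell_pullback]
    · rw [hbr.pullback_ell, hbr'.pullback_ell]
    · rw [hbr.pullback_pullback, hbr'.pullback_pullback]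

end IsLinearBracket

/-- Each `ℓ_y` comes from a section with constant coefficient, for which the derivative terms in
`bracket_eq` disappear. -/
theorem isLinearBracket_of_isLinearPoisson [FiniteDimensional ℝ EG] [CompleteSpace EG] [T2Space G]
    {P : PoissonStructure (DualBundle.model EG EB B) (DualBundle EG EB B)}
    (hP : IsLinearPoisson C P) : h.IsLinearBracket P.bracket where
  self := P.bracket_self
  leibniz := P.leibniz
  ell_ell y z := by
    ext g
    refine (hP.linear_linear (h.constSection y) (h.constSection z) g).trans ?_
    have hc (y : kerB EG EB B C) : (h.constSection y).coeff = fun _ ↦ (y : EG) :=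
      funext fun b ↦ h.coeff_constSection y b
    rw [h.bracket_eq, hc, hc, tder_const, tder_const, h.ell_apply, ← DualBundle.covector_lT,
      coe_bracketC]
    simp
  ell_pullback y f := by
    ext g
    refine (hP.linear_pullback (h.constSection y) f g).trans ?_
    rw [h.anchor_eq, h.coeff_constSection]
    rfl
  pullback_pullback := hP.pullback_pullback

/-- The function on `B` obtained by pairing the coefficients of a section with a fixed covector. -/
def coeffFun (X : AlgebroidSection EG EB B C) (L : EG →L[ℝ] ℝ) : C^∞⟮𝓘(ℝ, EB), B; 𝓘(ℝ), ℝ⟯ :=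
  ⟨fun b ↦ L (X.coeff b), (L.contMDiff (n := ∞)).comp X.contMDiff_coeff⟩

theorem tder_coeffFun (X : AlgebroidSection EG EB B C) (L : EG →L[ℝ] ℝ) (b : B) (u : EB) :
    tder 𝓘(ℝ, EB) 𝓘(ℝ) (coeffFun X L) b u = L (tder 𝓘(ℝ, EB) 𝓘(ℝ, EG) X.coeff b u) := by
  have h1 := tder_comp (x := b) ((L.contMDiff (n := ∞)).mdifferentiable (by simp) (X.coeff b))
    (X.contMDiff_coeff.mdifferentiable (by simp) b)
  rw [tder_clm] at h1
  exact congrArg (fun T : EB →L[ℝ] ℝ ↦ T u) h1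

/-- The value of a section, in the left trivialization. -/
def coeffC (X : AlgebroidSection EG EB B C) (b : B) : kerB EG EB B C :=
  ⟨X.coeff b, h.projB_coeff X b⟩

/-- The first order Taylor expansion of a fibrewise linear function, with a derivation applied. -/
theorem pointDerivation_linearFun [FiniteDimensional ℝ EG] (X : AlgebroidSection EG EB B C)
    {g : DualBundle EG EB B} (δ : BundleFun EG EB B →ₗ[ℝ] ℝ)
    (hδ : ∀ f k, δ (f * k) = δ f * k g + f g * δ k) :
    δ (linearFun X) = δ (h.ell (h.coeffC X g.base)) +
      δ (pullback (coeffFun X ((g.fibre : EG →L[ℝ] ℝ).comp (Ad EG (g.base : G))))) := by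
  let e := Module.finBasis ℝ (kerB EG EB B C)
  have hα (i) : ContMDiff 𝓘(ℝ, EB) 𝓘(ℝ) ∞ (fun b ↦ e.coord i (h.coeffC X b)) := fun b ↦
    ((LinearMap.toContinuousLinearMap (e.coord i)).contMDiff (n := ∞) _).comp b
      (contMDiffAt_of_coe (f := h.coeffC X) (X.contMDiff_coeff b))
  let α (i) : C^∞⟮𝓘(ℝ, EB), B; 𝓘(ℝ), ℝ⟯ := ⟨_, hα i⟩
  have hsum (b : B) : h.coeffC X b = ∑ i, α i b • e i := (e.sum_repr _).symm
  have ev (x : DualBundle EG EB B) (n : ℕ) (F : Fin n → BundleFun EG EB B) :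
      (∑ i, F i) x = ∑ i, F i x :=
    map_sum (ContMDiffMap.evalRingHom (I := DualBundle.model EG EB B) (n := ∞) x :
      BundleFun EG EB B →+* ℝ) F Finset.univ
  have happ (L : EG →L[ℝ] ℝ) (b : B) : L (X.coeff b) = ∑ i, α i b * L (e i : EG) := by
    have := congrArg (fun y : kerB EG EB B C ↦ L (y : EG)) (hsum b)
    simp only [Submodule.coe_sum, Submodule.coe_smul, map_sum, map_smul, smul_eq_mul] at this
    exact this
  -- In a basis of `𝔠`, a fibrewise linear function is a combination of `ℓ`'s with coefficients from
  -- `B`. The Leibniz rule then differentiates either the `ℓ`'s or the coefficients.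
  have e1 : linearFun X = ∑ i, pullback (EG := EG) (α i) * h.ell (e i) := by
    ext x
    rw [ev, linearFun_apply]
    refine (happ ((x.fibre : EG →L[ℝ] ℝ).comp (Ad EG (x.base : G))) x.base).trans
      (Finset.sum_congr rfl fun i _ ↦ ?_)
    rw [ContMDiffMap.coe_mul, Pi.mul_apply, ell_apply]
    rfl
  have e2 : pullback (coeffFun X ((g.fibre : EG →L[ℝ] ℝ).comp (Ad EG (g.base : G)))) =
      ∑ i, h.ell (e i) g • pullback (EG := EG) (α i) := by
    ext x
    rw [ev]
    refine (happ ((g.fibre : EG →L[ℝ] ℝ).comp (Ad EG (g.base : G))) x.base).trans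
      (Finset.sum_congr rfl fun i _ ↦ ?_)
    rw [ContMDiffMap.coe_smul, Pi.smul_apply, ell_apply, smul_eq_mul, mul_comm]
    rfl
  rw [e1, e2, hsum, map_sum, map_sum, map_sum, map_sum, ← Finset.sum_add_distrib]
  refine Finset.sum_congr rfl fun i _ ↦ ?_
  rw [hδ, map_smul, map_smul, map_smul, pullback_apply, smul_eq_mul, smul_eq_mul]
  ring

/-- Expanding each argument to first order at a point reduces arbitrary sections to generators. The
derivatives of the coefficients produce exactly the anchor terms of `bracket_eq`. -/
theorem IsLinearBracket.isLinearPoisson [FiniteDimensional ℝ EG] [CompleteSpace EG] [T2Space G]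
    {P : PoissonStructure (DualBundle.model EG EB B) (DualBundle EG EB B)}
    (hbr : h.IsLinearBracket P.bracket) : IsLinearPoisson C P := by
  have hs := bracket_swap_of_self P.bracket_self
  have exp (F : BundleFun EG EB B) (X : AlgebroidSection EG EB B C) (g : DualBundle EG EB B) :
      P.bracket F (linearFun X) g = P.bracket F (h.ell (h.coeffC X g.base)) g +
        P.bracket F (pullback (coeffFun X
          ((g.fibre : EG →L[ℝ] ℝ).comp (Ad EG (g.base : G))))) g := by
    let δ : BundleFun EG EB B →ₗ[ℝ] ℝ :=
      { toFun := fun k ↦ P.bracket F k g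
        map_add' := fun k l ↦ by rw [map_add]; rfl
        map_smul' := fun c k ↦ by rw [map_smul]; rfl }
    refine h.pointDerivation_linearFun X δ fun f k ↦ ?_
    change P.bracket F (f * k) g = _
    rw [P.leibniz]
    rfl
  have hpl (f : C^∞⟮𝓘(ℝ, EB), B; 𝓘(ℝ), ℝ⟯) (X : AlgebroidSection EG EB B C)
      (g : DualBundle EG EB B) : P.bracket (linearFun X) (pullback f) g =
        tder 𝓘(ℝ, EB) 𝓘(ℝ) f g.base (anchorVec EG EB B C (X.coeff g.base) g.base) := by
    have := exp (pullback f) X g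
    rw [hbr.pullback_ell, hbr.pullback_pullback] at this
    rw [hs, ContMDiffMap.coe_neg, Pi.neg_apply, this, ContMDiffMap.coe_neg, Pi.neg_apply,
      anchorPullback_apply]
    simp [coeffC]
  refine ⟨fun X Y g ↦ ?_, fun X f g ↦ ?_, hbr.pullback_pullback⟩
  · rw [exp, hpl, hs, ContMDiffMap.coe_neg, Pi.neg_apply, exp, hbr.ell_ell, hbr.ell_pullback,
      anchorPullback_apply, tder_coeffFun, tder_coeffFun, h.bracket_eq, DualBundle.covector_lT,
      h.ell_apply, coe_bracketC]
    simp only [coeffC, map_add, map_sub, ContinuousLinearMap.comp_apply]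
    rw [lbr_swap, map_neg, map_neg]
    ring
  · rw [hpl, h.anchor_eq]
    rfl

end HasSmoothSource

end LinearPoisson

/-! ### Multiplicativity of the Poisson bracket -/

section Multiplicative

variable {EG EB G : Type*} [NormedAddCommGroup EG] [NormedSpace ℝ EG]
  [NormedAddCommGroup EB] [NormedSpace ℝ EB]
  [TopologicalSpace G] [ChartedSpace EG G] [Group G] [LieGroup 𝓘(ℝ, EG) ∞ G]
  {B C : Subgroup G} [ChartedSpace EB B] [hB : IsLieSubgroup EG EB B]

/-- The transpose of `Ad_a` on `𝔟⁰`. -/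
def annihilatorComp (v : annihilator EG EB B) (a : B) : annihilator EG EB B :=
  ⟨(v : EG →L[ℝ] ℝ).comp (Ad EG (a : G)), fun x ↦ by
    rw [ContinuousLinearMap.comp_apply, Ad_inclDeriv]
    exact v.2 _⟩

theorem annihilatorComp_apply (v : annihilator EG EB B) (a : B) (y : EG) :
    (annihilatorComp v a : EG →L[ℝ] ℝ) y = (v : EG →L[ℝ] ℝ) (Ad EG (a : G) y) := rfl

/-- The function `b ↦ ⟨v, Ad_b y⟩` on `B`. -/
def adFun (v : annihilator EG EB B) (y : EG) : C^∞⟮𝓘(ℝ, EB), B; 𝓘(ℝ), ℝ⟯ :=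
  ⟨fun b ↦ (v : EG →L[ℝ] ℝ) (Ad EG (b : G) y), fun b ↦
    ((v : EG →L[ℝ] ℝ).contMDiff (n := ∞) _).comp b
      (ContMDiffAt.Ad_apply (contMDiff_val EG EB B b) contMDiffAt_const)⟩

/-- The anchor vector is a right translate of an element of `𝔟`, and along right translates the
derivative of `Ad` is a Lie bracket by `tder_Ad`. -/
theorem tder_adFun_anchorVec [FiniteDimensional ℝ EG] [CompleteSpace EG] [T2Space G]
    (v : annihilator EG EB B) (y z : EG) (b : B) :
    tder 𝓘(ℝ, EB) 𝓘(ℝ) (adFun v z) b (anchorVec EG EB B C y b) = (v : EG →L[ℝ] ℝ)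
      (lbr G (inclDeriv EG EB B 1 (projB EG EB B C (Ad EG (b : G) y))) (Ad EG (b : G) z)) := by
  have hA : MDifferentiable 𝓘(ℝ, EG) 𝓘(ℝ, EG) (fun g : G ↦ Ad EG g z) := fun g ↦
    (ContMDiffAt.Ad_apply (m := g) contMDiffAt_id contMDiffAt_const).mdifferentiableAt (by simp)
  have h1 := tder_comp (x := b) (hA (b : G)) (mdifferentiable_val EG EB B b)
  have h2 := tder_comp (x := b) (((v : EG →L[ℝ] ℝ).contMDiff (n := ∞)).mdifferentiable (by simp) _)
    ((hA (b : G)).comp b (mdifferentiable_val EG EB B b))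
  rw [h1, tder_clm] at h2
  have h3 := inclDeriv_rT_one (EG := EG) B b (projB EG EB B C (Ad EG (b : G) y))
  have h4 := congrArg (fun T : EB →L[ℝ] ℝ ↦ T (anchorVec EG EB B C y b)) h2
  refine h4.trans (congrArg (v : EG →L[ℝ] ℝ) ?_)
  rw [← tder_Ad, ← h3]
  rfl

namespace HasSmoothSource

variable (h : HasSmoothSource EG EB B C)
include h

/-- The anchor is a cocycle. -/
theorem anchorVec_mul (y : EG) (a b : B) : anchorVec EG EB B C y (a * b) =
    rT EB b a (anchorVec EG EB B C (projC EG EB B C (Ad EG (b : G) y)) a) +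
      lT EB a b (anchorVec EG EB B C y b) := by
  have := lieGroup_subgroup EG EB B
  have e1 (u : EB) : rT EB b a (rT EB a 1 u) = rT EB (a * b) 1 u := by
    have := congrArg (fun T : EB →L[ℝ] EB ↦ T u) (rT_rT (E := EB) a b 1)
    rwa [one_mul] at this
  have e2 (u : EB) : lT EB a b (rT EB b 1 u) = rT EB (a * b) 1 (Ad EB a u) := by
    have := congrArg (fun T : EB →L[ℝ] EB ↦ T u) (lT_rT (E := EB) a 1 b)
    rw [one_mul, mul_one] at this
    refine this.trans ?_
    rw [← e1, rT_Ad]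
    rfl
  simp only [anchorVec]
  -- Split `Ad_b y` into its `𝔠` and `𝔟` parts. `Ad_a` maps the `𝔟` part into `𝔟`, where the
  -- projection is the identity; it yields the left translated term.
  rw [e1, e2, ← map_add, projC_apply, map_sub, map_sub, Ad_inclDeriv, h.projB_inclDeriv,
    sub_add_cancel, Subgroup.coe_mul, Ad_mul_apply]

end HasSmoothSource

variable [FiniteDimensional ℝ EG]

namespace DualBundle

/-- Pullback of functions under a right translation. -/
def rightPullback (k : DualBundle EG EB B) (f : BundleFun EG EB B) : BundleFun EG EB B :=
  haveI := lieGroup (EG := EG) (EB := EB) (B := B)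
  (f.comp smoothMul).comp (.prodMk .id (.const k))

/-- Pullback of functions under a left translation. -/
def leftPullback (k : DualBundle EG EB B) (f : BundleFun EG EB B) : BundleFun EG EB B :=
  haveI := lieGroup (EG := EG) (EB := EB) (B := B)
  (f.comp smoothMul).comp (.prodMk (.const k) .id)

theorem rightPullback_apply (k : DualBundle EG EB B) (f : BundleFun EG EB B)
    (x : DualBundle EG EB B) : rightPullback k f x = f (x * k) := rfl

theorem leftPullback_apply (k : DualBundle EG EB B) (f : BundleFun EG EB B)
    (x : DualBundle EG EB B) : leftPullback k f x = f (k * x) := rfl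

theorem rightPullback_pullback (k : DualBundle EG EB B) (f : C^∞⟮𝓘(ℝ, EB), B; 𝓘(ℝ), ℝ⟯) :
    haveI := lieGroup_subgroup EG EB B
    rightPullback k (pullback f) =
      pullback (f.comp ⟨fun x ↦ x * k.base, contMDiff_mul_right⟩) := rfl

theorem leftPullback_pullback (k : DualBundle EG EB B) (f : C^∞⟮𝓘(ℝ, EB), B; 𝓘(ℝ), ℝ⟯) :
    haveI := lieGroup_subgroup EG EB B
    leftPullback k (pullback f) =
      pullback (f.comp ⟨fun x ↦ k.base * x, contMDiff_mul_left⟩) := rfl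

end DualBundle

open DualBundle

namespace HasSmoothSource

variable (h : HasSmoothSource EG EB B C)

/-- The base point of `x` enters the fibre term of `k` as `Ad_{a⁻¹} Ad_a`, so that term is constant
in `x`. In the other, the `𝔟` part of `Ad_b y` is lost since `x.fibre` kills `Ad_a 𝔟 ⊆ 𝔟`. -/
theorem rightPullback_ell (k : DualBundle EG EB B) (y : kerB EG EB B C) :
    rightPullback k (h.ell y) =
      h.ell ⟨projC EG EB B C (Ad EG (k.base : G) y), h.projB_projC _⟩ +
        ((k.fibre : EG →L[ℝ] ℝ) (Ad EG (k.base : G) y)) • 1 := by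
  ext x
  rw [rightPullback_apply, ContMDiffMap.coe_add, Pi.add_apply, ContMDiffMap.coe_smul,
    Pi.smul_apply, h.ell_apply, h.ell_apply, fibre_mul, base_mul, Subgroup.coe_mul, Ad_mul_apply,
    add_apply]
  simp only [coAd, ContinuousLinearMap.comp_apply]
  rw [Ad_inv_Ad, projC_apply, map_sub, map_sub, Ad_inclDeriv, x.fibre.2, sub_zero]
  simp

/-- Here the fibre of `k` is constant but is evaluated at a vector moving with the base point, which
adds a function pulled back from `B`. -/
theorem leftPullback_ell (k : DualBundle EG EB B) (y : kerB EG EB B C) :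
    leftPullback k (h.ell y) =
      h.ell y + pullback (adFun (annihilatorComp k.fibre k.base) (y : EG)) := by
  ext x
  rw [leftPullback_apply, ContMDiffMap.coe_add, Pi.add_apply, h.ell_apply, h.ell_apply,
    fibre_mul, base_mul, Subgroup.coe_mul, Ad_mul_apply, add_apply]
  simp only [coAd, ContinuousLinearMap.comp_apply]
  rw [Ad_inv_Ad, add_comm]
  rfl

/-- Decomposing both vectors along `𝔠 ⊕ 𝔟`, only the bracket of the two `𝔟` parts could spoil the
formula, and it lies in `𝔟`. -/
theorem annihilator_lbr [CompleteSpace EG] [FiniteDimensional ℝ EB]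
    (v : annihilator EG EB B) (y z : EG) :
    (v : EG →L[ℝ] ℝ) (lbr G y z) =
      (v : EG →L[ℝ] ℝ) (lbr G (projC EG EB B C y) (projC EG EB B C z)) +
      (v : EG →L[ℝ] ℝ) (lbr G (inclDeriv EG EB B 1 (projB EG EB B C y)) z) -
      (v : EG →L[ℝ] ℝ) (lbr G (inclDeriv EG EB B 1 (projB EG EB B C z)) y) := by
  have := FiniteDimensional.complete ℝ EB
  have := lieGroup_subgroup EG EB B
  set y₂ := projB EG EB B C y
  set z₂ := projB EG EB B C z
  set y₁ := projC EG EB B C y with hy₁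
  set z₁ := projC EG EB B C z with hz₁
  have hy : y = y₁ + inclDeriv EG EB B 1 y₂ := by rw [hy₁, projC_apply, sub_add_cancel]
  have hz : z = z₁ + inclDeriv EG EB B 1 z₂ := by rw [hz₁, projC_apply, sub_add_cancel]
  have add_left (a b c : EG) : lbr G (a + b) c = lbr G a c + lbr G b c := by
    rw [lbr_swap, lbr_add, neg_add, ← lbr_swap, ← lbr_swap]
  have h0 (a b : EB) : (v : EG →L[ℝ] ℝ)
      (lbr G (inclDeriv EG EB B 1 a) (inclDeriv EG EB B 1 b)) = 0 := by
    rw [← inclDeriv_lbr]; exact v.2 _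
  rw [hy, hz]
  simp only [lbr_add, add_left, map_add, h0]
  rw [lbr_swap (G := G) y₁ (inclDeriv EG EB B 1 z₂), map_neg]
  ring

namespace IsLinearBracket

variable {h} [CompleteSpace EG]
  {br : BundleFun EG EB B →ₗ[ℝ] BundleFun EG EB B →ₗ[ℝ] BundleFun EG EB B}

theorem one_right (hbr : h.IsLinearBracket br) (f : BundleFun EG EB B) : br f 1 = 0 := by
  have := hbr.leibniz f 1 1
  simpa using this

theorem one_left (hbr : h.IsLinearBracket br) (f : BundleFun EG EB B) : br 1 f = 0 := by
  rw [bracket_swap_of_self hbr.self, hbr.one_right, neg_zero]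

variable [FiniteDimensional ℝ EB] [T2Space G]

theorem mul_ell_pullback (hbr : h.IsLinearBracket br) (g k : DualBundle EG EB B)
    (y : kerB EG EB B C) (f : C^∞⟮𝓘(ℝ, EB), B; 𝓘(ℝ), ℝ⟯) :
    br (rightPullback k (h.ell y)) (rightPullback k (pullback f)) g +
      br (leftPullback g (h.ell y)) (leftPullback g (pullback f)) k =
      br (h.ell y) (pullback f) (g * k) := by
  have := lieGroup_subgroup EG EB B
  rw [h.rightPullback_ell, h.leftPullback_ell, rightPullback_pullback, leftPullback_pullback]
  simp only [map_add, map_smul, LinearMap.add_apply, LinearMap.smul_apply, hbr.one_left,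
    hbr.ell_pullback, hbr.pullback_pullback, smul_zero, add_zero]
  rw [anchorPullback_apply, anchorPullback_apply, anchorPullback_apply, base_mul,
    h.anchorVec_mul, map_add]
  have hf := f.contMDiff.mdifferentiable (by simp)
  have e1 := tder_comp (f := fun x : B ↦ x * k.base) (x := g.base) (hf (g.base * k.base))
    (mdifferentiable_mul_right' (E := EB) k.base g.base)
  have e2 := tder_comp (f := fun x : B ↦ g.base * x) (x := k.base) (hf (g.base * k.base))
    (mdifferentiable_mul_left' (E := EB) g.base k.base)
  exact congrArg₂ (· + ·) (congrArg (fun T : EB →L[ℝ] ℝ ↦ T _) e1)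
    (congrArg (fun T : EB →L[ℝ] ℝ ↦ T _) e2)

omit [FiniteDimensional ℝ EB] [T2Space G] in
theorem mul_pullback_pullback (hbr : h.IsLinearBracket br) (g k : DualBundle EG EB B)
    (f f' : C^∞⟮𝓘(ℝ, EB), B; 𝓘(ℝ), ℝ⟯) :
    br (rightPullback k (pullback f)) (rightPullback k (pullback f')) g +
      br (leftPullback g (pullback f)) (leftPullback g (pullback f')) k =
      br (pullback f) (pullback f') (g * k) := by
  have e1 : br (rightPullback k (pullback f)) (rightPullback k (pullback f')) = 0 := by
    rw [rightPullback_pullback, rightPullback_pullback, hbr.pullback_pullback]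
  have e2 : br (leftPullback g (pullback f)) (leftPullback g (pullback f')) = 0 := by
    rw [leftPullback_pullback, leftPullback_pullback, hbr.pullback_pullback]
  rw [e1, e2, hbr.pullback_pullback]
  exact add_zero (0 : ℝ)

/-- The right translates give the bracket of the `𝔠` parts of `Ad_b y` and `Ad_b z`, with `b` the
base of `k`. The left translates add derivatives of `adFun` along anchors, which are the brackets
with the `𝔟` parts. Together they are the right side of `annihilator_lbr`. -/
theorem mul_ell_ell (hbr : h.IsLinearBracket br) (g k : DualBundle EG EB B)
    (y z : kerB EG EB B C) :
    br (rightPullback k (h.ell y)) (rightPullback k (h.ell z)) g +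
      br (leftPullback g (h.ell y)) (leftPullback g (h.ell z)) k =
      br (h.ell y) (h.ell z) (g * k) := by
  have e := congrArg (fun F : BundleFun EG EB B ↦ F k) (h.leftPullback_ell g (h.bracketC y z))
  simp only [leftPullback_apply, ContMDiffMap.coe_add, Pi.add_apply, pullback_apply] at e
  rw [hbr.ell_ell, e, h.rightPullback_ell, h.rightPullback_ell, h.leftPullback_ell,
    h.leftPullback_ell]
  simp only [map_add, map_smul, LinearMap.add_apply, LinearMap.smul_apply, hbr.one_left,
    hbr.one_right, hbr.ell_ell, hbr.ell_pullback, hbr.pullback_ell, hbr.pullback_pullback,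
    smul_zero, add_zero, ContMDiffMap.coe_add, Pi.add_apply, ContMDiffMap.coe_neg, Pi.neg_apply]
  rw [anchorPullback_apply, anchorPullback_apply, tder_adFun_anchorVec, tder_adFun_anchorVec,
    h.ell_apply, coe_bracketC]
  have e3 : adFun (annihilatorComp g.fibre g.base) ((h.bracketC y z : kerB EG EB B C) : EG) k.base =
      (annihilatorComp g.fibre g.base : EG →L[ℝ] ℝ)
        (lbr G (Ad EG (k.base : G) y) (Ad EG (k.base : G) z)) :=
    congrArg (annihilatorComp g.fibre g.base : EG →L[ℝ] ℝ) (Ad_lbr (k.base : G) (y : EG) z)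
  rw [e3, annihilator_lbr (C := C) _ (Ad EG (k.base : G) y) (Ad EG (k.base : G) z)]
  rw [← annihilatorComp_apply]
  ring

end IsLinearBracket

theorem IsLinearBracket.isPoissonLieGroup {h : HasSmoothSource EG EB B C} [CompleteSpace EG]
    [FiniteDimensional ℝ EB] [T2Space G]
    {P : PoissonStructure (DualBundle.model EG EB B) (DualBundle EG EB B)}
    (hbr : h.IsLinearBracket P.bracket) : IsPoissonLieGroup P := by
  refine { DualBundle.lieGroup with mul_poisson := fun f k p ↦ ?_ }
  obtain ⟨p, q⟩ := p
  change P.bracket (rightPullback q f) (rightPullback q k) p +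
    P.bracket (leftPullback p f) (leftPullback p k) q = P.bracket f k (p * q)
  let D : BundleFun EG EB B →ₗ[ℝ] BundleFun EG EB B →ₗ[ℝ] ℝ :=
    LinearMap.mk₂ ℝ (fun f k ↦ P.bracket (rightPullback q f) (rightPullback q k) p +
      P.bracket (leftPullback p f) (leftPullback p k) q - P.bracket f k (p * q))
      (fun f f' k ↦ by
        have e1 : rightPullback q (f + f') = rightPullback q f + rightPullback q f' := rfl
        have e2 : leftPullback p (f + f') = leftPullback p f + leftPullback p f' := rfl
        simp only [e1, e2, map_add, LinearMap.add_apply, ContMDiffMap.coe_add, Pi.add_apply]; ring)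
      (fun c f k ↦ by
        have e1 : rightPullback q (c • f) = c • rightPullback q f := rfl
        have e2 : leftPullback p (c • f) = c • leftPullback p f := rfl
        simp only [e1, e2, map_smul, LinearMap.smul_apply, ContMDiffMap.coe_smul, Pi.smul_apply,
          smul_sub, smul_add])
      (fun f k k' ↦ by
        have e1 : rightPullback q (k + k') = rightPullback q k + rightPullback q k' := rfl
        have e2 : leftPullback p (k + k') = leftPullback p k + leftPullback p k' := rfl
        simp only [e1, e2, map_add, ContMDiffMap.coe_add, Pi.add_apply]; ring)
      (fun c f k ↦ by
        have e1 : rightPullback q (c • k) = c • rightPullback q k := rfl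
        have e2 : leftPullback p (c • k) = c • leftPullback p k := rfl
        simp only [e1, e2, map_smul, ContMDiffMap.coe_smul, Pi.smul_apply, smul_sub, smul_add])
  have hD (f k) : D f k = P.bracket (rightPullback q f) (rightPullback q k) p +
      P.bracket (leftPullback p f) (leftPullback p k) q - P.bracket f k (p * q) := rfl
  have hR (f k) : rightPullback q (f * k) = rightPullback q f * rightPullback q k := rfl
  have hL (f k) : leftPullback p (f * k) = leftPullback p f * leftPullback p k := rfl
  have hs := bracket_swap_of_self P.bracket_self
  have hDs (f k) : D f k = -D k f := by
    rw [hD, hD, hs, hs (leftPullback p f), hs f]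
    simp only [ContMDiffMap.coe_neg, Pi.neg_apply]
    ring
  -- Right translation by `q` at `p` and left translation by `p` at `q` both evaluate at `p * q`, so
  -- the defect `D` is a biderivation at that single point.
  have hD2 (f k l) : D f (k * l) = D f k * l (p * q) + k (p * q) * D f l := by
    simp only [hD, hR, hL, P.leibniz, ContMDiffMap.coe_add, Pi.add_apply, ContMDiffMap.coe_mul,
      Pi.mul_apply, rightPullback_apply, leftPullback_apply]
    ring
  refine sub_eq_zero.1 (pointBiderivation_eq_zero (p := p * q) D (S := h.generators)
    (fun f g k ↦ ?_) hD2 (h.generators_separating _) (fun s hs t ht ↦ ?_) f k)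
  · rw [hDs, hD2, hDs k, hDs k]
    ring
  · rcases hs with ⟨y, rfl⟩ | ⟨f, rfl⟩ <;> rcases ht with ⟨z, rfl⟩ | ⟨g, rfl⟩
    · exact sub_eq_zero.2 (hbr.mul_ell_ell p q y z)
    · exact sub_eq_zero.2 (hbr.mul_ell_pullback p q y g)
    · rw [hDs, neg_eq_zero]
      exact sub_eq_zero.2 (hbr.mul_ell_pullback p q z f)
    · exact sub_eq_zero.2 (hbr.mul_pullback_pullback p q f g)

end HasSmoothSource

end Multiplicative

end MatchedPair

end

open MatchedPair in
theorem theorem3p1 {EG EB EC : Type*}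
    [NormedAddCommGroup EG] [NormedSpace ℝ EG] [FiniteDimensional ℝ EG]
    [NormedAddCommGroup EB] [NormedSpace ℝ EB] [FiniteDimensional ℝ EB]
    [NormedAddCommGroup EC] [NormedSpace ℝ EC] [FiniteDimensional ℝ EC]
    {G : Type*} [TopologicalSpace G] [T2Space G] [SecondCountableTopology G]
    [ChartedSpace EG G] [Group G] [LieGroup 𝓘(ℝ, EG) ∞ G]
    (B C : Subgroup G) [ChartedSpace EB B] [ChartedSpace EC C]
    [IsLieSubgroup EG EB B] [IsLieSubgroup EG EC C] (hBC : IsMatchedPair B C) :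
    -- right translations identify `𝔟⁰ × B` with `(TB)⁰ ⊆ T*G|_B`
    (∀ b : B, Set.BijOn (fun v : annihilator EG EB B ↦ (DualBundle.mk v b).covector) Set.univ
      (conormal EG EB B b)) ∧
    -- the bundle `(TB)⁰` is the dual of the Lie algebroid
    (∀ b : B, Function.Bijective (β := Module.Dual ℝ (algebroidFibre EG EB B C b))
      (fun v : annihilator EG EB B ↦ (DualBundle.mk v b).toDual C)) ∧
    -- the linear Poisson structure exists, is unique, and makes `𝔟⁰ ⋊ B` a Poisson–Lie group
    (∃! P : PoissonStructure (DualBundle.model EG EB B) (DualBundle EG EB B),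
      IsLinearPoisson C P) ∧
    ∀ P : PoissonStructure (DualBundle.model EG EB B) (DualBundle EG EB B),
      IsLinearPoisson C P → IsPoissonLieGroup P := by
  have := FiniteDimensional.complete ℝ EG
  have h : HasSmoothSource EG EB B C := IsMatchedPair.hasSmoothSource EG EB EC hBC
  refine ⟨covector_bijOn, h.toDual_bijective, ?_, fun P hP ↦
    (h.isLinearBracket_of_isLinearPoisson hP).isPoissonLieGroup⟩
  obtain ⟨br, hbr⟩ := h.exists_isLinearBracket
  let P : PoissonStructure (DualBundle.model EG EB B) (DualBundle EG EB B) :=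
    ⟨br, hbr.self, hbr.jacobi, hbr.leibniz⟩
  refine ⟨P, HasSmoothSource.IsLinearBracket.isLinearPoisson h (P := P) hbr, fun Q hQ ↦ ?_⟩
  -- A linear Poisson structure is determined by its values on generators, so any other one has the
  -- same bracket; the remaining fields are propositions.
  have e := (h.isLinearBracket_of_isLinearPoisson hQ).unique hbr
  obtain ⟨brQ, _, _, _⟩ := Q
  obtain rfl : brQ = br := e
  rfl
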